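/- Let $n\ge 1$ and let $\mathfrak g^{\mathbb C}=\mathfrak{sp}(2n,\mathbb C)$ be realized as the matrices $X=\begin{pmatrix}A&B\\ C&-A^{t}\end{pmatrix}$ with $B=B^t$, $C=C^t$. It acts on the Schwartz functions on $\mathbb R^n$ by the (complex linear extension of the) derivative of the Segal–Shale–Weil representation, $$\sigma_*(X)=\frac1{4\pi i}\sum_{k,l}B_{kl}\frac{\partial^2}{\partial x^k\partial x^l}-\pi i\sum_{k,l}C_{kl}x^kx^l-\sum_{k,l}A_{kl}x^l\frac{\partial}{\partial x^k}-\frac12\sum_kA_{kk}.$$ Let $S_+$ and $S_-$ be the Segal–Shale–Weil Harish-Chandra modules, i.e. the $\mathfrak g^{\mathbb C}$-modules of even, respectively odd, Schwartz functions on $\mathbb R^n$ that are finite under (the double cover of) the maximal compact subgroup $U(n)\subset Sp(2n,\mathbb R)$. Let $V=\mathbb R^{2n}$, and let $\mathfrak g^{\mathbb C}$ act on the complex-valued exterior forms $\bigwedge^{\bullet}V^*$ in the natural way and on $\bigwedge^{\bullet}V^*\otimes S_\pm$ by the tensor product action. Let $\mathfrak h=\left\{\begin{pmatrix}0&D\\-D&0\end{pmatrix}: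 D \text{ diagonal}\right\}$, a Cartan subalgebra of $\mathfrak g^{\mathbb C}$ (the complexification of a Cartan subalgebra of $\mathfrak u(n)$). Let $H_k\in\mathfrak h$ be the element with $D=i\,E_{kk}$, let $\epsilon_1,\dots,\epsilon_n$ be the basis of $\mathfrak h^*$ dual to $H_1,\dots,H_n$, and let the positive roots be $\epsilon_k-\epsilon_l$ $(k<l)$ and $\epsilon_k+\epsilon_l$ $(k\le l)$. Denote by $L(\lambda_1,\dots,\lambda_n)$ the irreducible highest weight $\mathfrak g^{\mathbb C}$-module with highest weight $\sum_k\lambda_k\epsilon_k$. Put $$\Xi=\{(i,j): 0\le i\le n,\ 0\le j\le i\}\cup\{(i,j): n+1\le i\le 2n,\ 0\le j\le 2n-i\},$$ $\mathrm{sgn}(+)=0$, $\mathrm{sgn}(-)=1$. For $0\le j\le i\le n$, $(i,j)\ne(n,n)$, let $$E^{ij}_\pm=L\Big(\underbrace{\tfrac12,\dots,\tfrac12}_{j},\underbrace{-\tfrac12,\dots,-\tfrac12}_{n-j-1},-1+\tfrac12(-1)^{i+j+\mathrm{sgn}(\pm)}\Big),$$ let $E^{nn}_+=L(\tfrac12,\dots,\tfrac12)$,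 $E^{nn}_-=L(\tfrac12,\dots,\tfrac12,-\tfrac52)$, and let $E^{ij}_\pm=E^{2n-i,j}_\pm$ for $n+1\le i\le 2n$, $0\le j\le 2n-i$. Then, for each of the two signs, there is a decomposition into irreducible $\mathfrak g^{\mathbb C}$-modules $$\bigwedge\nolimits^{\bullet}V^*\otimes S_\pm=\bigoplus_{(i,j)\in\Xi}E^{ij}_\pm,\qquad E^{ij}_\pm\subseteq\bigwedge\nolimits^{i}V^*\otimes S_\pm .$$ In particular, for every $0\le i\le n$, exactly $2(i+1)$ of the summands (both signs together) lie in degree $i$. -/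

import Mathlib

open scoped TensorProduct SchwartzMap LineDeriv ExteriorAlgebra
open Matrix

attribute [local instance 100] LieRing.ofAssociativeRing

namespace SymplecticSpinor

noncomputable section

/-! ### The Lie algebra and its defining representation -/

/-- The complexified symplectic Lie algebra `sp(2n, ℂ)`: block matrices `(A, B; C, -Aᵀ)` with
`B` and `C` symmetric. -/
abbrev SpC (n : ℕ) : Type := LieAlgebra.Symplectic.sp (Fin n) ℂ

/-- The complexification `ℂ²ⁿ` of the symplectic vector space `V = ℝ²ⁿ`; the Lie algebra `SpC n`
acts on it by the matrix-vector product, and on its dual by the contragredient action. -/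
abbrev VC (n : ℕ) : Type := Fin n ⊕ Fin n → ℂ

/-! ### The action on exterior forms -/

section Exterior

variable {R : Type*} [CommRing R] {M : Type*} [AddCommGroup M] [Module R M]

/-- Auxiliary: the algebra homomorphism `a ↦ (a, D a)` into the dual numbers over the exterior
algebra, where `D` is the derivation extending the endomorphism `f` of `M`. -/
def derivationAux (f : M →ₗ[R] M) :
    ExteriorAlgebra R M →ₐ[R] TrivSqZeroExt (ExteriorAlgebra R M) (ExteriorAlgebra R M) :=
  ExteriorAlgebra.lift R
    ⟨(TrivSqZeroExt.inlAlgHom R (ExteriorAlgebra R M) (ExteriorAlgebra R M)).toLinearMap ∘ₗ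
        ExteriorAlgebra.ι R +
      (TrivSqZeroExt.inrHom (ExteriorAlgebra R M) (ExteriorAlgebra R M)).restrictScalars R ∘ₗ
        ExteriorAlgebra.ι R ∘ₗ f, by
      intro m
      ext
      · simp
      · simp [ExteriorAlgebra.ι_add_mul_swap]⟩

/-- The derivation of the exterior algebra of `M` that extends the endomorphism `f` of `M`:
`m₁ ∧ ⋯ ∧ mᵢ ↦ ∑ₖ m₁ ∧ ⋯ ∧ f mₖ ∧ ⋯ ∧ mᵢ`. -/
def exteriorDerivation (f : M →ₗ[R] M) : ExteriorAlgebra R M →ₗ[R] ExteriorAlgebra R M where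
  toFun a := (derivationAux f a).snd
  map_add' a b := by simp
  map_smul' c a := by simp

lemma derivationAux_fst (f : M →ₗ[R] M) (a : ExteriorAlgebra R M) :
    (derivationAux f a).fst = a := by
  have : (TrivSqZeroExt.fstHom R (ExteriorAlgebra R M) (ExteriorAlgebra R M)).comp
      (derivationAux f) = AlgHom.id R _ := by
    apply ExteriorAlgebra.hom_ext
    ext m
    simp [derivationAux]
  exact DFunLike.congr_fun this a

lemma exteriorDerivation_ι (f : M →ₗ[R] M) (m : M) :
    exteriorDerivation f (ExteriorAlgebra.ι R m) = ExteriorAlgebra.ι R (f m) := by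
  simp [exteriorDerivation, derivationAux]

lemma exteriorDerivation_algebraMap (f : M →ₗ[R] M) (r : R) :
    exteriorDerivation f (algebraMap R _ r) = 0 := by
  simp [exteriorDerivation, TrivSqZeroExt.algebraMap_eq_inl']

lemma exteriorDerivation_mul (f : M →ₗ[R] M) (a b : ExteriorAlgebra R M) :
    exteriorDerivation f (a * b) = a * exteriorDerivation f b + exteriorDerivation f a * b := by
  simp [exteriorDerivation, derivationAux_fst]

lemma exteriorDerivation_add (f g : M →ₗ[R] M) (a : ExteriorAlgebra R M) :
    exteriorDerivation (f + g) a = exteriorDerivation f a + exteriorDerivation g a := by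
  induction a using ExteriorAlgebra.induction with
  | algebraMap r => simp [exteriorDerivation_algebraMap]
  | ι m => simp [exteriorDerivation_ι]
  | mul a b ha hb => simp only [exteriorDerivation_mul, ha, hb, mul_add, add_mul]; abel
  | add a b ha hb => simp only [map_add, ha, hb]; abel

lemma exteriorDerivation_smul (c : R) (f : M →ₗ[R] M) (a : ExteriorAlgebra R M) :
    exteriorDerivation (c • f) a = c • exteriorDerivation f a := by
  induction a using ExteriorAlgebra.induction with
  | algebraMap r => simp [exteriorDerivation_algebraMap]
  | ι m => simp [exteriorDerivation_ι]
  | mul a b ha hb => simp only [exteriorDerivation_mul, ha, hb, mul_smul_comm, smul_mul_assoc,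
      smul_add]
  | add a b ha hb => simp only [map_add, ha, hb, smul_add]

lemma exteriorDerivation_lie (f g : M →ₗ[R] M) (a : ExteriorAlgebra R M) :
    exteriorDerivation (f ∘ₗ g - g ∘ₗ f) a =
      exteriorDerivation f (exteriorDerivation g a) -
        exteriorDerivation g (exteriorDerivation f a) := by
  induction a using ExteriorAlgebra.induction with
  | algebraMap r => simp [exteriorDerivation_algebraMap]
  | ι m => simp [exteriorDerivation_ι]
  | mul a b ha hb =>
    simp only [exteriorDerivation_mul, ha, hb, map_add, mul_sub, sub_mul]; abel
  | add a b ha hb => simp only [map_add, ha, hb]; abel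

variable {L : Type*} [LieRing L] [LieAlgebra R L] [LieRingModule L M] [LieModule R L M]

/-- A Lie algebra acting on `M` acts on the exterior algebra of `M` by derivations. -/
instance instLieRingModuleExterior : LieRingModule L (ExteriorAlgebra R M) where
  bracket X a := exteriorDerivation (LieModule.toEnd R L M X) a
  add_lie X Y a := by simp [exteriorDerivation_add]
  lie_add X a b := by simp
  leibniz_lie X Y a := by
    have h := exteriorDerivation_lie (LieModule.toEnd R L M X) (LieModule.toEnd R L M Y) a
    have h2 : LieModule.toEnd R L M ⁅X, Y⁆ = LieModule.toEnd R L M X ∘ₗ LieModule.toEnd R L M Y -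
        LieModule.toEnd R L M Y ∘ₗ LieModule.toEnd R L M X := by
      rw [LieHom.map_lie]; rfl
    rw [h2, h]; abel

instance instLieModuleExterior : LieModule R L (ExteriorAlgebra R M) where
  smul_lie c X a := by
    change exteriorDerivation (LieModule.toEnd R L M (c • X)) a = _
    rw [map_smul, exteriorDerivation_smul]; rfl
  lie_smul c X a := by
    change exteriorDerivation (LieModule.toEnd R L M X) (c • a) = _
    rw [map_smul]; rfl

end Exterior

/-- Exterior forms on `V` (with complex coefficients), of all degrees, with the action of `SpC n`
by derivations. -/
abbrev Forms (n : ℕ) : Type := ExteriorAlgebra ℂ (Module.Dual ℂ (VC n))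

/-! ### The infinitesimal Segal–Shale–Weil representation -/

/-- The space of complex-valued Schwartz functions on `ℝⁿ`. -/
abbrev Schwartz (n : ℕ) : Type := 𝓢(EuclideanSpace ℝ (Fin n), ℂ)

/-- Multiplication of Schwartz functions by the `k`-th coordinate. -/
def mulCoord {n : ℕ} (k : Fin n) : Module.End ℂ (Schwartz n) :=
  (SchwartzMap.smulLeftCLM ℂ (fun x : EuclideanSpace ℝ (Fin n) => ((x k : ℝ) : ℂ))).toLinearMap

/-- The `k`-th partial derivative of Schwartz functions. -/
def partialDeriv {n : ℕ} (k : Fin n) : Module.End ℂ (Schwartz n) where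
  toFun f := ∂_{EuclideanSpace.single k (1 : ℝ)} f
  map_add' f g := LineDeriv.lineDerivOp_add _ f g
  map_smul' c f := LineDeriv.lineDerivOp_smul _ c f

lemma mulCoord_apply {n : ℕ} (k : Fin n) (f : Schwartz n) (x : EuclideanSpace ℝ (Fin n)) :
    mulCoord k f x = (x k : ℂ) * f x := by
  have h : (fun x : EuclideanSpace ℝ (Fin n) => ((x k : ℝ) : ℂ)).HasTemperateGrowth := by
    exact (Complex.ofRealCLM ∘L
      (EuclideanSpace.proj k : EuclideanSpace ℝ (Fin n) →L[ℝ] ℝ)).hasTemperateGrowth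
  simp [mulCoord, SchwartzMap.smulLeftCLM_apply_apply h]

lemma partialDeriv_apply {n : ℕ} (k : Fin n) (f : Schwartz n) (x : EuclideanSpace ℝ (Fin n)) :
    partialDeriv k f x = fderiv ℝ f x (EuclideanSpace.single k 1) := rfl

lemma mulCoord_comm {n : ℕ} (k l : Fin n) :
    (mulCoord k * mulCoord l : Module.End ℂ (Schwartz n)) = mulCoord l * mulCoord k := by
  ext f x
  simp only [Module.End.mul_apply, mulCoord_apply]
  ring

lemma partialDeriv_comm {n : ℕ} (k l : Fin n) :
    (partialDeriv k * partialDeriv l : Module.End ℂ (Schwartz n)) =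
      partialDeriv l * partialDeriv k := by
  ext f x
  have key : ∀ i j : Fin n, partialDeriv i (partialDeriv j f) x =
      fderiv ℝ (fderiv ℝ f) x (EuclideanSpace.single i 1) (EuclideanSpace.single j 1) := by
    intro i j
    rw [partialDeriv_apply]
    have h1 : (fun y => (partialDeriv j f) y) =
        fun y => fderiv ℝ f y (EuclideanSpace.single j 1) := rfl
    have h2 : DifferentiableAt ℝ (fderiv ℝ f) x :=
      ((f.smooth 2).fderiv_right (m := 1) (by norm_num)).differentiable (by norm_num) x
    change fderiv ℝ (fun y => fderiv ℝ f y (EuclideanSpace.single j 1)) x _ = _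
    rw [fderiv_clm_apply h2 (differentiableAt_const _)]
    simp
  simp only [Module.End.mul_apply, key]
  have hs : IsSymmSndFDerivAt ℝ f x :=
    (f.smooth 2).contDiffAt.isSymmSndFDerivAt (by simp)
  exact hs _ _

lemma partialDeriv_mulCoord {n : ℕ} (k l : Fin n) :
    (partialDeriv k * mulCoord l : Module.End ℂ (Schwartz n)) =
      mulCoord l * partialDeriv k + if k = l then 1 else 0 := by
  ext f x
  have h : HasFDerivAt (fun y : EuclideanSpace ℝ (Fin n) => ((y l : ℝ) : ℂ))
      (Complex.ofRealCLM ∘L (EuclideanSpace.proj l : EuclideanSpace ℝ (Fin n) →L[ℝ] ℝ)) x :=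
    (Complex.ofRealCLM ∘L (EuclideanSpace.proj l : EuclideanSpace ℝ (Fin n) →L[ℝ] ℝ)).hasFDerivAt
  have h2 := h.mul (f.hasFDerivAt (x := x))
  have h3 : (fun y => (mulCoord l f) y) = (fun y => ((y l : ℝ) : ℂ) * f y) :=
    funext fun y => mulCoord_apply l f y
  have h4 : fderiv ℝ (mulCoord l f) x = _ := (congrArg (fderiv ℝ · x) h3).trans h2.fderiv
  have h5 : (if k = l then (1 : Module.End ℂ (Schwartz n)) else 0) f x =
      (if l = k then 1 else 0) * f x := by
    by_cases hkl : k = l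
    · simp [hkl]
    · simp [hkl, Ne.symm hkl]
  simp only [Module.End.mul_apply, LinearMap.add_apply, _root_.add_apply, mulCoord_apply,
    partialDeriv_apply, h4, h5]
  by_cases hkl : l = k <;> simp [hkl, mul_comm]

section Quadratic

variable {n : ℕ} {A : Type*} [Ring A] [Algebra ℂ A]

/-- Auxiliary: the element `∑ Mᵢⱼ uᵢ vⱼ` of an associative algebra. -/
def quad (u v : Fin n → A) (M : Matrix (Fin n) (Fin n) ℂ) : A := ∑ i, ∑ j, M i j • (u i * v j)

lemma quad_add (u v : Fin n → A) (M N : Matrix (Fin n) (Fin n) ℂ) :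
    quad u v (M + N) = quad u v M + quad u v N := by
  simp [quad, add_smul, Finset.sum_add_distrib]

lemma quad_smul (u v : Fin n → A) (c : ℂ) (M : Matrix (Fin n) (Fin n) ℂ) :
    quad u v (c • M) = c • quad u v M := by
  simp [quad, mul_smul, Finset.smul_sum]

lemma quad_neg (u v : Fin n → A) (M : Matrix (Fin n) (Fin n) ℂ) :
    quad u v (-M) = -quad u v M := by
  simp [quad]

lemma quad_sub (u v : Fin n → A) (M N : Matrix (Fin n) (Fin n) ℂ) :
    quad u v (M - N) = quad u v M - quad u v N := by
  rw [sub_eq_add_neg, quad_add, quad_neg, sub_eq_add_neg]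

lemma quad_swap (u v : Fin n → A) (t : ℂ)
    (h : ∀ i j, u i * v j = v j * u i + if i = j then t • (1 : A) else 0)
    (M : Matrix (Fin n) (Fin n) ℂ) :
    quad u v M = quad v u Mᵀ + (t * M.trace) • (1 : A) := by
  simp only [quad, h, smul_add, Finset.sum_add_distrib, Matrix.transpose_apply]
  congr 1
  · exact Finset.sum_comm
  · simp [Matrix.trace, Finset.mul_sum, Finset.sum_smul, smul_smul, mul_comm]

lemma quad_bracket (u v u' v' : Fin n → A) (p q r s : ℂ)
    (hp : ∀ i j, v i * u' j = u' j * v i + if i = j then p • (1 : A) else 0)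
    (hq : ∀ i j, v i * v' j = v' j * v i + if i = j then q • (1 : A) else 0)
    (hr : ∀ i j, u i * u' j = u' j * u i + if i = j then r • (1 : A) else 0)
    (hs : ∀ i j, u i * v' j = v' j * u i + if i = j then s • (1 : A) else 0)
    (M N : Matrix (Fin n) (Fin n) ℂ) :
    quad u v M * quad u' v' N - quad u' v' N * quad u v M =
      p • quad u v' (M * N) + q • quad u u' (M * Nᵀ) + r • quad v' v (Nᵀ * M) +
        s • quad u' v (N * M) := by
  have key : ∀ i j k l, u i * v j * (u' k * v' l) - u' k * v' l * (u i * v j) =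
      (if j = k then p • (u i * v' l) else 0) + (if j = l then q • (u i * u' k) else 0) +
      (if i = k then r • (v' l * v j) else 0) + (if i = l then s • (u' k * v j) else 0) := by
    intro i j k l
    have e1 : u i * v j * (u' k * v' l) =
        u i * (v j * u' k - u' k * v j) * v' l + u i * u' k * (v j * v' l - v' l * v j) +
        (u i * u' k - u' k * u i) * v' l * v j + u' k * (u i * v' l - v' l * u i) * v j +
        u' k * v' l * (u i * v j) := by noncomm_ring
    rw [e1, sub_eq_iff_eq_add'.2 (hp j k), sub_eq_iff_eq_add'.2 (hq j l),
      sub_eq_iff_eq_add'.2 (hr i k), sub_eq_iff_eq_add'.2 (hs i l)]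
    split_ifs <;> simp
  have lhs : quad u v M * quad u' v' N - quad u' v' N * quad u v M =
      ∑ i, ∑ j, ∑ k, ∑ l, (M i j * N k l) •
        (u i * v j * (u' k * v' l) - u' k * v' l * (u i * v j)) := by
    have a1 : quad u v M * quad u' v' N = ∑ i, ∑ j, ∑ k, ∑ l, (M i j * N k l) •
        (u i * v j * (u' k * v' l)) := by
      simp only [quad, Finset.sum_mul]
      simp only [Finset.mul_sum, smul_mul_smul_comm]
    have a2 : quad u' v' N * quad u v M = ∑ i, ∑ j, ∑ k, ∑ l, (M i j * N k l) •
        (u' k * v' l * (u i * v j)) := by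
      simp only [quad, Finset.mul_sum]
      simp only [Finset.sum_mul, smul_mul_smul_comm]
      simp only [mul_comm]
    rw [a1, a2]
    simp only [smul_sub, Finset.sum_sub_distrib]
  rw [lhs]
  simp only [key, smul_add, Finset.sum_add_distrib, quad, Matrix.mul_apply, Finset.sum_smul,
    Finset.smul_sum, smul_ite, smul_zero, Finset.sum_ite_irrel, Finset.sum_const_zero,
    Finset.sum_ite_eq, Finset.mem_univ, if_true, smul_smul, Matrix.transpose_apply]
  congr 1
  · congr 1
    · congr 1
      · refine Finset.sum_congr rfl fun i _ => Finset.sum_comm.trans ?_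
        simp only [mul_comm]
      · refine Finset.sum_congr rfl fun i _ => Finset.sum_comm.trans ?_
        simp only [mul_comm]
    · refine (Finset.sum_comm.trans (Finset.sum_congr rfl fun _ _ => Finset.sum_comm)).trans
        (Finset.sum_comm.trans ?_)
      simp only [mul_comm]
  · refine (Finset.sum_comm.trans (Finset.sum_congr rfl fun _ _ => Finset.sum_comm)).trans
        (Finset.sum_comm.trans ?_)
    simp only [mul_comm]

end Quadratic

/-- The blocks of a symplectic matrix: `X = (A, B; C, -Aᵀ)` with `B`, `C` symmetric. -/
lemma blocks {n : ℕ} (X : SpC n) : X.1.toBlocks₂₂ = -X.1.toBlocks₁₁ᵀ ∧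
    X.1.toBlocks₁₂ᵀ = X.1.toBlocks₁₂ ∧ X.1.toBlocks₂₁ᵀ = X.1.toBlocks₂₁ := by
  have h := X.2
  change X.1 ∈ skewAdjointMatricesLieSubalgebra (Matrix.J (Fin n) ℂ) at h
  rw [mem_skewAdjointMatricesLieSubalgebra, mem_skewAdjointMatricesSubmodule, Matrix.IsSkewAdjoint, Matrix.IsAdjointPair,
    ← Matrix.fromBlocks_toBlocks X.1, Matrix.J, Matrix.fromBlocks_transpose, Matrix.fromBlocks_neg,
    Matrix.fromBlocks_multiply, Matrix.fromBlocks_multiply, Matrix.fromBlocks_inj] at h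
  simp only [Matrix.mul_zero, Matrix.mul_one, Matrix.zero_mul, Matrix.one_mul, Matrix.mul_neg,
    Matrix.neg_mul, zero_add, add_zero, neg_neg, neg_zero] at h
  obtain ⟨h1, h2, h3, h4⟩ := h
  refine ⟨?_, ?_, ?_⟩
  · exact h2.symm
  · exact (neg_injective h4)
  · exact h1

/-- The infinitesimal Segal–Shale–Weil representation: the complex linear extension of the
derivative of the Segal–Shale–Weil representation of the metaplectic group, on Schwartz functions.
A matrix `X = (A, B; C, -Aᵀ)` acts as
`(4πi)⁻¹ ∑ Bₖₗ ∂ₖ∂ₗ - πi ∑ Cₖₗ xₖxₗ - ∑ Aₖₗ xₗ∂ₖ - (tr A)/2`. -/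
def weilOp {n : ℕ} (X : Matrix (Fin n ⊕ Fin n) (Fin n ⊕ Fin n) ℂ) : Module.End ℂ (Schwartz n) :=
  (1 / (4 * (Real.pi : ℂ) * Complex.I)) •
      ∑ k, ∑ l, X.toBlocks₁₂ k l • (partialDeriv k * partialDeriv l) -
    ((Real.pi : ℂ) * Complex.I) • ∑ k, ∑ l, X.toBlocks₂₁ k l • (mulCoord k * mulCoord l) -
    ∑ k, ∑ l, X.toBlocks₁₁ k l • (mulCoord l * partialDeriv k) -
    ((1 / 2 : ℂ) * ∑ k, X.toBlocks₁₁ k k) • 1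

lemma weilOp_eq {n : ℕ} (X : Matrix (Fin n ⊕ Fin n) (Fin n ⊕ Fin n) ℂ) :
    weilOp X = (1 / (4 * (Real.pi : ℂ) * Complex.I)) •
        quad partialDeriv partialDeriv X.toBlocks₁₂ -
      ((Real.pi : ℂ) * Complex.I) • quad mulCoord mulCoord X.toBlocks₂₁ -
      quad mulCoord partialDeriv X.toBlocks₁₁ᵀ - ((1 / 2 : ℂ) * X.toBlocks₁₁.trace) • 1 := by
  have h : quad mulCoord partialDeriv X.toBlocks₁₁ᵀ =
      ∑ k, ∑ l, X.toBlocks₁₁ k l • (mulCoord l * partialDeriv k : Module.End ℂ (Schwartz n)) :=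
    Finset.sum_comm
  rw [h]
  rfl

lemma weilOp_add {n : ℕ} (X Y : Matrix (Fin n ⊕ Fin n) (Fin n ⊕ Fin n) ℂ) :
    weilOp (X + Y) = weilOp X + weilOp Y := by
  have h1 : (X + Y).toBlocks₁₁ = X.toBlocks₁₁ + Y.toBlocks₁₁ := rfl
  have h2 : (X + Y).toBlocks₁₂ = X.toBlocks₁₂ + Y.toBlocks₁₂ := rfl
  have h3 : (X + Y).toBlocks₂₁ = X.toBlocks₂₁ + Y.toBlocks₂₁ := rfl
  simp only [weilOp_eq, h1, h2, h3, Matrix.transpose_add, quad_add, Matrix.trace_add]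
  module

lemma weilOp_smul {n : ℕ} (c : ℂ) (X : Matrix (Fin n ⊕ Fin n) (Fin n ⊕ Fin n) ℂ) :
    weilOp (c • X) = c • weilOp X := by
  have h1 : (c • X).toBlocks₁₁ = c • X.toBlocks₁₁ := rfl
  have h2 : (c • X).toBlocks₁₂ = c • X.toBlocks₁₂ := rfl
  have h3 : (c • X).toBlocks₂₁ = c • X.toBlocks₂₁ := rfl
  simp only [weilOp_eq, h1, h2, h3, Matrix.transpose_smul, quad_smul, Matrix.trace_smul,
    smul_eq_mul]
  module

lemma weilOp_lie {n : ℕ} (X Y : SpC n) :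
    weilOp (⁅X, Y⁆ : SpC n).1 = weilOp X.1 * weilOp Y.1 - weilOp Y.1 * weilOp X.1 := by
  obtain ⟨hX, hXB, hXC⟩ := blocks X
  obtain ⟨hY, hYB, hYC⟩ := blocks Y
  have hXY : (⁅X, Y⁆ : SpC n).1 = X.1 * Y.1 - Y.1 * X.1 := rfl
  have hb : X.1 * Y.1 - Y.1 * X.1 = Matrix.fromBlocks
      (X.1.toBlocks₁₁ * Y.1.toBlocks₁₁ + X.1.toBlocks₁₂ * Y.1.toBlocks₂₁ -
        (Y.1.toBlocks₁₁ * X.1.toBlocks₁₁ + Y.1.toBlocks₁₂ * X.1.toBlocks₂₁))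
      (X.1.toBlocks₁₁ * Y.1.toBlocks₁₂ + X.1.toBlocks₁₂ * Y.1.toBlocks₂₂ -
        (Y.1.toBlocks₁₁ * X.1.toBlocks₁₂ + Y.1.toBlocks₁₂ * X.1.toBlocks₂₂))
      (X.1.toBlocks₂₁ * Y.1.toBlocks₁₁ + X.1.toBlocks₂₂ * Y.1.toBlocks₂₁ -
        (Y.1.toBlocks₂₁ * X.1.toBlocks₁₁ + Y.1.toBlocks₂₂ * X.1.toBlocks₂₁))
      (X.1.toBlocks₂₁ * Y.1.toBlocks₁₂ + X.1.toBlocks₂₂ * Y.1.toBlocks₂₂ -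
        (Y.1.toBlocks₂₁ * X.1.toBlocks₁₂ + Y.1.toBlocks₂₂ * X.1.toBlocks₂₂)) := by
    conv_lhs => rw [← Matrix.fromBlocks_toBlocks X.1, ← Matrix.fromBlocks_toBlocks Y.1]
    rw [Matrix.fromBlocks_multiply, Matrix.fromBlocks_multiply, sub_eq_add_neg,
      Matrix.fromBlocks_neg, Matrix.fromBlocks_add]
    simp only [sub_eq_add_neg]
  rw [hXY, hb]
  rw [weilOp_eq, weilOp_eq, weilOp_eq]
  simp only [Matrix.toBlocks_fromBlocks₁₁, Matrix.toBlocks_fromBlocks₁₂,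
    Matrix.toBlocks_fromBlocks₂₁, hX, hY]
  generalize X.1.toBlocks₁₁ = A at *
  generalize X.1.toBlocks₁₂ = B at *
  generalize X.1.toBlocks₂₁ = C at *
  generalize Y.1.toBlocks₁₁ = A' at *
  generalize Y.1.toBlocks₁₂ = B' at *
  generalize Y.1.toBlocks₂₁ = C' at *
  have hπ : (Real.pi : ℂ) ≠ 0 := by exact_mod_cast Real.pi_ne_zero
  have hI : Complex.I ≠ 0 := Complex.I_ne_zero
  obtain ⟨c, hc⟩ : ∃ c : ℂ, c = 1 / (4 * (Real.pi : ℂ) * Complex.I) := ⟨_, rfl⟩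
  obtain ⟨e, he⟩ : ∃ e : ℂ, e = (Real.pi : ℂ) * Complex.I := ⟨_, rfl⟩
  have hce : c * e = 1 / 4 := by rw [hc, he]; field_simp
  rw [← hc, ← he]
  clear hc he hXY hb hX hY
  obtain ⟨x, hx⟩ : ∃ x : Fin n → Module.End ℂ (Schwartz n), x = mulCoord := ⟨_, rfl⟩
  obtain ⟨d, hd⟩ : ∃ d : Fin n → Module.End ℂ (Schwartz n), d = partialDeriv := ⟨_, rfl⟩
  rw [← hx, ← hd]
  have xx : ∀ i j, x i * x j = x j * x i + if i = j then (0 : ℂ) • 1 else 0 := by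
    intro i j; rw [hx, mulCoord_comm i j]; simp
  have dd : ∀ i j, d i * d j = d j * d i + if i = j then (0 : ℂ) • 1 else 0 := by
    intro i j; rw [hd, partialDeriv_comm i j]; simp
  have dx : ∀ i j, d i * x j = x j * d i + if i = j then (1 : ℂ) • 1 else 0 := by
    intro i j; rw [hx, hd, partialDeriv_mulCoord i j]; simp
  have xd : ∀ i j, x i * d j = d j * x i + if i = j then (-1 : ℂ) • 1 else 0 := by
    intro i j; rw [dx j i]; by_cases h : i = j
    · simp [h]
    · simp [h, Ne.symm h]
  clear hx hd
  have dxsw : ∀ M, quad d x M = quad x d Mᵀ + M.trace • 1 := fun M => by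
    rw [quad_swap d x 1 dx, one_mul]
  have bb := quad_bracket d d d d 0 0 0 0 dd dd dd dd B B'
  have qq := quad_bracket x x x x 0 0 0 0 xx xx xx xx C C'
  have aa := quad_bracket x d x d 1 0 0 (-1) dx dd xx xd Aᵀ A'ᵀ
  have bq := quad_bracket d d x x 1 1 1 1 dx dx dx dx B C'
  have bq' := quad_bracket d d x x 1 1 1 1 dx dx dx dx B' C
  have ba := quad_bracket d d x d 1 0 1 0 dx dd dx dd B A'ᵀ
  have ba' := quad_bracket d d x d 1 0 1 0 dx dd dx dd B' Aᵀ
  have qa := quad_bracket x x x d 0 (-1) 0 (-1) xx xd xx xd C A'ᵀ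
  have qa' := quad_bracket x x x d 0 (-1) 0 (-1) xx xd xx xd C' Aᵀ
  have expand : ∀ (b q a b' q' a' : Module.End ℂ (Schwartz n)) (t t' : ℂ),
      (c • b - e • q - a - t • 1) * (c • b' - e • q' - a' - t' • 1) -
        (c • b' - e • q' - a' - t' • 1) * (c • b - e • q - a - t • 1) =
      (c * c) • (b * b' - b' * b) - (c * e) • (b * q' - q' * b) - c • (b * a' - a' * b) +
        (c * e) • (b' * q - q * b') + (e * e) • (q * q' - q' * q) + e • (q * a' - a' * q) +
        c • (b' * a - a * b') - e • (q' * a - a * q') + (a * a' - a' * a) := by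
    intro b q a b' q' a' t t'
    simp only [mul_sub, sub_mul, smul_mul_assoc, mul_smul_comm, mul_one,
      one_mul]
    module
  rw [expand, bb, qq, aa, bq, bq', ba, ba', qa, qa', hce]
  simp only [dxsw, Matrix.transpose_mul, Matrix.transpose_transpose, hXB, hXC, hYB, hYC,
    Matrix.transpose_sub, Matrix.transpose_add, quad_sub, quad_add, Matrix.trace_sub,
    Matrix.trace_add, Matrix.mul_neg, Matrix.neg_mul, quad_neg, Matrix.trace_mul_comm A' A]
  module

instance instLieRingModuleSchwartz (n : ℕ) : LieRingModule (SpC n) (Schwartz n) where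
  bracket X f := weilOp X.1 f
  add_lie X Y f := by
    change weilOp (X.1 + Y.1) f = _
    rw [weilOp_add]; rfl
  lie_add X f g := map_add _ f g
  leibniz_lie X Y f := by
    change _ = weilOp (⁅X, Y⁆ : SpC n).1 f + _
    rw [weilOp_lie]
    simp

instance instLieModuleSchwartz (n : ℕ) : LieModule ℂ (SpC n) (Schwartz n) where
  smul_lie c X f := by
    change weilOp (c • X.1) f = _
    rw [weilOp_smul]; rfl
  lie_smul c X f := map_smul _ c f

/-! ### The Harish-Chandra modules of even and odd symplectic spinors -/

/-- The complexified Lie algebra `𝔨` of the maximal compact subgroup `U(n)` of `Sp(2n, ℝ)`, i.e. of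
the stabilizer of the standard compatible complex structure `J`: the elements of `sp(2n, ℂ)`
commuting with `J`. -/
def IsCompactElement {n : ℕ} (X : SpC n) : Prop := Commute X.1 (Matrix.J (Fin n) ℂ)

/-- A Schwartz function is `K`-finite if it lies in a finite-dimensional subspace that is stable
under `𝔨`. (As the double cover of `U(n)` is connected, this is the same as being finite under the
double cover of `U(n)`.) -/
def IsKFinite {n : ℕ} (f : Schwartz n) : Prop :=
  ∃ F : Submodule ℂ (Schwartz n), F.FG ∧ f ∈ F ∧
    ∀ X : SpC n, IsCompactElement X → ∀ g ∈ F, ⁅X, g⁆ ∈ F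

lemma IsKFinite.lie {n : ℕ} {f : Schwartz n} (hf : IsKFinite f) (X : SpC n) :
    IsKFinite ⁅X, f⁆ := by
  obtain ⟨F, hF, hfF, hst⟩ := hf
  have hfin : (⊤ : Submodule ℂ (SpC n)).FG := Module.Finite.fg_top
  refine ⟨Submodule.map₂ (LieModule.toEnd ℂ (SpC n) (Schwartz n)).toLinearMap ⊤ F,
    hfin.map₂ _ hF, Submodule.apply_mem_map₂ _ trivial hfF, ?_⟩
  intro Y hY g hg
  have hle : Submodule.map₂ (LieModule.toEnd ℂ (SpC n) (Schwartz n)).toLinearMap ⊤ F ≤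
      (Submodule.map₂ (LieModule.toEnd ℂ (SpC n) (Schwartz n)).toLinearMap ⊤ F).comap
        (LieModule.toEnd ℂ (SpC n) (Schwartz n) Y) := by
    rw [Submodule.map₂_le]
    intro Z _ h hh
    change ⁅Y, ⁅Z, h⁆⁆ ∈ Submodule.map₂ (LieModule.toEnd ℂ (SpC n) (Schwartz n)).toLinearMap ⊤ F
    rw [leibniz_lie]
    exact Submodule.add_mem _
      (Submodule.apply_mem_map₂ (LieModule.toEnd ℂ (SpC n) (Schwartz n)).toLinearMap
        (m := ⁅Y, Z⁆) trivial hh)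
      (Submodule.apply_mem_map₂ (LieModule.toEnd ℂ (SpC n) (Schwartz n)).toLinearMap
        (m := Z) trivial (hst Y hY h hh))
  exact hle hg

/-- The functions `f` with `f (-x) = ε f x` for all `x`. -/
def parity (n : ℕ) (ε : ℂ) : Submodule ℂ (Schwartz n) where
  carrier := {f | ∀ x, f (-x) = ε * f x}
  zero_mem' := by simp
  add_mem' := by
    intro f g hf hg x
    simp only [Set.mem_ofPred_eq] at hf hg
    simp [hf x, hg x, mul_add]
  smul_mem' := by
    intro c f hf x
    simp only [Set.mem_ofPred_eq] at hf
    simp [hf x, mul_left_comm]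

lemma mulCoord_parity {n : ℕ} {ε : ℂ} (k : Fin n) {f : Schwartz n} (hf : f ∈ parity n ε) :
    mulCoord k f ∈ parity n (-ε) := by
  intro x
  rw [mulCoord_apply, mulCoord_apply, hf x]
  simp [mul_left_comm]

lemma partialDeriv_parity {n : ℕ} {ε : ℂ} (k : Fin n) {f : Schwartz n} (hf : f ∈ parity n ε) :
    partialDeriv k f ∈ parity n (-ε) := by
  intro x
  have h : (fun y => f (-y)) = fun y => ε * f y := funext hf
  have h1 : HasFDerivAt (fun y => f (-y))
      ((fderiv ℝ f (-x)).comp (-ContinuousLinearMap.id ℝ (EuclideanSpace ℝ (Fin n)))) x :=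
    (f.hasFDerivAt (x := -x)).comp x (hasFDerivAt_id x).neg
  rw [h] at h1
  have h2 := h1.unique ((f.hasFDerivAt (x := x)).const_mul ε)
  have h3 := congrArg (fun T => T (EuclideanSpace.single k 1)) h2
  simp only [ContinuousLinearMap.comp_apply, _root_.neg_apply, ContinuousLinearMap.id_apply,
    map_neg, _root_.smul_apply, smul_eq_mul] at h3
  rw [partialDeriv_apply, partialDeriv_apply, neg_mul, ← h3, neg_neg]

lemma weilOp_parity {n : ℕ} {ε : ℂ} (X : Matrix (Fin n ⊕ Fin n) (Fin n ⊕ Fin n) ℂ)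
    {f : Schwartz n} (hf : f ∈ parity n ε) : weilOp X f ∈ parity n ε := by
  have mm : ∀ {u v : Module.End ℂ (Schwartz n)},
      (∀ {δ : ℂ} {g : Schwartz n}, g ∈ parity n δ → u g ∈ parity n (-δ)) →
      (∀ {δ : ℂ} {g : Schwartz n}, g ∈ parity n δ → v g ∈ parity n (-δ)) →
      (u * v) f ∈ parity n ε := by
    intro u v hu hv
    have := hu (hv hf)
    rwa [neg_neg] at this
  simp only [weilOp, LinearMap.sub_apply, LinearMap.smul_apply, LinearMap.sum_apply]
  refine Submodule.sub_mem _ (Submodule.sub_mem _ (Submodule.sub_mem _ ?_ ?_) ?_) ?_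
  · exact Submodule.smul_mem _ _ (Submodule.sum_mem _ fun k _ => Submodule.sum_mem _ fun l _ =>
      Submodule.smul_mem _ _ (mm (partialDeriv_parity k) (partialDeriv_parity l)))
  · exact Submodule.smul_mem _ _ (Submodule.sum_mem _ fun k _ => Submodule.sum_mem _ fun l _ =>
      Submodule.smul_mem _ _ (mm (mulCoord_parity k) (mulCoord_parity l)))
  · exact Submodule.sum_mem _ fun k _ => Submodule.sum_mem _ fun l _ =>
      Submodule.smul_mem _ _ (mm (mulCoord_parity l) (partialDeriv_parity k))
  · exact Submodule.smul_mem _ _ hf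

/-- The Segal–Shale–Weil Harish-Chandra module of even (`s = 0`) respectively odd (`s = 1`)
symplectic spinors: the `K`-finite Schwartz functions with `f (-x) = (-1)ˢ f x`. -/
def Spinor (n : ℕ) (s : Fin 2) : LieSubmodule ℂ (SpC n) (Schwartz n) where
  carrier := {f | IsKFinite f ∧ ∀ x, f (-x) = (-1) ^ (s : ℕ) * f x}
  zero_mem' := ⟨⟨⊥, Submodule.fg_bot, Submodule.zero_mem _, by simp⟩,
    (parity n ((-1) ^ (s : ℕ))).zero_mem⟩
  add_mem' := by
    rintro f g ⟨⟨F, hF, hfF, hFst⟩, hf⟩ ⟨⟨G, hG, hgG, hGst⟩, hg⟩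
    refine ⟨⟨F ⊔ G, hF.sup hG, Submodule.add_mem_sup hfF hgG, ?_⟩,
      (parity n ((-1) ^ (s : ℕ))).add_mem hf hg⟩
    intro X hX h hh
    obtain ⟨a, ha, b, hb, rfl⟩ := Submodule.mem_sup.1 hh
    rw [lie_add]
    exact Submodule.add_mem_sup (hFst X hX a ha) (hGst X hX b hb)
  smul_mem' := by
    rintro c f ⟨⟨F, hF, hfF, hFst⟩, hf⟩
    exact ⟨⟨F, hF, F.smul_mem c hfF, hFst⟩, (parity n ((-1) ^ (s : ℕ))).smul_mem c hf⟩
  lie_mem := by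
    rintro X f ⟨hf, hf'⟩
    exact ⟨hf.lie X, weilOp_parity X.1 (ε := (-1) ^ (s : ℕ)) hf'⟩

/-- Exterior forms with values in the even (`s = 0`) respectively odd (`s = 1`) symplectic spinors,
`Λ^• V^* ⊗ S_±`, with the tensor product action of `sp(2n, ℂ)`. -/
abbrev SpinorForms (n : ℕ) (s : Fin 2) : Type := Forms n ⊗[ℂ] Spinor n s

/-- The subspace `Λ^i V^* ⊗ S_±` of `Λ^• V^* ⊗ S_±`. -/
def degreePart (n : ℕ) (s : Fin 2) (i : ℕ) : Submodule ℂ (SpinorForms n s) :=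
  LinearMap.range (LinearMap.rTensor (Spinor n s) (⋀[ℂ]^i (Module.Dual ℂ (VC n))).subtype)

/-! ### Highest weight modules -/

/-- The elements `H₁, …, Hₙ` of the standard basis of the Cartan subalgebra
`𝔥 = {(0, D; -D, 0) | D diagonal}` of `sp(2n, ℂ)` (the complexification of a Cartan subalgebra of
the Lie algebra of `U(n)`). The dual basis of `𝔥^*` is denoted `ε₁, …, εₙ`, and an element
`λ` of `𝔥^*` is represented by its values `λ(Hₖ)`, i.e. its coordinates in the basis `εₖ`. -/
def cartanH {n : ℕ} (k : Fin n) : SpC n :=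
  ⟨Matrix.fromBlocks 0 (Matrix.single k k Complex.I) (Matrix.single k k (-Complex.I)) 0, by
    change _ ∈ skewAdjointMatricesLieSubalgebra (Matrix.J (Fin n) ℂ)
    rw [mem_skewAdjointMatricesLieSubalgebra, mem_skewAdjointMatricesSubmodule,
      Matrix.IsSkewAdjoint, Matrix.IsAdjointPair, Matrix.J, Matrix.fromBlocks_transpose,
      Matrix.fromBlocks_neg, Matrix.fromBlocks_multiply, Matrix.fromBlocks_multiply]
    simp⟩

/-- The positive roots `εₖ - εₗ` (`k < l`) and `εₖ + εₗ` (including `2εₖ`). -/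
def positiveRoots (n : ℕ) : Set (Fin n → ℂ) :=
  {α | (∃ k l : Fin n, k < l ∧ α = Pi.single k 1 - Pi.single l 1) ∨
    ∃ k l : Fin n, α = Pi.single k 1 + Pi.single l 1}

/-- `X` is in the root space of `α`. -/
def IsRootVector {n : ℕ} (α : Fin n → ℂ) (X : SpC n) : Prop :=
  ∀ k, ⁅cartanH k, X⁆ = α k • X

section HighestWeight

variable {n : ℕ} {M : Type*} [AddCommGroup M] [Module ℂ M] [LieRingModule (SpC n) M]

/-- `m` is a highest weight vector of weight `λ = ∑ₖ lam k · εₖ`. -/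
def IsHighestWeightVector (lam : Fin n → ℂ) (m : M) : Prop :=
  m ≠ 0 ∧ (∀ k, ⁅cartanH k, m⁆ = lam k • m) ∧
    ∀ α ∈ positiveRoots n, ∀ X : SpC n, IsRootVector α X → ⁅X, m⁆ = 0

variable (M) in
/-- `M` is the irreducible highest weight module `L(λ)` with highest weight
`λ = ∑ₖ lam k · εₖ`. -/
structure IsIrreducibleHighestWeightModule (lam : Fin n → ℂ) : Prop where
  irreducible : LieModule.IsIrreducible ℂ (SpC n) M
  exists_highestWeightVector : ∃ m : M, IsHighestWeightVector lam m

end HighestWeight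

/-! ### The highest weights of the higher symplectic spinor modules -/

/-- The index set `Ξ`. -/
def Xi (n : ℕ) : Set (ℕ × ℕ) :=
  {p | (p.1 ≤ n ∧ p.2 ≤ p.1) ∨ (n + 1 ≤ p.1 ∧ p.1 ≤ 2 * n ∧ p.2 ≤ 2 * n - p.1)}

/-- The highest weight of `E^{ij}_±` for `j ≤ i ≤ n` (`s = 0` for `+` and `s = 1` for `-`). Here
`k = 0, …, n - 1`, so `k + 1 = n` is the last coordinate. -/
def lowerWeight (n : ℕ) (s : Fin 2) (i j : ℕ) (k : Fin n) : ℂ :=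
  if i = n ∧ j = n then
    if (k : ℕ) + 1 = n ∧ s = 1 then -5 / 2 else 1 / 2
  else if (k : ℕ) + 1 = n then -1 + 1 / 2 * (-1) ^ (i + j + (s : ℕ))
  else if (k : ℕ) < j then 1 / 2 else -1 / 2

/-- The highest weight of `E^{ij}_±` for `(i, j) ∈ Ξ`: for `i > n` it is that of
`E^{2n-i,j}_±`. -/
def spinorWeight (n : ℕ) (s : Fin 2) (i j : ℕ) : Fin n → ℂ :=
  if i ≤ n then lowerWeight n s i j else lowerWeight n s (2 * n - i) j

end

end SymplecticSpinor

open SymplecticSpinor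

/-!
The proof is an instance of Howe duality for the pair `(𝔰𝔭(2n), 𝔬𝔰𝔭(1|2))`, carried out inside a
Fock space.

The `K`-finite Schwartz functions are acted on by the creation operators `zₖ = 2πxₖ - ∂ₖ` and the
annihilation operators `dₖ = (∂ₖ + 2πxₖ) / 4π`; the latter are locally nilpotent on them, since
`zₖ dₖ + c` is injective for `Re c > 0` (`eq_zero_of_creS_annS`, `IsKFinite.exists_annS_pow`). The
exterior forms are acted on by exterior multiplications and contractions, for a basis of covectors
`ξₖ`, `ηₖ` of weights `εₖ`, `-εₖ`. Together these form a representation of the canonical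
commutation and anticommutation relations (`Fock`) with a unique vacuum, the constant form with
value the Gaussian (`isVacuum_total`), and `𝔰𝔭(2n)` acts through bilinear expressions in the
operators: `genX`, `genY`, `genE`. The even and the odd spinors are treated at once, and are
separated at the end by the parity operator.

Two further odd operators `Fp = ∑ zₖ ξₖ - dₖ ηₖ` and `Fm = ∑ zₖ ∂/∂ηₖ + dₖ ∂/∂ξₖ`, of degrees `1`
and `-1`, commute with `𝔰𝔭(2n)` and satisfy `Fp Fm + Fm Fp = n - deg`, so that they generate
`𝔬𝔰𝔭(1|2)`. As for `𝔰𝔩(2)`, the product `Fp Fm` is diagonalizable on the forms of degree `i`, its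
eigenspaces are the images `Fp ^ (i - j)` of the primitive vectors (the kernel of `Fm`) of degree
`j` for `j ≤ min i (2n - i)`, and `Fp` maps each of these isomorphically onto the next one in the
range (`mem_iSup_sector_of_le`, `mem_iSup_sector_of_ge`). This is the decomposition indexed by
`Ξ`. It remains to show that the primitive vectors of given degree `j ≤ n` and parity form an
irreducible module, and to find its highest weight.

Every nonzero submodule contains a singular vector, because the element `height` of the Cartan
subalgebra has natural numbers as eigenvalues and is lowered by the positive root vectors. The
primitive singular vectors of degree `j ≤ n` can be classified (`IsSingular.isTop`): they are the
multiples of `ξ₁ ⋯ ξⱼ` and `ξ₁ ⋯ ξⱼ zₙ`, applied to the vacuum, except that for `j = n` the second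
of these is not primitive and is replaced by a combination of `∑ dₖ ηₖ w` and `∑ zₖ ξₖ w` with `w
= ξ₁ ⋯ ξₙ₋₁ zₙ²`. In particular there is exactly one of each parity. Irreducibility follows by
duality (`part_irreducible_self`): the functionals in the contragredient Fock space that
annihilate a proper submodule would contain a nonzero singular vector as well, which by the
classification does not vanish on the singular vector of the same kind in the original space; but
that singular vector lies in the submodule.
-/

namespace SymplecticSpinor

/-! ### Diagonalizable operators on spaces of arbitrary dimension -/

section Diagonalizable

open Module.End

variable {K V : Type*} [Field K] [AddCommGroup V] [Module K V]

lemma mem_of_sum_eigenvectors_mem {T : Module.End K V} {p : Submodule K V}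
    (hp : ∀ u ∈ p, T u ∈ p) (s : Finset K) :
    ∀ u : K → V, (∀ μ ∈ s, T (u μ) = μ • u μ) → ∑ μ ∈ s, u μ ∈ p → ∀ μ ∈ s, u μ ∈ p := by
  classical
  induction s using Finset.induction_on with
  | empty => simp
  | insert ν s hν ih =>
    intro u hu hsum
    have h1 : ∀ μ ∈ s, (μ - ν) • u μ ∈ p := by
      refine ih (fun μ => (μ - ν) • u μ) ?_ ?_
      · intro μ hμ
        rw [map_smul, hu μ (Finset.mem_insert_of_mem hμ), smul_comm]
      · have h2 : ∑ μ ∈ s, (μ - ν) • u μ =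
            T (∑ μ ∈ insert ν s, u μ) - ν • ∑ μ ∈ insert ν s, u μ := by
          rw [map_sum, Finset.smul_sum, ← Finset.sum_sub_distrib, Finset.sum_insert hν,
            hu ν (Finset.mem_insert_self _ _), sub_self, zero_add]
          exact Finset.sum_congr rfl fun μ hμ => by
            rw [hu μ (Finset.mem_insert_of_mem hμ), sub_smul]
        rw [h2]
        exact p.sub_mem (hp _ hsum) (p.smul_mem _ hsum)
    have h3 : ∀ μ ∈ s, u μ ∈ p := by
      intro μ hμ
      have hne : μ - ν ≠ 0 := sub_ne_zero.2 fun h => hν (h ▸ hμ)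
      exact (p.smul_mem_iff hne).1 (h1 μ hμ)
    intro μ hμ
    rcases Finset.mem_insert.1 hμ with rfl | hμ
    · rw [Finset.sum_insert hν] at hsum
      exact (p.add_mem_iff_left (p.sum_mem h3)).1 hsum
    · exact h3 μ hμ

/-- A stable subspace of a diagonalizable operator is spanned by the eigenvectors it contains. -/
lemma le_iSup_inf_eigenspace {J : Type*} {e : J → K} (he : Function.Injective e)
    {T : Module.End K V} (hT : ⨆ j, eigenspace T (e j) = ⊤) {p : Submodule K V}
    (hp : ∀ u ∈ p, T u ∈ p) : p ≤ ⨆ j, p ⊓ eigenspace T (e j) := by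
  classical
  rcases isEmpty_or_nonempty J with hJ | hJ
  · rw [iSup_of_empty] at hT
    exact le_top.trans (hT ▸ bot_le)
  intro x hx
  have hx' : x ∈ ⨆ j, eigenspace T (e j) := hT ▸ Submodule.mem_top
  obtain ⟨m, hm, rfl⟩ := (Submodule.mem_iSup_iff_exists_finsupp _ _).1 hx'
  have key : ∀ j ∈ m.support, m j ∈ p := by
    have hinv : ∀ j, Function.invFun e (e j) = j := Function.leftInverse_invFun he
    intro j hj
    have := mem_of_sum_eigenvectors_mem hp (m.support.image e)
      (fun μ => m (Function.invFun e μ)) ?_ ?_ (e j) (Finset.mem_image_of_mem _ hj)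
    · simpa [hinv] using this
    · intro μ hμ
      obtain ⟨i, -, rfl⟩ := Finset.mem_image.1 hμ
      simpa [hinv] using mem_eigenspace_iff.1 (hm i)
    · rw [Finset.sum_image he.injOn]
      simpa [hinv, Finsupp.sum] using hx
  refine Submodule.sum_mem _ fun j hj => ?_
  exact Submodule.mem_iSup_of_mem j ⟨key j hj, hm j⟩

/-- Commuting diagonalizable operators are simultaneously diagonalizable. -/
lemma iSup_iInf_eigenspace_eq_top {ι J : Type*} [Fintype ι] {e : J → K}
    (he : Function.Injective e) (T : ι → Module.End K V)
    (hc : ∀ i j, T i * T j = T j * T i) (hT : ∀ i, ⨆ j, eigenspace (T i) (e j) = ⊤) :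
    ⨆ o : ι → J, ⨅ i, eigenspace (T i) (e (o i)) = ⊤ := by
  classical
  rcases isEmpty_or_nonempty ι with hι | ⟨⟨i₀⟩⟩
  · rw [eq_top_iff]
    exact le_iSup_of_le (fun i => (hι.false i).elim) (by simp)
  rcases isEmpty_or_nonempty J with hJ | hJ
  · have h := hT i₀
    rw [iSup_of_empty] at h
    exact top_le_iff.1 (h ▸ bot_le)
  have key : ∀ s : Finset ι, ⨆ o : ι → J, ⨅ i ∈ s, eigenspace (T i) (e (o i)) = ⊤ := by
    intro s
    induction s using Finset.induction_on with
    | empty => simp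
    | insert a s ha ih =>
      rw [eq_top_iff, ← ih]
      refine iSup_le fun o => ?_
      refine (le_iSup_inf_eigenspace he (hT a) (p := ⨅ i ∈ s, eigenspace (T i) (e (o i)))
        ?_).trans (iSup_le fun j => ?_)
      · intro u hu
        simp only [Submodule.mem_iInf, mem_eigenspace_iff] at hu ⊢
        intro i hi
        have := LinearMap.congr_fun (hc i a) u
        simp only [Module.End.mul_apply] at this
        rw [this, hu i hi, map_smul]
      · refine le_iSup_of_le (Function.update o a j) ?_
        intro u hu
        simp only [Submodule.mem_inf, Submodule.mem_iInf, Finset.mem_insert] at hu ⊢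
        rintro i (rfl | hi)
        · simpa using hu.2
        · rw [Function.update_of_ne (fun h : i = a => ha (h ▸ hi))]
          exact hu.1 i hi
  simpa using key Finset.univ

/-- If an operator is a scalar on each member of a family of subspaces that span, then it has no
other eigenvalues. -/
lemma eq_zero_of_eigenvalue_ne {ι : Type*} {W : ι → Submodule K V} (hW : ⨆ o, W o = ⊤)
    {T : Module.End K V} {t : ι → K} (hT : ∀ o, ∀ u ∈ W o, T u = t o • u) {μ : K}
    (hμ : ∀ o, W o ≠ ⊥ → t o ≠ μ) {u : V} (hu : T u = μ • u) : u = 0 := by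
  have h1 : (⊤ : Submodule K V) ≤ ⨆ ν, ⨆ _ : ν ≠ μ, eigenspace T ν := by
    rw [← hW]
    refine iSup_le fun o => ?_
    by_cases ho : W o = ⊥
    · simp [ho]
    · exact le_iSup₂_of_le (t o) (hμ o ho) fun v hv => mem_eigenspace_iff.2 (hT o v hv)
  have h2 := eigenspaces_iSupIndep T μ
  rw [top_le_iff.1 h1, disjoint_top] at h2
  have : u ∈ eigenspace T μ := mem_eigenspace_iff.2 hu
  rwa [h2] at this

end Diagonalizable

/-! ### Representations of the canonical (anti)commutation relations -/

section Boson

variable {V : Type*} [AddCommGroup V] [Module ℂ V] {z d : Module.End ℂ V}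

lemma annihilation_pow (h : d * z = z * d + 1) (r : ℕ) (y : V) :
    d ((z ^ (r + 1)) y) = (z ^ (r + 1)) (d y) + ((r : ℂ) + 1) • (z ^ r) y := by
  induction r generalizing y with
  | zero => simpa using LinearMap.congr_fun h y
  | succ r ih =>
    have hz : ∀ m (w : V), (z ^ (m + 1)) w = (z ^ m) (z w) := fun m w => by
      rw [pow_succ, Module.End.mul_apply]
    rw [hz (r + 1), ih, hz (r + 1) (d y)]
    have h2 := LinearMap.congr_fun h y
    simp only [Module.End.mul_apply, LinearMap.add_apply, Module.End.one_apply] at h2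
    rw [h2, map_add, ← hz r y]
    push_cast
    module

/-- If the annihilation operator of a bosonic mode is locally nilpotent, then the number operator is
diagonalizable with eigenvalues `0, 1, 2, …`. -/
lemma iSup_eigenspace_boson (h : d * z = z * d + 1) (hd : ∀ u, ∃ r : ℕ, (d ^ r) u = 0) :
    ⨆ m : ℕ, Module.End.eigenspace (z * d) (m : ℂ) = ⊤ := by
  have vac : ∀ (r : ℕ) (y : V), d y = 0 → (d ^ r) ((z ^ r) y) = (r.factorial : ℂ) • y := by
    intro r
    induction r with
    | zero => simp
    | succ r ih =>
      intro y hy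
      rw [pow_succ, Module.End.mul_apply, annihilation_pow h, hy, map_zero, zero_add, map_smul,
        ih y hy, smul_smul, Nat.factorial_succ]
      push_cast; rfl
  have eig : ∀ (r : ℕ) (y : V), d y = 0 → (z * d) ((z ^ r) y) = (r : ℂ) • (z ^ r) y := by
    intro r y hy
    cases r with
    | zero => simp [hy]
    | succ r =>
      rw [Module.End.mul_apply, annihilation_pow h, hy, map_zero, zero_add, map_smul,
        ← Module.End.mul_apply, ← pow_succ']
      push_cast; rfl
  have key : ∀ (r : ℕ) (u : V), (d ^ r) u = 0 →
      u ∈ ⨆ m : ℕ, Module.End.eigenspace (z * d) (m : ℂ) := by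
    intro r
    induction r with
    | zero => intro u hu; simp only [pow_zero, Module.End.one_apply] at hu; simp [hu]
    | succ r ih =>
      intro u hu
      have hy : d ((d ^ r) u) = 0 := by rwa [← Module.End.mul_apply, ← pow_succ']
      have hf : (r.factorial : ℂ) ≠ 0 := by exact_mod_cast r.factorial_ne_zero
      have h1 := ih (u - (r.factorial : ℂ)⁻¹ • (z ^ r) ((d ^ r) u)) (by
        rw [map_sub, map_smul, vac r _ hy, smul_smul, inv_mul_cancel₀ hf, one_smul, sub_self])
      have h2 : (z ^ r) ((d ^ r) u) ∈ ⨆ m : ℕ, Module.End.eigenspace (z * d) (m : ℂ) :=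
        Submodule.mem_iSup_of_mem r (Module.End.mem_eigenspace_iff.2 (eig r _ hy))
      have := Submodule.add_mem _ h1 (Submodule.smul_mem _ (r.factorial : ℂ)⁻¹ h2)
      rwa [sub_add_cancel] at this
  rw [eq_top_iff]
  rintro u -
  obtain ⟨r, hr⟩ := hd u
  exact key r u hr

lemma iSup_eigenspace_idempotent {P : Module.End ℂ V} (h : P * P = P) :
    ⨆ m : ℕ, Module.End.eigenspace P (m : ℂ) = ⊤ := by
  rw [eq_top_iff]
  rintro u -
  have h' : ∀ u, P (P u) = P u := fun u => LinearMap.congr_fun h u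
  have h0 : u - P u ∈ ⨆ m : ℕ, Module.End.eigenspace P (m : ℂ) :=
    Submodule.mem_iSup_of_mem 0 (Module.End.mem_eigenspace_iff.2 (by simp [h']))
  have h1 : P u ∈ ⨆ m : ℕ, Module.End.eigenspace P (m : ℂ) :=
    Submodule.mem_iSup_of_mem 1 (Module.End.mem_eigenspace_iff.2 (by simp [h']))
  simpa using Submodule.add_mem _ h0 h1

end Boson

lemma eq_zero_of_eq_neg_self {W : Type*} [AddCommGroup W] [Module ℂ W] {w : W} (h : w = -w) :
    w = 0 := by
  have h2 : (2 : ℂ) • w = 0 := by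
    rw [two_smul]
    nth_rewrite 2 [h]
    exact add_neg_cancel w
  exact (smul_eq_zero.1 h2).resolve_left two_ne_zero

/-- A representation on `M` of the canonical commutation relations of `n` bosonic modes, with
creation operators `z k` and locally nilpotent annihilation operators `d k`, together with the
canonical anticommutation relations of `2n` fermionic modes, with creation operators `c i` and
annihilation operators `a i`. -/
structure Fock (n : ℕ) (M : Type*) [AddCommGroup M] [Module ℂ M] where
  /-- bosonic creation operators -/
  z : Fin n → Module.End ℂ M
  /-- bosonic annihilation operators -/
  d : Fin n → Module.End ℂ M
  /-- fermionic creation operators -/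
  c : Fin n ⊕ Fin n → Module.End ℂ M
  /-- fermionic annihilation operators -/
  a : Fin n ⊕ Fin n → Module.End ℂ M
  zz : ∀ k l, z k * z l = z l * z k
  dd : ∀ k l, d k * d l = d l * d k
  dz : ∀ k l, d k * z l = z l * d k + if k = l then 1 else 0
  cc : ∀ i j, c i * c j = -(c j * c i)
  aa : ∀ i j, a i * a j = -(a j * a i)
  ac : ∀ i j, a i * c j = -(c j * a i) + if i = j then 1 else 0
  zc : ∀ k i, z k * c i = c i * z k
  za : ∀ k i, z k * a i = a i * z k
  dc : ∀ k i, d k * c i = c i * d k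
  da : ∀ k i, d k * a i = a i * d k
  nilpotent : ∀ k u, ∃ r : ℕ, (d k ^ r) u = 0

namespace Fock

variable {n : ℕ} {M : Type*} [AddCommGroup M] [Module ℂ M] (F : Fock n M)

/-- The creation operator `ξₖ`, of weight `εₖ`. -/
abbrev x (k : Fin n) : Module.End ℂ M := F.c (Sum.inl k)
/-- The creation operator `ηₖ`, of weight `-εₖ`. -/
abbrev y (k : Fin n) : Module.End ℂ M := F.c (Sum.inr k)
/-- The annihilation operator `∂/∂ξₖ`, of weight `-εₖ`. -/
abbrev dx (k : Fin n) : Module.End ℂ M := F.a (Sum.inl k)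
/-- The annihilation operator `∂/∂ηₖ`, of weight `εₖ`. -/
abbrev dy (k : Fin n) : Module.End ℂ M := F.a (Sum.inr k)

lemma aa_self (i) : F.a i * F.a i = 0 := eq_zero_of_eq_neg_self (F.aa i i)

/-- The number operators of all bosonic and fermionic modes. -/
def num : Fin n ⊕ (Fin n ⊕ Fin n) → Module.End ℂ M
  | Sum.inl k => F.z k * F.d k
  | Sum.inr i => F.c i * F.a i

/-! Commutators of bilinear expressions with single operators. -/

lemma ca_c (i j m) : F.c i * F.a j * F.c m = F.c m * (F.c i * F.a j) +
    if j = m then F.c i else 0 := by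
  rw [mul_assoc, F.ac, mul_add, mul_neg, ← mul_assoc, F.cc i m]
  split_ifs <;> simp [mul_assoc]

lemma ca_a (i j m) : F.c i * F.a j * F.a m = F.a m * (F.c i * F.a j) -
    if m = i then F.a j else 0 := by
  rw [mul_assoc, F.aa j m, mul_neg, ← mul_assoc, ← mul_assoc, F.ac m i, add_mul]
  split_ifs <;> simp

lemma ca_z (i j m) : F.c i * F.a j * F.z m = F.z m * (F.c i * F.a j) := by
  rw [mul_assoc, ← F.za, ← mul_assoc, ← F.zc, mul_assoc]

lemma ca_d (i j m) : F.c i * F.a j * F.d m = F.d m * (F.c i * F.a j) := by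
  rw [mul_assoc, ← F.da, ← mul_assoc, ← F.dc, mul_assoc]

lemma zd_z (k l m) : F.z k * F.d l * F.z m = F.z m * (F.z k * F.d l) +
    if l = m then F.z k else 0 := by
  rw [mul_assoc, F.dz, mul_add, ← mul_assoc, F.zz k m]
  split_ifs <;> simp [mul_assoc]

lemma zd_d (k l m) : F.z k * F.d l * F.d m = F.d m * (F.z k * F.d l) -
    if m = k then F.d l else 0 := by
  rw [mul_assoc, F.dd l m, ← mul_assoc, ← mul_assoc, F.dz m k, add_mul]
  split_ifs <;> simp

lemma zd_c (k l m) : F.z k * F.d l * F.c m = F.c m * (F.z k * F.d l) := by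
  rw [mul_assoc, F.dc, ← mul_assoc, F.zc, mul_assoc]

lemma zd_a (k l m) : F.z k * F.d l * F.a m = F.a m * (F.z k * F.d l) := by
  rw [mul_assoc, F.da, ← mul_assoc, F.za, mul_assoc]

lemma dd_z (k l m) : F.d k * F.d l * F.z m = F.z m * (F.d k * F.d l) +
    ((if l = m then F.d k else 0) + if k = m then F.d l else 0) := by
  rw [mul_assoc, F.dz, mul_add, ← mul_assoc, F.dz k m, add_mul]
  split_ifs <;> simp [mul_assoc, add_comm, add_assoc]

lemma dd_d (k l m) : F.d k * F.d l * F.d m = F.d m * (F.d k * F.d l) := by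
  rw [mul_assoc, F.dd l m, ← mul_assoc, F.dd k m, mul_assoc]

lemma dd_c (k l m) : F.d k * F.d l * F.c m = F.c m * (F.d k * F.d l) := by
  rw [mul_assoc, F.dc, ← mul_assoc, F.dc, mul_assoc]

lemma dd_a (k l m) : F.d k * F.d l * F.a m = F.a m * (F.d k * F.d l) := by
  rw [mul_assoc, F.da, ← mul_assoc, F.da, mul_assoc]

lemma zz_d (k l m) : F.z k * F.z l * F.d m = F.d m * (F.z k * F.z l) -
    ((if m = k then F.z l else 0) + if m = l then F.z k else 0) := by
  have h1 := F.dz m k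
  have h2 := F.dz m l
  rw [← mul_assoc, h1, add_mul, mul_assoc (F.z k) (F.d m), h2, mul_add]
  split_ifs <;> simp [mul_assoc]
  abel

lemma zz_z (k l m) : F.z k * F.z l * F.z m = F.z m * (F.z k * F.z l) := by
  rw [mul_assoc, F.zz l m, ← mul_assoc, F.zz k m, mul_assoc]

lemma zz_c (k l m) : F.z k * F.z l * F.c m = F.c m * (F.z k * F.z l) := by
  rw [mul_assoc, F.zc, ← mul_assoc, F.zc, mul_assoc]

lemma zz_a (k l m) : F.z k * F.z l * F.a m = F.a m * (F.z k * F.z l) := by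
  rw [mul_assoc, F.za, ← mul_assoc, F.za, mul_assoc]

lemma num_idempotent (i) : F.c i * F.a i * (F.c i * F.a i) = F.c i * F.a i := by
  rw [← mul_assoc, F.ca_c]
  simp [add_mul, mul_assoc, F.aa_self]

lemma num_comm (p q) : F.num p * F.num q = F.num q * F.num p := by
  rcases p with k | i <;> rcases q with l | j <;> simp only [num]
  · rw [← mul_assoc, zd_z, add_mul, mul_assoc (F.z l), zd_d, mul_sub, mul_assoc (F.z l)]
    by_cases h : k = l
    · subst h; simp
    · simp [h, Ne.symm h]
  · rw [← mul_assoc, zd_c, mul_assoc, zd_a, mul_assoc]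
  · rw [← mul_assoc, ca_z, mul_assoc, ca_d, mul_assoc]
  · rw [← mul_assoc, ca_c, add_mul, mul_assoc (F.c j), ca_a, mul_sub, mul_assoc (F.c j)]
    by_cases h : i = j
    · subst h; simp
    · simp [h, Ne.symm h]

/-- The vectors with prescribed occupation numbers of all modes. -/
def Occ (o : Fin n ⊕ (Fin n ⊕ Fin n) → ℕ) : Submodule ℂ M :=
  ⨅ p, Module.End.eigenspace (F.num p) (o p : ℂ)

lemma mem_occ {o : Fin n ⊕ (Fin n ⊕ Fin n) → ℕ} {u : M} :
    u ∈ F.Occ o ↔ ∀ p, F.num p u = (o p : ℂ) • u := by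
  simp [Occ]

lemma iSup_occ : ⨆ o, F.Occ o = ⊤ := by
  refine iSup_iInf_eigenspace_eq_top (e := fun m : ℕ => (m : ℂ)) Nat.cast_injective F.num
    F.num_comm ?_
  rintro (k | i)
  · exact iSup_eigenspace_boson (by simpa using F.dz k k) (F.nilpotent k)
  · exact iSup_eigenspace_idempotent (F.num_idempotent i)

/-- The exclusion principle. -/
lemma occ_fermion_le_one {o : Fin n ⊕ (Fin n ⊕ Fin n) → ℕ} (h : F.Occ o ≠ ⊥) (i) :
    o (Sum.inr i) ≤ 1 := by
  obtain ⟨u, hu, hu0⟩ := Submodule.exists_mem_ne_zero_of_ne_bot h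
  have h1 : F.c i (F.a i u) = (o (Sum.inr i) : ℂ) • u := F.mem_occ.1 hu (Sum.inr i)
  have h2 : (F.c i * F.a i * (F.c i * F.a i)) u = (F.c i * F.a i) u := by rw [num_idempotent]
  simp only [Module.End.mul_apply] at h2
  simp only [h1, map_smul, smul_smul] at h2
  have h3 : ((o (Sum.inr i) : ℂ) * o (Sum.inr i) - o (Sum.inr i)) • u = 0 := by
    rw [sub_smul, h2, sub_self]
  have h4 := (smul_eq_zero.1 h3).resolve_right hu0
  have h5 : o (Sum.inr i) * o (Sum.inr i) = o (Sum.inr i) := by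
    have := sub_eq_zero.1 h4
    exact_mod_cast this
  by_contra hlt
  nlinarith

/-- An operator that is a function of the occupation numbers has only the eigenvalues that this
function takes on occupation numbers obeying the exclusion principle. -/
lemma eq_zero_of_spectrum {T : Module.End ℂ M} {t : (Fin n ⊕ (Fin n ⊕ Fin n) → ℕ) → ℂ}
    (hT : ∀ o, ∀ u ∈ F.Occ o, T u = t o • u) {μ : ℂ}
    (hμ : ∀ o : Fin n ⊕ (Fin n ⊕ Fin n) → ℕ, (∀ i, o (Sum.inr i) ≤ 1) → t o ≠ μ) {u : M}
    (hu : T u = μ • u) : u = 0 :=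
  eq_zero_of_eigenvalue_ne F.iSup_occ hT (fun o ho => hμ o (F.occ_fermion_le_one ho)) hu

end Fock

/-! ### Operators that shift eigenvalues -/

/-- The operator `X` raises the eigenvalues of `T` by `κ`. -/
def Shifts {V : Type*} [AddCommGroup V] [Module ℂ V] (T X : Module.End ℂ V) (κ : ℂ) : Prop :=
  T * X = X * T + κ • X

namespace Shifts

variable {V : Type*} [AddCommGroup V] [Module ℂ V] {T T' X Y : Module.End ℂ V} {κ κ' : ℂ}

lemma apply (h : Shifts T X κ) (u : V) : T (X u) = X (T u) + κ • X u :=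
  LinearMap.congr_fun h u

lemma apply_of_eigen (h : Shifts T X κ) {u : V} {μ : ℂ} (hu : T u = μ • u) :
    T (X u) = (μ + κ) • X u := by
  rw [h.apply, hu, map_smul, add_smul]

lemma mul (h : Shifts T X κ) (h' : Shifts T Y κ') : Shifts T (X * Y) (κ + κ') := by
  unfold Shifts at *
  rw [← mul_assoc, h, add_mul, mul_assoc, h', mul_add]
  simp only [mul_assoc, smul_mul_assoc, mul_smul_comm, add_smul]
  abel

lemma add (h : Shifts T X κ) (h' : Shifts T Y κ) : Shifts T (X + Y) κ := by
  unfold Shifts at *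
  rw [mul_add, h, h', add_mul, smul_add]
  abel

lemma sub (h : Shifts T X κ) (h' : Shifts T Y κ) : Shifts T (X - Y) κ := by
  unfold Shifts at *
  rw [mul_sub, h, h', sub_mul, smul_sub]
  abel

lemma sum {ι : Type*} {s : Finset ι} {X : ι → Module.End ℂ V}
    (h : ∀ i ∈ s, Shifts T (X i) κ) : Shifts T (∑ i ∈ s, X i) κ := by
  unfold Shifts at *
  rw [Finset.mul_sum, Finset.sum_mul, Finset.smul_sum, ← Finset.sum_add_distrib]
  exact Finset.sum_congr rfl h

lemma add_left (h : Shifts T X κ) (h' : Shifts T' X κ') : Shifts (T + T') X (κ + κ') := by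
  unfold Shifts at *
  rw [add_mul, h, h', mul_add, add_smul]
  abel

lemma sub_left (h : Shifts T X κ) (h' : Shifts T' X κ') : Shifts (T - T') X (κ - κ') := by
  unfold Shifts at *
  rw [sub_mul, h, h', mul_sub, sub_smul]
  abel

lemma smul_left (h : Shifts T X κ) (c : ℂ) : Shifts (c • T) X (c * κ) := by
  unfold Shifts at *
  rw [smul_mul_assoc, h, smul_add, mul_smul_comm, smul_smul]

lemma one_left : Shifts 1 X 0 := by simp [Shifts]

lemma sum_left {ι : Type*} {s : Finset ι} {T : ι → Module.End ℂ V} {κ : ι → ℂ}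
    (h : ∀ i ∈ s, Shifts (T i) X (κ i)) : Shifts (∑ i ∈ s, T i) X (∑ i ∈ s, κ i) := by
  unfold Shifts at *
  rw [Finset.sum_mul, Finset.mul_sum, Finset.sum_smul, ← Finset.sum_add_distrib]
  exact Finset.sum_congr rfl h

lemma of_eq (h : Shifts T X κ) (e : κ = κ') : Shifts T X κ' := e ▸ h

end Shifts

/-! ### The symplectic Lie algebra and its partner `𝔬𝔰𝔭(1|2)` on the Fock space -/

section Anticommutator

variable {A : Type*} [Ring A] {n : ℕ}

lemma anticommutator_sum [Algebra ℂ A] (u v p q : Fin n → A) (a b : ℂ)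
    (huq : ∀ k l, u k * q l = q l * u k) (hvp : ∀ k l, v k * p l = p l * v k)
    (hpq : ∀ k l, p k * q l = -(q l * p k) + if k = l then a • (1 : A) else 0)
    (huv : ∀ k l, u k * v l = v l * u k + if k = l then b • (1 : A) else 0) :
    (∑ k, u k * p k) * (∑ l, v l * q l) + (∑ l, v l * q l) * (∑ k, u k * p k) =
      a • ∑ k, u k * v k - b • ∑ k, q k * p k := by
  have key : ∀ k l, u k * p k * (v l * q l) + v l * q l * (u k * p k) =
      (if k = l then a • (u k * v l) else 0) - (if k = l then b • (q l * p k) else 0) := by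
    intro k l
    have e1 : u k * p k * (v l * q l) = u k * v l * (p k * q l) := by
      rw [mul_assoc, ← mul_assoc (p k), ← hvp, mul_assoc (v l), ← mul_assoc]
    have e2 : v l * q l * (u k * p k) = v l * u k * (q l * p k) := by
      rw [mul_assoc, ← mul_assoc (q l), ← huq, mul_assoc (u k), ← mul_assoc]
    rw [e1, e2, hpq, mul_add, huv]
    split_ifs
    · simp only [mul_neg, add_mul, smul_mul_assoc, one_mul, mul_smul_comm, mul_one]
      abel
    · simp
  rw [Finset.sum_mul_sum, Finset.sum_mul_sum, Finset.sum_comm (γ := Fin n)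
    (f := fun l k => v l * q l * (u k * p k)), ← Finset.sum_add_distrib]
  simp only [← Finset.sum_add_distrib, key, Finset.sum_sub_distrib, Finset.sum_ite_eq,
    Finset.mem_univ, if_true, Finset.smul_sum]

lemma mul_sum_of_commutators (T : A) (u p U P : Fin n → A) (hu : ∀ m, T * u m = u m * T + U m)
    (hp : ∀ m, T * p m = p m * T + P m) :
    T * ∑ m, u m * p m = (∑ m, u m * p m) * T + ∑ m, (u m * P m + U m * p m) := by
  rw [Finset.mul_sum, Finset.sum_mul, ← Finset.sum_add_distrib]
  refine Finset.sum_congr rfl fun m _ => ?_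
  rw [← mul_assoc, hu, add_mul, mul_assoc, hp, mul_add, mul_assoc]
  abel

end Anticommutator

namespace Fock

variable {n : ℕ} {M : Type*} [AddCommGroup M] [Module ℂ M] (F : Fock n M)

/-- The operator of `𝔰𝔭(2n)` of weight `εₖ + εₗ`. -/
def genX (k l : Fin n) : Module.End ℂ M := F.d k * F.d l + (F.x k * F.dy l + F.x l * F.dy k)

/-- The operator of `𝔰𝔭(2n)` of weight `-εₖ - εₗ`. -/
def genY (k l : Fin n) : Module.End ℂ M := F.z k * F.z l - (F.y k * F.dx l + F.y l * F.dx k)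

/-- The operator of `𝔰𝔭(2n)` of weight `εₖ - εₗ`, up to a scalar for `k = l`. -/
def genE (k l : Fin n) : Module.End ℂ M := F.x k * F.dx l - F.y l * F.dy k - F.z l * F.d k

/-- `∑ zₖ ξₖ` -/
def zeta : Module.End ℂ M := ∑ k, F.z k * F.x k
/-- `∑ zₖ ∂/∂ηₖ` -/
def del : Module.End ℂ M := ∑ k, F.z k * F.dy k
/-- `∑ ∂/∂zₖ ∂/∂ξₖ` -/
def div : Module.End ℂ M := ∑ k, F.d k * F.dx k
/-- `∑ ∂/∂zₖ ηₖ` -/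
def delT : Module.End ℂ M := ∑ k, F.d k * F.y k
/-- `∑ ∂/∂ξₖ ∂/∂ηₖ` -/
def lam : Module.End ℂ M := ∑ k, F.dx k * F.dy k
/-- The total number of bosons. -/
def eul : Module.End ℂ M := ∑ k, F.z k * F.d k
/-- The number of `ξ`s. -/
def nx : Module.End ℂ M := ∑ k, F.x k * F.dx k
/-- The number of `η`s. -/
def ny : Module.End ℂ M := ∑ k, F.y k * F.dy k
/-- The degree as an exterior form. -/
def deg : Module.End ℂ M := F.nx + F.ny
/-- The odd raising operator of `𝔬𝔰𝔭(1|2)`. -/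
def Fp : Module.End ℂ M := F.zeta - F.delT
/-- The odd lowering operator of `𝔬𝔰𝔭(1|2)`. -/
def Fm : Module.End ℂ M := F.del + F.div

lemma genX_z (k l m) : F.genX k l * F.z m = F.z m * F.genX k l +
    ((if l = m then F.d k else 0) + if k = m then F.d l else 0) := by
  simp only [genX, add_mul, dd_z, ca_z, mul_add]; abel

lemma genX_d (k l m) : F.genX k l * F.d m = F.d m * F.genX k l := by
  simp only [genX, add_mul, dd_d, ca_d, mul_add]

lemma genX_x (k l m) : F.genX k l * F.x m = F.x m * F.genX k l := by
  simp only [genX, add_mul, dd_c, ca_c, mul_add, reduceCtorEq, if_false, add_zero]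

lemma genX_dx (k l m) : F.genX k l * F.dx m = F.dx m * F.genX k l +
    -((if m = k then F.dy l else 0) + if m = l then F.dy k else 0) := by
  simp only [genX, add_mul, dd_a, ca_a, mul_add, Sum.inl.injEq]; abel

lemma genX_dy (k l m) : F.genX k l * F.dy m = F.dy m * F.genX k l := by
  simp only [genX, add_mul, dd_a, ca_a, mul_add, reduceCtorEq, if_false, sub_zero]

lemma genX_y (k l m) : F.genX k l * F.y m = F.y m * F.genX k l +
    ((if l = m then F.x k else 0) + if k = m then F.x l else 0) := by
  simp only [genX, add_mul, dd_c, ca_c, mul_add, Sum.inr.injEq]; abel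

lemma genY_z (k l m) : F.genY k l * F.z m = F.z m * F.genY k l := by
  simp only [genY, add_mul, sub_mul, zz_z, ca_z, mul_add, mul_sub]

lemma genY_d (k l m) : F.genY k l * F.d m = F.d m * F.genY k l +
    -((if m = k then F.z l else 0) + if m = l then F.z k else 0) := by
  simp only [genY, add_mul, sub_mul, zz_d, ca_d, mul_add, mul_sub]; abel

lemma genY_x (k l m) : F.genY k l * F.x m = F.x m * F.genY k l +
    -((if l = m then F.y k else 0) + if k = m then F.y l else 0) := by
  simp only [genY, add_mul, sub_mul, zz_c, ca_c, mul_add, mul_sub, Sum.inl.injEq]; abel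

lemma genY_dx (k l m) : F.genY k l * F.dx m = F.dx m * F.genY k l := by
  simp only [genY, add_mul, sub_mul, zz_a, ca_a, mul_add, mul_sub, reduceCtorEq, if_false,
    sub_zero]

lemma genY_y (k l m) : F.genY k l * F.y m = F.y m * F.genY k l := by
  simp only [genY, add_mul, sub_mul, zz_c, ca_c, mul_add, mul_sub, reduceCtorEq, if_false,
    add_zero]

lemma genY_dy (k l m) : F.genY k l * F.dy m = F.dy m * F.genY k l +
    ((if m = k then F.dx l else 0) + if m = l then F.dx k else 0) := by
  simp only [genY, add_mul, sub_mul, zz_a, ca_a, mul_add, mul_sub, Sum.inr.injEq]; abel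

lemma genE_z (k l m) : F.genE k l * F.z m = F.z m * F.genE k l +
    -(if k = m then F.z l else 0) := by
  simp only [genE, sub_mul, zd_z, ca_z, mul_sub]; abel

lemma genE_d (k l m) : F.genE k l * F.d m = F.d m * F.genE k l + if m = l then F.d k else 0 := by
  simp only [genE, sub_mul, zd_d, ca_d, mul_sub]; abel

lemma genE_x (k l m) : F.genE k l * F.x m = F.x m * F.genE k l + if l = m then F.x k else 0 := by
  simp only [genE, sub_mul, zd_c, ca_c, mul_sub, Sum.inl.injEq, reduceCtorEq, if_false]; abel

lemma genE_dx (k l m) : F.genE k l * F.dx m = F.dx m * F.genE k l +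
    -(if m = k then F.dx l else 0) := by
  simp only [genE, sub_mul, zd_a, ca_a, mul_sub, Sum.inl.injEq, reduceCtorEq, if_false]; abel

lemma genE_y (k l m) : F.genE k l * F.y m = F.y m * F.genE k l +
    -(if k = m then F.y l else 0) := by
  simp only [genE, sub_mul, zd_c, ca_c, mul_sub, Sum.inr.injEq, reduceCtorEq, if_false]; abel

lemma genE_dy (k l m) : F.genE k l * F.dy m = F.dy m * F.genE k l +
    if m = l then F.dy k else 0 := by
  simp only [genE, sub_mul, zd_a, ca_a, mul_sub, Sum.inr.injEq, reduceCtorEq, if_false]; abel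

lemma genE_zeta (k l) : F.genE k l * F.zeta = F.zeta * F.genE k l := by
  rw [zeta, mul_sum_of_commutators _ _ _ _ _ (F.genE_z k l) (F.genE_x k l)]
  simp [Finset.sum_add_distrib]

lemma genE_del (k l) : F.genE k l * F.del = F.del * F.genE k l := by
  rw [del, mul_sum_of_commutators _ _ _ _ _ (F.genE_z k l) (F.genE_dy k l)]
  simp [Finset.sum_add_distrib]

lemma genE_div (k l) : F.genE k l * F.div = F.div * F.genE k l := by
  rw [div, mul_sum_of_commutators _ _ _ _ _ (F.genE_d k l) (F.genE_dx k l)]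
  simp [Finset.sum_add_distrib]

lemma genE_delT (k l) : F.genE k l * F.delT = F.delT * F.genE k l := by
  rw [delT, mul_sum_of_commutators _ _ _ _ _ (F.genE_d k l) (F.genE_y k l)]
  simp [Finset.sum_add_distrib]

lemma genE_Fp (k l) : F.genE k l * F.Fp = F.Fp * F.genE k l := by
  rw [Fp, mul_sub, sub_mul, genE_zeta, genE_delT]

lemma genE_Fm (k l) : F.genE k l * F.Fm = F.Fm * F.genE k l := by
  rw [Fm, mul_add, add_mul, genE_del, genE_div]

lemma genX_Fp (k l) : F.genX k l * F.Fp = F.Fp * F.genX k l := by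
  have h1 : F.genX k l * F.zeta = F.zeta * F.genX k l + (F.d k * F.x l + F.d l * F.x k) := by
    rw [zeta, mul_sum_of_commutators _ _ _ _ _ (F.genX_z k l)
      (fun m => (F.genX_x k l m).trans (add_zero _).symm)]
    simp [Finset.sum_add_distrib, add_mul]
  have h2 : F.genX k l * F.delT = F.delT * F.genX k l + (F.d k * F.x l + F.d l * F.x k) := by
    rw [delT, mul_sum_of_commutators _ _ _ _ _
      (fun m => (F.genX_d k l m).trans (add_zero _).symm) (F.genX_y k l)]
    simp [Finset.sum_add_distrib, mul_add, add_comm]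
  rw [Fp, mul_sub, sub_mul, h1, h2]
  abel

lemma genX_Fm (k l) : F.genX k l * F.Fm = F.Fm * F.genX k l := by
  have h1 : F.genX k l * F.del = F.del * F.genX k l + (F.d k * F.dy l + F.d l * F.dy k) := by
    rw [del, mul_sum_of_commutators _ _ _ _ _ (F.genX_z k l)
      (fun m => (F.genX_dy k l m).trans (add_zero _).symm)]
    simp [Finset.sum_add_distrib, add_mul]
  have h2 : F.genX k l * F.div = F.div * F.genX k l - (F.d k * F.dy l + F.d l * F.dy k) := by
    rw [div, mul_sum_of_commutators _ _ _ _ _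
      (fun m => (F.genX_d k l m).trans (add_zero _).symm) (F.genX_dx k l)]
    simp [Finset.sum_add_distrib, mul_add]
    abel
  rw [Fm, mul_add, add_mul, h1, h2]
  abel

lemma genY_Fp (k l) : F.genY k l * F.Fp = F.Fp * F.genY k l := by
  have h1 : F.genY k l * F.zeta = F.zeta * F.genY k l - (F.z k * F.y l + F.z l * F.y k) := by
    rw [zeta, mul_sum_of_commutators _ _ _ _ _
      (fun m => (F.genY_z k l m).trans (add_zero _).symm) (F.genY_x k l)]
    simp [Finset.sum_add_distrib, mul_add]
    abel
  have h2 : F.genY k l * F.delT = F.delT * F.genY k l - (F.z k * F.y l + F.z l * F.y k) := by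
    rw [delT, mul_sum_of_commutators _ _ _ _ _ (F.genY_d k l)
      (fun m => (F.genY_y k l m).trans (add_zero _).symm)]
    simp [Finset.sum_add_distrib, add_mul]
    abel
  rw [Fp, mul_sub, sub_mul, h1, h2]
  abel

lemma genY_Fm (k l) : F.genY k l * F.Fm = F.Fm * F.genY k l := by
  have h1 : F.genY k l * F.del = F.del * F.genY k l + (F.z k * F.dx l + F.z l * F.dx k) := by
    rw [del, mul_sum_of_commutators _ _ _ _ _
      (fun m => (F.genY_z k l m).trans (add_zero _).symm) (F.genY_dy k l)]
    simp [Finset.sum_add_distrib, mul_add]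
  have h2 : F.genY k l * F.div = F.div * F.genY k l - (F.z k * F.dx l + F.z l * F.dx k) := by
    rw [div, mul_sum_of_commutators _ _ _ _ _ (F.genY_d k l)
      (fun m => (F.genY_dx k l m).trans (add_zero _).symm)]
    simp [Finset.sum_add_distrib, add_mul]
    abel
  rw [Fm, mul_add, add_mul, h1, h2]
  abel

/-! The anticommutation relations between `zeta`, `del`, `div` and `delT`. -/

lemma zd (k l) : F.z k * F.d l = F.d l * F.z k + if k = l then (-1 : ℂ) • 1 else 0 := by
  rw [F.dz]
  by_cases h : k = l
  · subst h; simp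
  · simp [h, Ne.symm h]

lemma del_div : F.del * F.div + F.div * F.del = F.lam := by
  have := anticommutator_sum F.z F.d F.dy F.dx 0 (-1) (fun _ _ => F.za _ _) (fun _ _ => F.da _ _)
    (fun k l => by simp [F.aa (Sum.inr k)]) F.zd
  simpa [del, div, lam] using this

lemma div_zeta : F.div * F.zeta + F.zeta * F.div = (n : ℂ) • 1 + F.eul - F.nx := by
  have := anticommutator_sum F.d F.z F.dx F.x 1 1 (fun _ _ => F.dc _ _) (fun _ _ => F.za _ _)
    (fun k l => by simpa using F.ac (Sum.inl k) (Sum.inl l)) (fun k l => by simpa using F.dz k l)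
  simp only [F.dz, if_true, Finset.sum_add_distrib, one_smul] at this
  rw [div, zeta, this, eul, nx]
  simp [add_comm, ← Nat.cast_smul_eq_nsmul ℂ]

lemma del_zeta : F.del * F.zeta = -(F.zeta * F.del) := by
  have := anticommutator_sum F.z F.z F.dy F.x 0 0 (fun _ _ => F.zc _ _) (fun _ _ => F.za _ _)
    (fun k l => by simpa using F.ac (Sum.inr k) (Sum.inl l)) (fun k l => by simpa using F.zz k l)
  rw [eq_neg_iff_add_eq_zero]
  simpa [del, zeta] using this

lemma del_delT : F.del * F.delT + F.delT * F.del = F.eul + F.ny := by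
  have := anticommutator_sum F.z F.d F.dy F.y 1 (-1) (fun _ _ => F.zc _ _) (fun _ _ => F.da _ _)
    (fun k l => by simpa using F.ac (Sum.inr k) (Sum.inr l)) F.zd
  simpa [del, delT, eul, ny] using this

lemma div_delT : F.div * F.delT = -(F.delT * F.div) := by
  have := anticommutator_sum F.d F.d F.dx F.y 0 0 (fun _ _ => F.dc _ _) (fun _ _ => F.da _ _)
    (fun k l => by simpa using F.ac (Sum.inl k) (Sum.inr l)) (fun k l => by simpa using F.dd k l)
  rw [eq_neg_iff_add_eq_zero]
  simpa [div, delT] using this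

lemma del_del : F.del * F.del = 0 := by
  have := anticommutator_sum F.z F.z F.dy F.dy 0 0 (fun _ _ => F.za _ _) (fun _ _ => F.za _ _)
    (fun k l => by simpa using F.aa (Sum.inr k) (Sum.inr l)) (fun k l => by simpa using F.zz k l)
  refine eq_zero_of_eq_neg_self ?_
  rw [eq_neg_iff_add_eq_zero]
  simpa [del] using this

lemma div_div : F.div * F.div = 0 := by
  have := anticommutator_sum F.d F.d F.dx F.dx 0 0 (fun _ _ => F.da _ _) (fun _ _ => F.da _ _)
    (fun k l => by simpa using F.aa (Sum.inl k) (Sum.inl l)) (fun k l => by simpa using F.dd k l)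
  refine eq_zero_of_eq_neg_self ?_
  rw [eq_neg_iff_add_eq_zero]
  simpa [div] using this

lemma zeta_zeta : F.zeta * F.zeta = 0 := by
  have := anticommutator_sum F.z F.z F.x F.x 0 0 (fun _ _ => F.zc _ _) (fun _ _ => F.zc _ _)
    (fun k l => by simpa using F.cc (Sum.inl k) (Sum.inl l)) (fun k l => by simpa using F.zz k l)
  refine eq_zero_of_eq_neg_self ?_
  rw [eq_neg_iff_add_eq_zero]
  simpa [zeta] using this

lemma Fm_Fm : F.Fm * F.Fm = F.lam := by
  rw [Fm, add_mul, mul_add, mul_add, del_del, div_div, ← del_div]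
  abel

/-- The defining relation of `𝔬𝔰𝔭(1|2)`. -/
lemma Fp_Fm : F.Fp * F.Fm + F.Fm * F.Fp = (n : ℂ) • 1 - F.deg := by
  have h : F.Fp * F.Fm + F.Fm * F.Fp = (F.zeta * F.del + F.del * F.zeta) +
      (F.div * F.zeta + F.zeta * F.div) - (F.del * F.delT + F.delT * F.del) -
      (F.div * F.delT + F.delT * F.div) := by
    rw [Fp, Fm]; noncomm_ring
  rw [h, del_zeta, div_zeta, del_delT, div_delT, deg]
  abel

end Fock

namespace Fock

variable {n : ℕ} {M : Type*} [AddCommGroup M] [Module ℂ M] (F : Fock n M)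

/-! ### Number operators -/

lemma shifts_zd_z (k m) : Shifts (F.z k * F.d k) (F.z m) (if k = m then 1 else 0) := by
  rw [Shifts, zd_z]; split_ifs with h <;> simp [h]

lemma shifts_zd_d (k m) : Shifts (F.z k * F.d k) (F.d m) (if k = m then -1 else 0) := by
  rw [Shifts, zd_d]
  by_cases h : k = m
  · simp [h, sub_eq_add_neg]
  · simp [h, Ne.symm h]

lemma shifts_zd_c (k m) : Shifts (F.z k * F.d k) (F.c m) 0 := by
  rw [Shifts, zd_c]; simp

lemma shifts_zd_a (k m) : Shifts (F.z k * F.d k) (F.a m) 0 := by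
  rw [Shifts, zd_a]; simp

lemma shifts_ca_c (i m) : Shifts (F.c i * F.a i) (F.c m) (if i = m then 1 else 0) := by
  rw [Shifts, ca_c]; split_ifs with h <;> simp [h]

lemma shifts_ca_a (i m) : Shifts (F.c i * F.a i) (F.a m) (if i = m then -1 else 0) := by
  rw [Shifts, ca_a]
  by_cases h : i = m
  · simp [h, sub_eq_add_neg]
  · simp [h, Ne.symm h]

lemma shifts_ca_z (i m) : Shifts (F.c i * F.a i) (F.z m) 0 := by
  rw [Shifts, ca_z]; simp

lemma shifts_ca_d (i m) : Shifts (F.c i * F.a i) (F.d m) 0 := by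
  rw [Shifts, ca_d]; simp

lemma eul_z (m) : Shifts F.eul (F.z m) 1 :=
  (Shifts.sum_left fun k _ => F.shifts_zd_z k m).of_eq (by simp)
lemma eul_d (m) : Shifts F.eul (F.d m) (-1) :=
  (Shifts.sum_left fun k _ => F.shifts_zd_d k m).of_eq (by simp)
lemma eul_c (m) : Shifts F.eul (F.c m) 0 :=
  (Shifts.sum_left fun k _ => F.shifts_zd_c k m).of_eq (by simp)
lemma eul_a (m) : Shifts F.eul (F.a m) 0 :=
  (Shifts.sum_left fun k _ => F.shifts_zd_a k m).of_eq (by simp)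
lemma nx_z (m) : Shifts F.nx (F.z m) 0 :=
  (Shifts.sum_left fun k _ => F.shifts_ca_z _ m).of_eq (by simp)
lemma nx_d (m) : Shifts F.nx (F.d m) 0 :=
  (Shifts.sum_left fun k _ => F.shifts_ca_d _ m).of_eq (by simp)
lemma nx_x (m) : Shifts F.nx (F.x m) 1 :=
  (Shifts.sum_left fun k _ => F.shifts_ca_c _ _).of_eq (by simp)
lemma nx_dx (m) : Shifts F.nx (F.dx m) (-1) :=
  (Shifts.sum_left fun k _ => F.shifts_ca_a _ _).of_eq (by simp)
lemma nx_y (m) : Shifts F.nx (F.y m) 0 :=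
  (Shifts.sum_left fun k _ => F.shifts_ca_c _ _).of_eq (by simp)
lemma nx_dy (m) : Shifts F.nx (F.dy m) 0 :=
  (Shifts.sum_left fun k _ => F.shifts_ca_a _ _).of_eq (by simp)
lemma ny_z (m) : Shifts F.ny (F.z m) 0 :=
  (Shifts.sum_left fun k _ => F.shifts_ca_z _ m).of_eq (by simp)
lemma ny_d (m) : Shifts F.ny (F.d m) 0 :=
  (Shifts.sum_left fun k _ => F.shifts_ca_d _ m).of_eq (by simp)
lemma ny_x (m) : Shifts F.ny (F.x m) 0 :=
  (Shifts.sum_left fun k _ => F.shifts_ca_c _ _).of_eq (by simp)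
lemma ny_dx (m) : Shifts F.ny (F.dx m) 0 :=
  (Shifts.sum_left fun k _ => F.shifts_ca_a _ _).of_eq (by simp)
lemma ny_y (m) : Shifts F.ny (F.y m) 1 :=
  (Shifts.sum_left fun k _ => F.shifts_ca_c _ _).of_eq (by simp)
lemma ny_dy (m) : Shifts F.ny (F.dy m) (-1) :=
  (Shifts.sum_left fun k _ => F.shifts_ca_a _ _).of_eq (by simp)

lemma eul_zeta : Shifts F.eul F.zeta 1 :=
  Shifts.sum fun _ _ => ((F.eul_z _).mul (F.eul_c _)).of_eq (by simp)
lemma eul_del : Shifts F.eul F.del 1 :=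
  Shifts.sum fun _ _ => ((F.eul_z _).mul (F.eul_a _)).of_eq (by simp)
lemma eul_div : Shifts F.eul F.div (-1) :=
  Shifts.sum fun _ _ => ((F.eul_d _).mul (F.eul_a _)).of_eq (by simp)
lemma eul_delT : Shifts F.eul F.delT (-1) :=
  Shifts.sum fun _ _ => ((F.eul_d _).mul (F.eul_c _)).of_eq (by simp)
lemma nx_zeta : Shifts F.nx F.zeta 1 :=
  Shifts.sum fun _ _ => ((F.nx_z _).mul (F.nx_x _)).of_eq (by simp)
lemma nx_del : Shifts F.nx F.del 0 :=
  Shifts.sum fun _ _ => ((F.nx_z _).mul (F.nx_dy _)).of_eq (by simp)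
lemma nx_div : Shifts F.nx F.div (-1) :=
  Shifts.sum fun _ _ => ((F.nx_d _).mul (F.nx_dx _)).of_eq (by simp)
lemma nx_delT : Shifts F.nx F.delT 0 :=
  Shifts.sum fun _ _ => ((F.nx_d _).mul (F.nx_y _)).of_eq (by simp)
lemma ny_zeta : Shifts F.ny F.zeta 0 :=
  Shifts.sum fun _ _ => ((F.ny_z _).mul (F.ny_x _)).of_eq (by simp)
lemma ny_del : Shifts F.ny F.del (-1) :=
  Shifts.sum fun _ _ => ((F.ny_z _).mul (F.ny_dy _)).of_eq (by simp)
lemma ny_div : Shifts F.ny F.div 0 :=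
  Shifts.sum fun _ _ => ((F.ny_d _).mul (F.ny_dx _)).of_eq (by simp)
lemma ny_delT : Shifts F.ny F.delT 1 :=
  Shifts.sum fun _ _ => ((F.ny_d _).mul (F.ny_y _)).of_eq (by simp)
lemma deg_Fp : Shifts F.deg F.Fp 1 :=
  ((F.nx_zeta.add_left F.ny_zeta).of_eq (by simp)).sub
    ((F.nx_delT.add_left F.ny_delT).of_eq (by simp))
lemma deg_Fm : Shifts F.deg F.Fm (-1) :=
  ((F.nx_del.add_left F.ny_del).of_eq (by simp)).add
    ((F.nx_div.add_left F.ny_div).of_eq (by simp))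

section Occupation

variable {F} {o : Fin n ⊕ (Fin n ⊕ Fin n) → ℕ} {u : M}

lemma occ_z (hu : u ∈ F.Occ o) (k) : F.z k (F.d k u) = (o (Sum.inl k) : ℂ) • u :=
  F.mem_occ.1 hu (Sum.inl k)

lemma occ_c (hu : u ∈ F.Occ o) (i) : F.c i (F.a i u) = (o (Sum.inr i) : ℂ) • u :=
  F.mem_occ.1 hu (Sum.inr i)

lemma occ_eul (hu : u ∈ F.Occ o) : F.eul u = (∑ k, (o (Sum.inl k) : ℂ)) • u := by
  simp [eul, LinearMap.sum_apply, occ_z hu, Finset.sum_smul]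

lemma occ_nx (hu : u ∈ F.Occ o) : F.nx u = (∑ k, (o (Sum.inr (Sum.inl k)) : ℂ)) • u := by
  simp [nx, LinearMap.sum_apply, occ_c hu, Finset.sum_smul]

lemma occ_ny (hu : u ∈ F.Occ o) : F.ny u = (∑ k, (o (Sum.inr (Sum.inr k)) : ℂ)) • u := by
  simp [ny, LinearMap.sum_apply, occ_c hu, Finset.sum_smul]

lemma occ_genE (hu : u ∈ F.Occ o) (k) : F.genE k k u =
    ((o (Sum.inr (Sum.inl k)) : ℂ) - o (Sum.inr (Sum.inr k)) - o (Sum.inl k)) • u := by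
  simp [genE, occ_c hu, occ_z hu, sub_smul]

end Occupation

/-- If a nonzero vector is an eigenvector of the degree operator, then the eigenvalue is at
most `2n`. -/
lemma eq_zero_of_deg {i : ℕ} (hi : 2 * n < i) {u : M} (hu : F.deg u = (i : ℂ) • u) : u = 0 := by
  refine F.eq_zero_of_spectrum (T := F.deg) (t := fun o => ((∑ k, o (Sum.inr (Sum.inl k)) +
    ∑ k, o (Sum.inr (Sum.inr k)) : ℕ) : ℂ)) ?_ ?_ hu
  · intro o v hv
    rw [deg, LinearMap.add_apply, occ_nx hv, occ_ny hv, ← add_smul]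
    push_cast; rfl
  · intro o ho h
    have h1 : ∑ k, o (Sum.inr (Sum.inl k)) + ∑ k, o (Sum.inr (Sum.inr k)) = i := by
      exact_mod_cast h
    have h2 : ∑ k : Fin n, o (Sum.inr (Sum.inl k)) ≤ ∑ k : Fin n, 1 :=
      Finset.sum_le_sum fun k _ => ho _
    have h3 : ∑ k : Fin n, o (Sum.inr (Sum.inr k)) ≤ ∑ k : Fin n, 1 :=
      Finset.sum_le_sum fun k _ => ho _
    simp at h2 h3
    omega

lemma Fm_eq_zero_of_deg_zero {u : M} (hu : F.deg u = 0) : F.Fm u = 0 := by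
  refine F.eq_zero_of_spectrum (T := F.deg) (t := fun o => ((∑ k, o (Sum.inr (Sum.inl k)) +
    ∑ k, o (Sum.inr (Sum.inr k)) : ℕ) : ℂ)) (μ := -1) ?_ ?_ ?_
  · intro o v hv
    rw [deg, LinearMap.add_apply, occ_nx hv, occ_ny hv, ← add_smul]
    push_cast; rfl
  · intro o _ h
    have := congrArg Complex.re h
    simp only [Complex.natCast_re, Complex.neg_re, Complex.one_re] at this
    have h0 : (0 : ℝ) ≤ ((∑ k, o (Sum.inr (Sum.inl k)) +
      ∑ k, o (Sum.inr (Sum.inr k)) : ℕ) : ℝ) := Nat.cast_nonneg _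
    linarith
  · rw [F.deg_Fm.apply, hu, map_zero, zero_add]

/-! ### Decomposition under `𝔬𝔰𝔭(1|2)` -/

/-- The eigenvalue of `Fp * Fm` in degree `i` on the representation of `𝔬𝔰𝔭(1|2)` generated by a
primitive vector of degree `j`. -/
noncomputable def _root_.SymplecticSpinor.stringValue (n i j : ℕ) : ℂ :=
  if Even (i + j) then ((j : ℂ) - i) / 2 else (2 * (n : ℂ) + 1 - i - j) / 2

lemma _root_.SymplecticSpinor.stringValue_succ (n i j : ℕ) :
    stringValue n (i + 1) j = (n : ℂ) - i - stringValue n i j := by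
  have h : Even (i + 1 + j) ↔ ¬ Even (i + j) := by
    rw [add_right_comm, Nat.even_add_one]
  by_cases h1 : Even (i + j)
  · rw [stringValue, stringValue, if_neg (by simpa [h] using h1), if_pos h1]
    push_cast; ring
  · rw [stringValue, stringValue, if_pos (h.2 h1), if_neg h1]
    push_cast; ring

lemma _root_.SymplecticSpinor.stringValue_self (n i : ℕ) : stringValue n i i = 0 := by
  simp [stringValue]

lemma _root_.SymplecticSpinor.stringValue_ne_zero {n i j : ℕ} (h : j < i) (h' : i + j ≤ 2 * n) :
    stringValue n i j ≠ 0 := by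
  rw [stringValue]
  split_ifs with h1
  · intro h2
    have h3 : (j : ℂ) = i := by linear_combination 2 * h2
    have h4 : j = i := by exact_mod_cast h3
    omega
  · intro h2
    have h3 : 2 * (n : ℂ) + 1 = i + j := by linear_combination 2 * h2
    have h4 : 2 * n + 1 = i + j := by exact_mod_cast h3
    omega

lemma _root_.SymplecticSpinor.stringValue_injective {n i j j' : ℕ}
    (h' : i + j' ≤ 2 * n) (hj : j ≤ i) (e : stringValue n i j = stringValue n i j') : j = j' := by
  rw [stringValue, stringValue] at e
  split_ifs at e
  · have h3 : (j : ℂ) = j' := by linear_combination 2 * e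
    exact_mod_cast h3
  · have h3 : (j : ℂ) + j' = 2 * n + 1 := by linear_combination 2 * e
    have h4 : j + j' = 2 * n + 1 := by exact_mod_cast h3
    omega
  · have h3 : (j : ℂ) + j' = 2 * n + 1 := by linear_combination -2 * e
    have h4 : j + j' = 2 * n + 1 := by exact_mod_cast h3
    omega
  · have h3 : (j : ℂ) = j' := by linear_combination -2 * e
    exact_mod_cast h3

/-- The part of degree `i` of the sum of all representations of `𝔬𝔰𝔭(1|2)` generated by primitive
vectors of degree `j`, described as an eigenspace of `Fp * Fm`. This is meaningful for `j ≤ i` and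
`i + j ≤ 2 * n`. -/
noncomputable def sector (i j : ℕ) : Submodule ℂ M :=
  Module.End.eigenspace F.deg (i : ℂ) ⊓ Module.End.eigenspace (F.Fp * F.Fm) (stringValue n i j)

lemma mem_sector {i j : ℕ} {u : M} : u ∈ F.sector i j ↔
    F.deg u = (i : ℂ) • u ∧ F.Fp (F.Fm u) = stringValue n i j • u := by
  simp [sector]

lemma Fm_Fp_apply (u : M) : F.Fm (F.Fp u) = (n : ℂ) • u - F.deg u - F.Fp (F.Fm u) := by
  have := LinearMap.congr_fun F.Fp_Fm u
  simp only [LinearMap.add_apply, Module.End.mul_apply, LinearMap.sub_apply, LinearMap.smul_apply,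
    Module.End.one_apply] at this
  rw [← this]; abel

variable {F}

lemma Fm_Fp_of_mem_sector {i j : ℕ} {u : M} (hu : u ∈ F.sector i j) :
    F.Fm (F.Fp u) = stringValue n (i + 1) j • u := by
  rw [Fm_Fp_apply, (F.mem_sector.1 hu).1, (F.mem_sector.1 hu).2, stringValue_succ]
  module

lemma Fp_mem_sector {i j : ℕ} {u : M} (hu : u ∈ F.sector i j) : F.Fp u ∈ F.sector (i + 1) j := by
  refine F.mem_sector.2 ⟨?_, ?_⟩
  · rw [F.deg_Fp.apply_of_eigen (F.mem_sector.1 hu).1]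
    push_cast; rfl
  · rw [Fm_Fp_of_mem_sector hu, map_smul]

lemma Fm_mem_sector {i j : ℕ} {u : M} (hu : u ∈ F.sector (i + 1) j) : F.Fm u ∈ F.sector i j := by
  have hd : F.deg (F.Fm u) = (i : ℂ) • F.Fm u := by
    rw [F.deg_Fm.apply_of_eigen (F.mem_sector.1 hu).1]
    push_cast; congr 1; ring
  refine F.mem_sector.2 ⟨hd, ?_⟩
  have h := F.Fm_Fp_apply (F.Fm u)
  rw [(F.mem_sector.1 hu).2, map_smul, hd, stringValue_succ] at h
  have h' : F.Fp (F.Fm (F.Fm u)) = (n : ℂ) • F.Fm u - (i : ℂ) • F.Fm u -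
      ((n : ℂ) - i - stringValue n i j) • F.Fm u := by
    rw [h]; abel
  rw [h']; module

lemma eq_zero_of_mem_iSup_sector {i : ℕ} {J : ℕ → Prop} (hJ : ∀ j, J j → stringValue n i j ≠ 0)
    {u : M} (hu : u ∈ ⨆ j, ⨆ _ : J j, F.sector i j) (h0 : F.Fp (F.Fm u) = 0) : u = 0 := by
  have h1 := Module.End.eigenspaces_iSupIndep (F.Fp * F.Fm) 0
  have h2 : u ∈ Module.End.eigenspace (F.Fp * F.Fm) 0 :=
    Module.End.mem_eigenspace_iff.2 (by simpa using h0)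
  have h3 : ⨆ j, ⨆ _ : J j, F.sector i j ≤
      ⨆ μ, ⨆ _ : μ ≠ 0, Module.End.eigenspace (F.Fp * F.Fm) μ :=
    iSup₂_le fun j hj => le_iSup₂_of_le (stringValue n i j) (hJ j hj) inf_le_right
  exact Submodule.disjoint_def.1 h1 u h2 (h3 hu)

lemma exists_Fm_eq {i : ℕ} {J : ℕ → Prop} (hJ : ∀ j, J j → stringValue n (i + 1) j ≠ 0)
    {u : M} (hu : u ∈ ⨆ j, ⨆ _ : J j, F.sector i j) :
    ∃ v ∈ ⨆ j, ⨆ _ : J j, F.sector (i + 1) j, F.Fm v = u := by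
  have : ⨆ j, ⨆ _ : J j, F.sector i j ≤
      Submodule.map F.Fm (⨆ j, ⨆ _ : J j, F.sector (i + 1) j) := by
    refine iSup₂_le fun j hj v hv => ⟨(stringValue n (i + 1) j)⁻¹ • F.Fp v, ?_, ?_⟩
    · exact Submodule.smul_mem _ _ (Submodule.mem_iSup_of_mem j
        (Submodule.mem_iSup_of_mem hj (Fp_mem_sector hv)))
    · rw [map_smul, Fm_Fp_of_mem_sector hv, smul_smul, inv_mul_cancel₀ (hJ j hj), one_smul]
  obtain ⟨v, hv, e⟩ := this hu
  exact ⟨v, hv, e⟩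

lemma exists_Fp_eq {i : ℕ} {J : ℕ → Prop} (hJ : ∀ j, J j → stringValue n (i + 1) j ≠ 0)
    {u : M} (hu : u ∈ ⨆ j, ⨆ _ : J j, F.sector (i + 1) j) :
    ∃ v ∈ ⨆ j, ⨆ _ : J j, F.sector i j, F.Fp v = u := by
  have : ⨆ j, ⨆ _ : J j, F.sector (i + 1) j ≤
      Submodule.map F.Fp (⨆ j, ⨆ _ : J j, F.sector i j) := by
    refine iSup₂_le fun j hj v hv => ⟨(stringValue n (i + 1) j)⁻¹ • F.Fm v, ?_, ?_⟩
    · exact Submodule.smul_mem _ _ (Submodule.mem_iSup_of_mem j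
        (Submodule.mem_iSup_of_mem hj (Fm_mem_sector hv)))
    · rw [map_smul, (F.mem_sector.1 hv).2, smul_smul, inv_mul_cancel₀ (hJ j hj), one_smul]
  obtain ⟨v, hv, e⟩ := this hu
  exact ⟨v, hv, e⟩

lemma deg_eq_of_mem_iSup_sector {i : ℕ} {J : ℕ → Prop} {u : M}
    (hu : u ∈ ⨆ j, ⨆ _ : J j, F.sector i j) : F.deg u = (i : ℂ) • u :=
  Module.End.mem_eigenspace_iff.1 ((iSup₂_le fun _ _ => inf_le_left :
    ⨆ j, ⨆ _ : J j, F.sector i j ≤ Module.End.eigenspace F.deg (i : ℂ)) hu)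

/-- Up to the middle degree, forms decompose into the images of primitive vectors: `Fm u` is the
image under `Fm` of some `v` in the sum of the `sector i j` with `j < i`, and `u - v` is
primitive. -/
lemma mem_iSup_sector_of_le {i : ℕ} (hi : i ≤ n) {u : M} (hu : F.deg u = (i : ℂ) • u) :
    u ∈ ⨆ j, ⨆ _ : j ≤ i, F.sector i j := by
  induction i generalizing u with
  | zero =>
    have h : F.Fm u = 0 := F.Fm_eq_zero_of_deg_zero (by simpa using hu)
    refine Submodule.mem_iSup_of_mem 0 (Submodule.mem_iSup_of_mem le_rfl
      (F.mem_sector.2 ⟨hu, ?_⟩))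
    rw [h, map_zero, stringValue_self, zero_smul]
  | succ i ih =>
    have h1 : F.deg (F.Fm u) = (i : ℂ) • F.Fm u := by
      rw [F.deg_Fm.apply_of_eigen hu]
      push_cast; congr 1; ring
    obtain ⟨v, hv, e⟩ := exists_Fm_eq (fun j hj => stringValue_ne_zero (by omega) (by omega))
      (ih (by omega) h1)
    have h2 : u - v ∈ F.sector (i + 1) (i + 1) := by
      refine F.mem_sector.2 ⟨?_, ?_⟩
      · rw [map_sub, hu, deg_eq_of_mem_iSup_sector hv, smul_sub]
      · rw [map_sub, e, sub_self, map_zero, stringValue_self, zero_smul]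
    rw [← sub_add_cancel u v]
    refine Submodule.add_mem _ (Submodule.mem_iSup_of_mem (i + 1)
      (Submodule.mem_iSup_of_mem le_rfl h2)) ?_
    have hle : (⨆ j, ⨆ _ : j ≤ i, F.sector (i + 1) j) ≤ ⨆ j, ⨆ _ : j ≤ i + 1, F.sector (i + 1) j :=
      iSup_mono fun j => iSup_le fun hj => le_iSup_of_le (by omega) le_rfl
    exact hle hv

/-- The counterpart of `mem_iSup_sector_of_le` above the middle degree, proved by descending
induction with the roles of `Fp` and `Fm` exchanged: a vector of degree `i` killed by `Fp` is in
`sector i (2 * n - i)`. -/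
lemma mem_iSup_sector_of_ge {i : ℕ} (hi : n ≤ i) {u : M} (hu : F.deg u = (i : ℂ) • u) :
    u ∈ ⨆ j, ⨆ _ : i + j ≤ 2 * n, F.sector i j := by
  by_cases hi2 : 2 * n < i
  · rw [F.eq_zero_of_deg hi2 hu]; exact Submodule.zero_mem _
  · obtain ⟨m, hm⟩ : ∃ m, m = 2 * n - i := ⟨_, rfl⟩
    induction m generalizing i u with
    | zero =>
      have h0 : F.Fp u = 0 := by
        refine F.eq_zero_of_deg (i := i + 1) (by omega) ?_
        rw [F.deg_Fp.apply_of_eigen hu]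
        push_cast; rfl
      have h1 := F.Fm_Fp_apply u
      rw [h0, map_zero, hu] at h1
      have h2 : u ∈ F.sector i 0 := by
        refine F.mem_sector.2 ⟨hu, ?_⟩
        have : i = 2 * n := by omega
        subst this
        have h3 : F.Fp (F.Fm u) = (n : ℂ) • u - ((2 * n : ℕ) : ℂ) • u :=
          (sub_eq_zero.1 h1.symm).symm
        rw [h3, stringValue, if_pos (by simp)]
        push_cast; module
      exact Submodule.mem_iSup_of_mem 0 (Submodule.mem_iSup_of_mem (by omega) h2)
    | succ m ih =>
      have h1 : F.deg (F.Fp u) = ((i + 1 : ℕ) : ℂ) • F.Fp u := by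
        rw [F.deg_Fp.apply_of_eigen hu]
        push_cast; rfl
      obtain ⟨v, hv, e⟩ := exists_Fp_eq
        (fun j hj => stringValue_ne_zero (by omega) (by omega))
        (ih (i := i + 1) (by omega) h1 (by omega) (by omega))
      have h2 : u - v ∈ F.sector i (2 * n - i) := by
        have hd : F.deg (u - v) = (i : ℂ) • (u - v) := by
          rw [map_sub, hu, deg_eq_of_mem_iSup_sector hv, smul_sub]
        refine F.mem_sector.2 ⟨hd, ?_⟩
        have h3 := F.Fm_Fp_apply (u - v)
        rw [map_sub F.Fp, e, sub_self, map_zero, hd] at h3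
        rw [(sub_eq_zero.1 h3.symm).symm, stringValue, if_pos (by
          rw [show i + (2 * n - i) = 2 * n by omega]; simp), Nat.cast_sub (by omega)]
        push_cast; module
      rw [← sub_add_cancel u v]
      refine Submodule.add_mem _ (Submodule.mem_iSup_of_mem (2 * n - i)
        (Submodule.mem_iSup_of_mem (by omega) h2)) ?_
      have hle : (⨆ j, ⨆ _ : i + 1 + j ≤ 2 * n, F.sector i j) ≤
          ⨆ j, ⨆ _ : i + j ≤ 2 * n, F.sector i j :=
        iSup_mono fun j => iSup_le fun hj => le_iSup_of_le (by omega) le_rfl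
      exact hle hv

/-- In degrees `j ≤ n`, the kernel of `Fp * Fm` consists of primitive vectors. -/
lemma Fm_eq_zero_of_mem_sector_self {j : ℕ} (hj : j ≤ n) {u : M} (hu : u ∈ F.sector j j) :
    F.Fm u = 0 := by
  obtain ⟨hd, h0⟩ := F.mem_sector.1 hu
  rw [stringValue_self, zero_smul] at h0
  have h1 : u ∈ ⨆ i, ⨆ _ : i ≤ j, F.sector j i := mem_iSup_sector_of_le hj hd
  cases j with
  | zero =>
    exact F.Fm_eq_zero_of_deg_zero (by simpa using hd)
  | succ i =>
    have h2 : F.deg (F.Fm u) = (i : ℂ) • F.Fm u := by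
      rw [F.deg_Fm.apply_of_eigen hd]
      push_cast; congr 1; ring
    have hne : ∀ j, j ≤ i → stringValue n (i + 1) j ≠ 0 := fun j _ =>
      stringValue_ne_zero (by omega) (by omega)
    obtain ⟨v, hv, e⟩ := exists_Fm_eq hne (mem_iSup_sector_of_le (by omega) h2)
    rw [← e] at h0 ⊢
    rw [eq_zero_of_mem_iSup_sector hne hv h0, map_zero]

/-- Primitive vectors of the middle degree are annihilated by `Fp`. -/
lemma Fp_eq_zero_of_primitive {u : M} (hd : F.deg u = (n : ℂ) • u) (h0 : F.Fm u = 0) :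
    F.Fp u = 0 := by
  have h1 : F.deg (F.Fp u) = ((n + 1 : ℕ) : ℂ) • F.Fp u := by
    rw [F.deg_Fp.apply_of_eigen hd]
    push_cast; rfl
  refine eq_zero_of_mem_iSup_sector (fun j hj => stringValue_ne_zero (by omega) hj)
    (mem_iSup_sector_of_ge (Nat.le_succ n) h1) ?_
  rw [Fm_Fp_apply, hd, h0, map_zero, sub_self, sub_zero, map_zero]

end Fock

namespace Fock

variable {n : ℕ} {M : Type*} [AddCommGroup M] [Module ℂ M] (F : Fock n M)

/-! ### Spectra of the number operators -/

lemma eul_spectrum {u : M} {μ : ℂ} (hu : F.eul u = μ • u) (hμ : ∀ m : ℕ, (m : ℂ) ≠ μ) : u = 0 := by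
  refine F.eq_zero_of_spectrum (T := F.eul) (t := fun o => ((∑ k, o (Sum.inl k) : ℕ) : ℂ)) ?_
    (fun o _ => hμ _) hu
  intro o v hv
  rw [occ_eul hv]; push_cast; rfl

lemma boson_spectrum (k) {u : M} {μ : ℂ} (hu : F.z k (F.d k u) = μ • u)
    (hμ : ∀ m : ℕ, (m : ℂ) ≠ μ) : u = 0 :=
  F.eq_zero_of_spectrum (T := F.z k * F.d k) (t := fun o => (o (Sum.inl k) : ℂ))
    (fun _ _ hv => occ_z hv k) (fun _ _ => hμ _) hu

lemma nx_spectrum {u : M} {μ : ℂ} (hu : F.nx u = μ • u) (hμ : ∀ m : ℕ, m ≤ n → (m : ℂ) ≠ μ) :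
    u = 0 := by
  refine F.eq_zero_of_spectrum (T := F.nx)
    (t := fun o => ((∑ k, o (Sum.inr (Sum.inl k)) : ℕ) : ℂ)) ?_ (fun o ho => hμ _ ?_) hu
  · intro o v hv
    rw [occ_nx hv]; push_cast; rfl
  · simpa using Finset.sum_le_sum fun (k : Fin n) (_ : k ∈ Finset.univ) => ho (Sum.inl k)

lemma ny_spectrum {u : M} {μ : ℂ} (hu : F.ny u = μ • u) (hμ : ∀ m : ℕ, (m : ℂ) ≠ μ) : u = 0 := by
  refine F.eq_zero_of_spectrum (T := F.ny)
    (t := fun o => ((∑ k, o (Sum.inr (Sum.inr k)) : ℕ) : ℂ)) ?_ (fun o _ => hμ _) hu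
  intro o v hv
  rw [occ_ny hv]; push_cast; rfl

lemma natCast_ne_of_re_neg {μ : ℂ} (h : μ.re < 0) (m : ℕ) : (m : ℂ) ≠ μ := by
  rintro rfl
  rw [Complex.natCast_re] at h
  exact absurd h (not_lt.2 (Nat.cast_nonneg m))

lemma d_eq_zero_of_eul {u : M} (hu : F.eul u = 0) (k) : F.d k u = 0 := by
  refine F.eul_spectrum (μ := -1) ?_ (natCast_ne_of_re_neg (by simp))
  rw [(F.eul_d k).apply, hu, map_zero, zero_add]

lemma dy_eq_zero_of_ny {u : M} (hu : F.ny u = 0) (k) : F.dy k u = 0 := by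
  refine F.ny_spectrum (μ := -1) ?_ (natCast_ne_of_re_neg (by simp))
  rw [(F.ny_dy k).apply, hu, map_zero, zero_add]

lemma eq_zero_of_nx_succ {u : M} (hu : F.nx u = ((n : ℂ) + 1) • u) : u = 0 :=
  F.nx_spectrum hu fun m hm h => by
    have : m = n + 1 := by exact_mod_cast h
    omega

lemma x_eq_zero_of_nx {u : M} (hu : F.nx u = (n : ℂ) • u) (k) : F.x k u = 0 :=
  F.eq_zero_of_nx_succ ((F.nx_x k).apply_of_eigen hu)

lemma nx_eul : F.nx * F.eul = F.eul * F.nx := by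
  rw [nx, eul, Finset.sum_mul_sum, Finset.sum_mul_sum, Finset.sum_comm]
  exact Finset.sum_congr rfl fun k _ => Finset.sum_congr rfl fun l _ =>
    F.num_comm (Sum.inr (Sum.inl l)) (Sum.inl k)

/-! Pointwise forms of the canonical relations. -/

lemma dz_apply (k u) : F.d k (F.z k u) = F.z k (F.d k u) + u := by
  simpa using LinearMap.congr_fun (F.dz k k) u

lemma ac_apply (i u) : F.a i (F.c i u) = u - F.c i (F.a i u) := by
  have := LinearMap.congr_fun (F.ac i i) u
  simp only [if_true, Module.End.mul_apply, LinearMap.add_apply, LinearMap.neg_apply,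
    Module.End.one_apply] at this
  rw [this]; abel

lemma aa_apply (i u) : F.a i (F.a i u) = 0 := LinearMap.congr_fun (F.aa_self i) u

lemma sum_genE_self : ∑ k, F.genE k k = F.nx - F.ny - F.eul := by
  simp [genE, nx, ny, eul, Finset.sum_sub_distrib]

lemma sum_dx_x_apply (u : M) : ∑ k, F.dx k (F.x k u) = (n : ℂ) • u - F.nx u := by
  simp only [F.ac_apply, Finset.sum_sub_distrib, nx, LinearMap.sum_apply, Module.End.mul_apply]
  simp [← Nat.cast_smul_eq_nsmul ℂ]

lemma sum_zz_genX : ∑ k, ∑ l, F.z k * F.z l * F.genX k l =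
    F.eul * F.eul - F.eul + (2 : ℂ) • (F.zeta * F.del) := by
  have h1 : ∀ k l, F.z k * F.z l * (F.d k * F.d l) =
      F.z k * F.d k * (F.z l * F.d l) - if k = l then F.z l * F.d l else 0 := by
    intro k l
    rw [mul_assoc (F.z k) (F.d k), ← mul_assoc (F.d k), F.dz]
    split_ifs with h
    · subst h; simp only [add_mul, mul_add, mul_assoc, one_mul]; abel
    · simp [mul_assoc]
  have h2 : ∀ k l, F.z k * F.z l * (F.x k * F.dy l) = F.z k * F.x k * (F.z l * F.dy l) := by
    intro k l
    rw [mul_assoc, ← mul_assoc (F.z l), F.zc, mul_assoc, mul_assoc]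
  have h3 : ∀ k l, F.z k * F.z l * (F.x l * F.dy k) = F.z l * F.x l * (F.z k * F.dy k) := by
    intro k l
    rw [F.zz k l, h2]
  simp only [genX, mul_add, Finset.sum_add_distrib, h1, h2, h3, Finset.sum_sub_distrib,
    Finset.sum_ite_eq, Finset.mem_univ, if_true]
  rw [Finset.sum_comm (f := fun k l => F.z l * F.x l * (F.z k * F.dy k)), two_smul]
  simp only [eul, zeta, del, Finset.sum_mul_sum]

/-! ### Singular vectors among the primitive vectors -/

/-- The occupation numbers of the vector `ξ₁ ⋯ ξⱼ zₙᵉ`. -/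
def _root_.SymplecticSpinor.topOcc (n j e : ℕ) : Fin n ⊕ (Fin n ⊕ Fin n) → ℕ
  | Sum.inl k => if (k : ℕ) + 1 = n then e else 0
  | Sum.inr (Sum.inl k) => if (k : ℕ) < j then 1 else 0
  | Sum.inr (Sum.inr _) => 0

/-- An initial segment of `Fin n` is determined by its cardinality. -/
lemma _root_.SymplecticSpinor.mem_iff_lt_card {n : ℕ} (A : Finset (Fin n))
    (hA : ∀ k l, k < l → l ∈ A → k ∈ A) (k : Fin n) : k ∈ A ↔ (k : ℕ) < A.card := by
  constructor
  · intro hk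
    have : Finset.Iic k ⊆ A := fun l hl => by
      rcases (Finset.mem_Iic.1 hl).eq_or_lt with rfl | h
      · exact hk
      · exact hA l k h hk
    have := Finset.card_le_card this
    rw [Fin.card_Iic] at this
    omega
  · intro hk
    by_contra hkA
    have : A ⊆ Finset.Iio k := fun l hl => by
      rw [Finset.mem_Iio]
      by_contra h
      rcases (not_lt.1 h).eq_or_lt with rfl | h
      · exact hkA hl
      · exact hkA (hA k l h hl)
    have := Finset.card_le_card this
    rw [Fin.card_Iio] at this
    omega

/-- A weight vector without `η`s that is divergence free and annihilated by the root vectors of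
`εₖ - εₗ`, `k < l`, is a multiple of `ξ₁ ⋯ ξⱼ zₙᵉ`. -/
lemma mem_occ_of_gl_singular (hn : 0 < n) {w : M} (hw0 : w ≠ 0) (hy : ∀ k, F.dy k w = 0)
    (hdiv : F.div w = 0) (hE : ∀ k l, k < l → F.genE k l w = 0) {wt : Fin n → ℂ}
    (hwt : ∀ k, F.genE k k w = wt k • w) {j e : ℕ} (he : F.eul w = (e : ℂ) • w)
    (hx : F.nx w = (j : ℂ) • w) (hej : e = 0 ∨ j < n) : w ∈ F.Occ (topOcc n j e) := by
  obtain ⟨q, hq⟩ : ∃ q : Fin n, (q : ℕ) + 1 = n := ⟨⟨n - 1, by omega⟩, by simp; omega⟩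
  have hlt : ∀ k, k ≠ q → k < q := fun k hk => by
    rw [Fin.lt_def]
    have := k.2
    have : (k : ℕ) ≠ q := fun h => hk (Fin.ext h)
    omega
  have hE' : ∀ k l, k < l → F.x k (F.dx l w) = F.z l (F.d k w) := by
    intro k l hkl
    have := hE k l hkl
    simp only [genE, LinearMap.sub_apply, Module.End.mul_apply, hy, map_zero, sub_zero] at this
    exact sub_eq_zero.1 this
  -- the bosonic quanta are all in the last mode, and not both `ξₙ` and `zₙ` occur
  have key : (∀ k, k ≠ q → F.d k w = 0) ∧ (e = 0 ∨ F.dx q w = 0) := by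
    rcases Nat.eq_zero_or_pos e with he0 | he0
    · subst he0
      exact ⟨fun k _ => F.d_eq_zero_of_eul (by simpa using he) k, Or.inl rfl⟩
    have hjn : j < n := hej.resolve_left (by omega)
    have hv : F.dx q w = 0 := by
      -- expanding `zₙ (div w) = 0` shows that `∂w/∂ξₙ` is an eigenvector of `zₙ dₙ` for `j - n < 0`
      have h1 : ∀ k, F.z q (F.d k (F.dx k w)) = F.dx k (F.x k (F.dx q w)) -
          if k = q then F.dx q w - F.z q (F.d q (F.dx q w)) else 0 := by
        intro k
        by_cases hk : k = q
        · subst hk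
          rw [if_pos rfl, F.ac_apply, F.aa_apply, map_zero]
          abel
        · rw [if_neg hk, sub_zero, hE' k q (hlt k hk)]
          have h2 := LinearMap.congr_fun (F.da k (Sum.inl k)) w
          have h3 := LinearMap.congr_fun (F.za q (Sum.inl k)) (F.d k w)
          simp only [Module.End.mul_apply] at h2 h3
          rw [h2, h3]
      have h2 : F.z q (F.div w) = 0 := by rw [hdiv, map_zero]
      rw [div, LinearMap.sum_apply, map_sum] at h2
      simp only [Module.End.mul_apply] at h2
      rw [Finset.sum_congr rfl fun k _ => h1 k, Finset.sum_sub_distrib, Finset.sum_ite_eq',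
        if_pos (Finset.mem_univ q), sum_dx_x_apply] at h2
      have h3 : F.nx (F.dx q w) = ((j : ℂ) + -1) • F.dx q w := (F.nx_dx q).apply_of_eigen hx
      rw [h3] at h2
      refine F.boson_spectrum q (μ := (j : ℂ) - n) ?_ ?_
      · rw [← sub_eq_zero, ← h2]; module
      · refine natCast_ne_of_re_neg ?_
        have : (j : ℝ) < n := by exact_mod_cast hjn
        simpa using this
    refine ⟨fun k hk => ?_, Or.inr hv⟩
    have h1 := hE' k q (hlt k hk)
    rw [hv, map_zero] at h1
    refine F.boson_spectrum q (μ := -1) ?_ (natCast_ne_of_re_neg (by simp))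
    have h2 := F.dz_apply q (F.d k w)
    rw [← h1, map_zero] at h2
    rw [neg_one_smul, eq_neg_iff_add_eq_zero, ← h2]
  obtain ⟨hd, hq'⟩ := key
  have hbos : F.z q (F.d q w) = (e : ℂ) • w := by
    rw [← he, eul, LinearMap.sum_apply, Finset.sum_eq_single q]
    · rfl
    · intro k _ hk
      rw [Module.End.mul_apply, hd k hk, map_zero]
    · simp
  -- `w` has well-defined occupation numbers of the modes `ξₖ`
  have hμ : ∀ k, ∃ μ : ℂ, F.x k (F.dx k w) = μ • w := by
    intro k
    have h1 := hwt k
    simp only [genE, LinearMap.sub_apply, Module.End.mul_apply, hy, map_zero, sub_zero] at h1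
    by_cases hk : k = q
    · subst hk
      rw [hbos] at h1
      exact ⟨wt k + e, by rw [add_smul, ← h1]; abel⟩
    · exact ⟨wt k, by simpa [hd k hk] using h1⟩
  choose μ hμ using hμ
  have hμ01 : ∀ k, μ k = 0 ∨ μ k = 1 := by
    intro k
    have h1 := LinearMap.congr_fun (F.num_idempotent (Sum.inl k)) w
    simp only [Module.End.mul_apply, hμ, map_smul, smul_smul] at h1
    have h2 : (μ k * μ k - μ k) • w = 0 := by rw [sub_smul, h1, sub_self]
    have h3 := (smul_eq_zero.1 h2).resolve_right hw0
    have h4 : μ k * (μ k - 1) = 0 := by linear_combination h3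
    rcases mul_eq_zero.1 h4 with h | h
    · exact Or.inl h
    · exact Or.inr (sub_eq_zero.1 h)
  have hmono : ∀ k l, k < l → μ l = 1 → μ k = 1 := by
    intro k l hkl hl
    by_contra hk
    have hk0 : μ k = 0 := (hμ01 k).resolve_right hk
    have hkq : k ≠ q := by
      rintro rfl
      have := l.2
      rw [Fin.lt_def] at hkl
      omega
    have h1 : F.x k (F.dx l w) = 0 := by rw [hE' k l hkl, hd k hkq, map_zero]
    have h2 := F.ac_apply (Sum.inl k) (F.dx l w)
    have h3 := (F.shifts_ca_a (Sum.inl k) (Sum.inl l)).apply_of_eigen (u := w) (hμ k)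
    rw [if_neg (by simpa using hkl.ne), hk0, add_zero, zero_smul] at h3
    change F.c _ (F.a _ _) = 0 at h3
    rw [h3, h1, map_zero, sub_zero] at h2
    have h4 := hμ l
    rw [hl, one_smul, ← h2, map_zero] at h4
    exact hw0 h4.symm
  have hocc : ∀ k, μ k = if (k : ℕ) < j then 1 else 0 := by
    classical
    have hmem := mem_iff_lt_card (Finset.univ.filter fun k => μ k = 1)
      (fun k l hkl hl => by simpa using hmono k l hkl (by simpa using hl))
    have hcard : (Finset.univ.filter fun k => μ k = 1).card = j := by
      have h1 : F.nx w = (∑ k, μ k) • w := by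
        simp [nx, LinearMap.sum_apply, hμ, Finset.sum_smul]
      have h2 : (∑ k, μ k) = ((Finset.univ.filter fun k => μ k = 1).card : ℂ) := by
        rw [Finset.card_filter]
        push_cast
        refine Finset.sum_congr rfl fun k _ => ?_
        rcases hμ01 k with h | h <;> simp [h]
      have h3 : ((∑ k, μ k) - j) • w = 0 := by rw [sub_smul, ← h1, hx, sub_self]
      have h4 := sub_eq_zero.1 ((smul_eq_zero.1 h3).resolve_right hw0)
      rw [h2] at h4
      exact_mod_cast h4
    intro k
    have := hmem k
    rw [hcard, Finset.mem_filter] at this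
    split_ifs with h
    · exact (this.2 h).2
    · exact (hμ01 k).resolve_right fun h' => h (this.1 ⟨Finset.mem_univ _, h'⟩)
  rw [mem_occ]
  rintro (k | k | k)
  · by_cases hk : k = q
    · subst hk
      simpa [num, topOcc, hq] using hbos
    · have : ¬ (k : ℕ) + 1 = n := fun h => hk (Fin.ext (by omega))
      simp [num, topOcc, this, hd k hk]
  · have := hμ k
    rw [hocc k] at this
    simpa [num, topOcc] using this
  · have := hy k
    simp only [dy] at this
    simp [num, topOcc, this]

end Fock

namespace Fock

variable {n : ℕ} {M : Type*} [AddCommGroup M] [Module ℂ M] (F : Fock n M)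

/-- A vector of weight `wt` (shifted by `1/2`) that is annihilated by all positive root vectors. -/
structure IsSingular (wt : Fin n → ℂ) (u : M) : Prop where
  genX_eq_zero : ∀ k l, F.genX k l u = 0
  genE_eq_zero : ∀ k l, k < l → F.genE k l u = 0
  genE_self : ∀ k, F.genE k k u = wt k • u

variable {F}

lemma IsSingular.weight_sum {wt : Fin n → ℂ} {u : M} (h : F.IsSingular wt u) :
    F.nx u - F.ny u - F.eul u = (∑ k, wt k) • u := by
  have := LinearMap.congr_fun F.sum_genE_self u
  simp only [LinearMap.sum_apply, h.genE_self, LinearMap.sub_apply, ← Finset.sum_smul] at this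
  exact this.symm

lemma IsSingular.eul_eul {wt : Fin n → ℂ} {u : M} (h : F.IsSingular wt u) :
    F.eul (F.eul u) - F.eul u + (2 : ℂ) • F.zeta (F.del u) = 0 := by
  have := LinearMap.congr_fun F.sum_zz_genX u
  simp only [LinearMap.sum_apply, Module.End.mul_apply, h.genX_eq_zero, map_zero,
    Finset.sum_const_zero, LinearMap.add_apply, LinearMap.sub_apply, LinearMap.smul_apply] at this
  exact this.symm

section Pointwise

variable (F)

lemma div_zeta_apply (u : M) : F.div (F.zeta u) =
    (n : ℂ) • u + F.eul u - F.nx u - F.zeta (F.div u) := by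
  have := LinearMap.congr_fun F.div_zeta u
  simp only [LinearMap.add_apply, Module.End.mul_apply, LinearMap.sub_apply, LinearMap.smul_apply,
    Module.End.one_apply] at this
  rw [← this]; abel

lemma del_div_apply (u : M) : F.del (F.div u) = F.lam u - F.div (F.del u) := by
  rw [← del_div]
  simp

lemma del_del_apply (u : M) : F.del (F.del u) = 0 := LinearMap.congr_fun F.del_del u

lemma zeta_zeta_apply (u : M) : F.zeta (F.zeta u) = 0 := LinearMap.congr_fun F.zeta_zeta u

lemma del_zeta_apply (u : M) : F.del (F.zeta u) = -F.zeta (F.del u) :=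
  LinearMap.congr_fun F.del_zeta u

lemma div_delT_apply (u : M) : F.div (F.delT u) = -F.delT (F.div u) :=
  LinearMap.congr_fun F.div_delT u

lemma del_delT_apply (u : M) : F.del (F.delT u) = F.eul u + F.ny u - F.delT (F.del u) := by
  have := LinearMap.congr_fun F.del_delT u
  simp only [LinearMap.add_apply, Module.End.mul_apply] at this
  rw [← this]; abel

end Pointwise

/-- A primitive singular vector without `η`s. -/
lemma IsSingular.mem_occ_of_del_eq_zero (hn : 0 < n) {wt : Fin n → ℂ} {u : M}
    (h : F.IsSingular wt u) (hu0 : u ≠ 0) (hF : F.Fm u = 0) {j : ℕ}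
    (hdeg : F.deg u = (j : ℂ) • u) (hdel : F.del u = 0) :
    u ∈ F.Occ (topOcc n j 0) ∨ j ≠ n ∧ u ∈ F.Occ (topOcc n j 1) := by
  have hdiv : F.div u = 0 := by simpa [Fm, hdel] using hF
  have hlam : F.lam u = 0 := by
    have := F.del_div_apply u
    rw [hdiv, hdel, map_zero, map_zero, sub_zero] at this
    exact this.symm
  have hE2 : F.eul (F.eul u) = F.eul u := by
    have := h.eul_eul
    rwa [hdel, map_zero, smul_zero, add_zero, sub_eq_zero] at this
  -- `u` has degree at most one in the bosons
  have hdd : ∀ k l, F.d k (F.d l u) = 0 := by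
    intro k l
    have hs : Shifts F.eul (F.d k * F.d l) (-2) := ((F.eul_d k).mul (F.eul_d l)).of_eq (by norm_num)
    have h1 : (F.d k * F.d l) (F.eul u) = 0 := by
      refine F.eul_spectrum (μ := -1) ?_ (natCast_ne_of_re_neg (by simp))
      rw [hs.apply, hE2]; module
    refine F.eul_spectrum (μ := -2) ?_ (natCast_ne_of_re_neg (by simp))
    have := hs.apply u
    rwa [h1, zero_add] at this
  have hX : ∀ k l, F.x k (F.dy l u) + F.x l (F.dy k u) = 0 := by
    intro k l
    simpa [genX, hdd] using h.genX_eq_zero k l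
  -- contracting `hX` with `∂/∂ξₖ` gives `(n + 1 - nx) (∂u/∂ηₗ) = 0`
  have hdy : ∀ l, F.dy l u = 0 := by
    intro l
    refine F.eq_zero_of_nx_succ ?_
    have h1 : ∀ k, F.dx k (F.x l (F.dy k u)) =
        (if k = l then F.dy l u else 0) - F.x l (F.dx k (F.dy k u)) := by
      intro k
      have := LinearMap.congr_fun (F.ac (Sum.inl k) (Sum.inl l)) (F.dy k u)
      simp only [Module.End.mul_apply, LinearMap.add_apply, LinearMap.neg_apply] at this
      rw [this]
      by_cases hk : k = l
      · subst hk; simp; abel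
      · simp [hk]
    have h2 : ∑ k, F.dx k (F.x k (F.dy l u) + F.x l (F.dy k u)) = 0 := by simp [hX]
    have h3 : ∑ k, F.x l (F.dx k (F.dy k u)) = 0 := by
      rw [← map_sum]
      have : ∑ k, F.dx k (F.dy k u) = F.lam u := by simp [lam]
      rw [this, hlam, map_zero]
    simp only [map_add, Finset.sum_add_distrib, sum_dx_x_apply] at h2
    rw [Finset.sum_congr rfl fun k _ => h1 k, Finset.sum_sub_distrib, h3, Finset.sum_ite_eq',
      if_pos (Finset.mem_univ l)] at h2
    rw [eq_comm, ← sub_eq_zero, ← h2]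
    module
  have hny : F.ny u = 0 := by simp [ny, hdy]
  have hnx : F.nx u = (j : ℂ) • u := by simpa [deg, hny] using hdeg
  obtain ⟨κ, hκ⟩ : ∃ κ : ℂ, F.eul u = κ • u := by
    refine ⟨j - ∑ k, wt k, ?_⟩
    have := h.weight_sum
    rw [hny, hnx, sub_zero] at this
    rw [sub_smul, ← this]; abel
  have hκ01 : κ = 0 ∨ κ = 1 := by
    rw [hκ, map_smul, hκ, smul_smul, ← sub_eq_zero, ← sub_smul] at hE2
    have h1 : κ * (κ - 1) = 0 := by
      linear_combination (smul_eq_zero.1 hE2).resolve_right hu0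
    rcases mul_eq_zero.1 h1 with h | h
    · exact Or.inl h
    · exact Or.inr (sub_eq_zero.1 h)
  have hjn' : j ≤ n := by
    by_contra hlt
    refine hu0 (F.nx_spectrum hnx fun m hm e => ?_)
    have : m = j := by exact_mod_cast e
    omega
  rcases hκ01 with rfl | rfl
  · exact Or.inl (F.mem_occ_of_gl_singular hn hu0 hdy hdiv h.genE_eq_zero h.genE_self
      (by simpa using hκ) hnx (Or.inl rfl))
  · have hjn : j ≠ n := by
      -- if all `ξₖ` occur in `u`, then `div u = 0` implies `dₖ u = 0`
      rintro rfl
      have hxu : ∀ k, F.x k u = 0 := F.x_eq_zero_of_nx hnx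
      have hd : ∀ k, F.d k u = 0 := by
        intro k
        have h1 : ∀ l, F.x k (F.d l (F.dx l u)) = if l = k then F.d k u else 0 := by
          intro l
          have h2 := LinearMap.congr_fun (F.dc l (Sum.inl k)) (F.dx l u)
          have h3 := LinearMap.congr_fun (F.ac (Sum.inl l) (Sum.inl k)) u
          simp only [Module.End.mul_apply, LinearMap.add_apply, LinearMap.neg_apply, hxu,
            map_zero] at h2 h3
          rw [← h2]
          by_cases hl : l = k
          · subst hl
            simp only [if_true, Module.End.one_apply] at h3 ⊢
            change F.d l (F.c _ (F.a _ u)) = F.d l u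
            rw [neg_add_eq_zero.1 h3.symm]
          · simp only [Sum.inl.injEq, hl, if_false, LinearMap.zero_apply, add_zero] at h3 ⊢
            change F.d l (F.c _ (F.a _ u)) = 0
            rw [neg_eq_zero.1 h3.symm, map_zero]
        have h2 : F.x k (F.div u) = 0 := by rw [hdiv, map_zero]
        rw [div, LinearMap.sum_apply, map_sum] at h2
        simp only [Module.End.mul_apply] at h2
        rwa [Finset.sum_congr rfl fun l _ => h1 l, Finset.sum_ite_eq',
          if_pos (Finset.mem_univ k)] at h2
      have : F.eul u = 0 := by simp [eul, hd]
      rw [this, one_smul] at hκ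
      exact hu0 hκ.symm
    exact Or.inr ⟨hjn, F.mem_occ_of_gl_singular hn hu0 hdy hdiv h.genE_eq_zero h.genE_self
      (by simpa using hκ) hnx (Or.inr (by omega))⟩

/-- A primitive singular vector `u` containing `η`s has degree `n` and is recovered from
`w = ∑ zₖ ∂u/∂ηₖ`, which is a multiple of `ξ₁ ⋯ ξₙ₋₁ zₙ²`. -/
lemma IsSingular.eq_of_del_ne_zero (hn : 0 < n) {wt : Fin n → ℂ} {u : M}
    (h : F.IsSingular wt u) (hF : F.Fm u = 0) {j : ℕ} (hj : j ≤ n)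
    (hdeg : F.deg u = (j : ℂ) • u) (hdel : F.del u ≠ 0) :
    j = n ∧ F.del u ∈ F.Occ (topOcc n (n - 1) 2) ∧
      u = (1 / 2 : ℂ) • F.delT (F.del u) - (1 / 3 : ℂ) • F.zeta (F.del u) := by
  obtain ⟨w, hw⟩ : ∃ w, w = F.del u := ⟨_, rfl⟩
  rw [← hw] at hdel ⊢
  have hdivu : F.div u = -w := by
    rw [Fm, LinearMap.add_apply, ← hw] at hF
    exact (neg_eq_of_add_eq_zero_right hF).symm
  have hlam : F.lam u = 0 := by
    rw [← Fm_Fm, Module.End.mul_apply, hF, map_zero]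
  have hdelw : F.del w = 0 := by rw [hw, del_del_apply]
  have hdivw : F.div w = 0 := by
    have := F.del_div_apply u
    rw [hdivu, map_neg, hdelw, neg_zero, hlam, zero_sub, ← hw] at this
    exact neg_eq_zero.1 this.symm
  have hkey := h.eul_eul
  rw [← hw] at hkey
  have hdel_eul : ∀ v, F.del (F.eul v) = F.eul (F.del v) - F.del v := fun v => by
    rw [F.eul_del.apply]; module
  have hdiv_eul : ∀ v, F.div (F.eul v) = F.eul (F.div v) + F.div v := fun v => by
    rw [F.eul_div.apply]; module
  -- apply `del` and `div` to the equation `eul (eul u) - eul u = -2 zeta w`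
  have e1 : F.eul (F.eul w) - (3 : ℂ) • F.eul w + (2 : ℂ) • w = 0 := by
    have := congrArg F.del hkey
    simp only [map_add, map_sub, map_smul, hdel_eul, ← hw, del_zeta_apply, hdelw, map_zero] at this
    rw [← this]; module
  have e2 : F.eul (F.eul w) - F.eul w - (2 * (n : ℂ)) • w + (2 : ℂ) • F.nx w = 0 := by
    have := congrArg F.div hkey
    simp only [map_add, map_sub, map_smul, hdiv_eul, hdivu, div_zeta_apply, hdivw, map_zero,
      map_neg] at this
    rw [← neg_eq_zero, ← this]; module
  have hdegw : F.nx w + F.ny w = ((j : ℂ) - 1) • w := by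
    have hs : Shifts F.deg F.del (-1) := (F.nx_del.add_left F.ny_del).of_eq (by simp)
    have := hs.apply_of_eigen hdeg
    rw [← hw, deg, LinearMap.add_apply] at this
    rw [this]; rfl
  obtain ⟨c, hc⟩ : ∃ c : ℂ, c = ∑ k, wt k := ⟨_, rfl⟩
  have hcu : F.nx u - F.ny u - F.eul u = c • u := hc ▸ h.weight_sum
  have hcw : F.nx w - F.ny w - F.eul w = c • w := by
    have hs : Shifts (F.nx - F.ny - F.eul) F.del 0 :=
      ((F.nx_del.sub_left F.ny_del).sub_left F.eul_del).of_eq (by norm_num)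
    have := hs.apply_of_eigen (u := u) (μ := c) hcu
    rw [← hw, add_zero] at this
    exact this
  have h2nx : (2 : ℂ) • F.nx w = (c + j - 1) • w + F.eul w := by
    have h1 : (2 : ℂ) • F.nx w = (F.nx w - F.ny w - F.eul w) + (F.nx w + F.ny w) + F.eul w := by
      module
    rw [h1, hcw, hdegw]; module
  -- eliminating `eul (eul w)` from `e1` and `e2` shows that `w` is an eigenvector of `eul`
  obtain ⟨κ, hκ⟩ : ∃ κ : ℂ, F.eul w = κ • w := by
    refine ⟨(2 * n - c - j + 3) / 3, ?_⟩
    have h1 : (3 : ℂ) • F.eul w = (2 * (n : ℂ) - c - j + 3) • w := by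
      rw [h2nx] at e2
      have h3 : (3 : ℂ) • F.eul w - (2 * (n : ℂ) - c - j + 3) • w =
        (F.eul (F.eul w) - F.eul w - (2 * (n : ℂ)) • w + ((c + j - 1) • w + F.eul w)) -
        (F.eul (F.eul w) - (3 : ℂ) • F.eul w + (2 : ℂ) • w) := by module
      rw [e1, e2, sub_zero] at h3
      exact sub_eq_zero.1 h3
    rw [div_eq_inv_mul, mul_smul, ← h1, smul_smul]; norm_num
  have hκ12 : κ = 1 ∨ κ = 2 := by
    have h1 : ((κ - 1) * (κ - 2)) • w = 0 := by
      rw [← e1, hκ, map_smul, hκ]; module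
    rcases mul_eq_zero.1 ((smul_eq_zero.1 h1).resolve_right hdel) with h | h
    · exact Or.inl (sub_eq_zero.1 h)
    · exact Or.inr (sub_eq_zero.1 h)
  have hnxw : F.nx w = ((n : ℂ) - (κ * κ - κ) / 2) • w := by
    have h1 : F.nx w - ((n : ℂ) - (κ * κ - κ) / 2) • w = (1 / 2 : ℂ) •
        (F.eul (F.eul w) - F.eul w - (2 * (n : ℂ)) • w + (2 : ℂ) • F.nx w) := by
      rw [hκ, map_smul, hκ]; module
    rw [e2, smul_zero] at h1
    exact sub_eq_zero.1 h1
  have hjR : (j : ℝ) ≤ n := by exact_mod_cast hj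
  -- for `κ = 1` the number of `η`s in `w` would be `j - 1 - n < 0`
  rcases hκ12 with rfl | rfl
  · exfalso
    refine hdel (F.ny_spectrum (μ := (j : ℂ) - 1 - n) ?_ (natCast_ne_of_re_neg ?_))
    · have h1 : F.ny w = (F.nx w + F.ny w) - F.nx w := by abel
      rw [h1, hdegw, hnxw]; module
    · simp; linarith
  have hnyw : F.ny w = ((j : ℂ) - n) • w := by
    have h1 : F.ny w = (F.nx w + F.ny w) - F.nx w := by abel
    rw [h1, hdegw, hnxw]; module
  have hjn : j = n := by
    by_contra hne
    refine hdel (F.ny_spectrum hnyw (natCast_ne_of_re_neg ?_))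
    have : (j : ℝ) < n := lt_of_le_of_ne hjR (by exact_mod_cast hne)
    simpa using this
  subst hjn
  rw [sub_self, zero_smul] at hnyw
  have hwt : ∀ k l, ∀ v, F.genE k l (F.del v) = F.del (F.genE k l v) := fun k l v =>
    LinearMap.congr_fun (F.genE_del k l) v
  have hmem : w ∈ F.Occ (topOcc j (j - 1) 2) := by
    refine F.mem_occ_of_gl_singular (wt := wt) hn hdel (F.dy_eq_zero_of_ny hnyw) hdivw ?_ ?_
      (by exact_mod_cast hκ) ?_ (Or.inr (by omega))
    · intro k l hkl
      rw [hw, hwt, h.genE_eq_zero k l hkl, map_zero]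
    · intro k
      rw [hw, hwt, h.genE_self, map_smul]
    · rw [hnxw, Nat.cast_sub (by omega)]; congr 1; push_cast; ring
  refine ⟨rfl, hmem, ?_⟩
  -- the component `v` of `u` of bosonic degree one
  obtain ⟨q, hq⟩ : ∃ q, q = F.zeta w := ⟨_, rfl⟩
  obtain ⟨v, hv⟩ : ∃ v, v = u + (1 / 3 : ℂ) • q := ⟨_, rfl⟩
  have huv : u = v - (1 / 3 : ℂ) • q := by rw [hv]; abel
  have hEq : F.eul q = (3 : ℂ) • q := by
    rw [hq, F.eul_zeta.apply_of_eigen hκ]; norm_num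
  have hNq : F.nx q = (j : ℂ) • q := by
    rw [hq, F.nx_zeta.apply_of_eigen hnxw]; congr 1; ring
  have hNyq : F.ny q = 0 := by
    rw [hq, F.ny_zeta.apply, hnyw, map_zero, zero_smul, add_zero]
  have hEv : F.eul (F.eul v) = F.eul v := by
    rw [← sub_eq_zero, ← hkey, hv, ← hq]
    simp only [map_add, map_smul, hEq]
    module
  have hcj : c = (j : ℂ) - 3 := by
    have h1 : ((c - (j - 3)) : ℂ) • w = 0 := by
      rw [sub_smul, ← hcw, hnxw, hnyw, hκ]; module
    exact sub_eq_zero.1 ((smul_eq_zero.1 h1).resolve_right hdel)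
  have hdegv : F.nx v + F.ny v = (j : ℂ) • v := by
    rw [deg, LinearMap.add_apply] at hdeg
    have h1 : F.nx v + F.ny v = (F.nx u + F.ny u) + (1 / 3 : ℂ) • (F.nx q + F.ny q) := by
      rw [hv, map_add, map_add, map_smul, map_smul]; module
    rw [h1, hdeg, hNq, hNyq, hv]; module
  have hcv : F.nx v - F.ny v - F.eul v = c • v := by
    have h1 : F.nx v - F.ny v - F.eul v = (F.nx u - F.ny u - F.eul u) +
        (1 / 3 : ℂ) • (F.nx q - F.ny q - F.eul q) := by
      rw [hv]; simp only [map_add, map_smul]; module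
    rw [h1, hcu, hNq, hNyq, hEq, hv, hcj]; module
  have h2nxv : F.nx v = (1 / 2 : ℂ) • ((2 * (j : ℂ) - 3) • v + F.eul v) := by
    have h1 : F.nx v = (1 / 2 : ℂ) • ((F.nx v - F.ny v - F.eul v) + (F.nx v + F.ny v) +
        F.eul v) := by module
    rw [h1, hcv, hdegv, hcj]; module
  have hE1 : F.eul v = v := by
    -- otherwise the number of `ξ`s in `eul v - v` would be a half-integer
    have hy : F.eul v - v = 0 := by
      refine F.nx_spectrum (μ := (j : ℂ) - 3 / 2) ?_ ?_
      · have h1 := LinearMap.congr_fun F.nx_eul v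
        simp only [Module.End.mul_apply] at h1
        rw [map_sub, h1, h2nxv]
        simp only [map_smul, map_add, hEv]
        module
      · intro m _ hm
        have h1 : (2 * m + 3 : ℂ) = 2 * j := by rw [hm]; ring
        have h2 : 2 * m + 3 = 2 * j := by exact_mod_cast h1
        omega
    exact sub_eq_zero.1 hy
  have hnyv : F.ny v = v := by
    have h1 : F.ny v = (F.nx v + F.ny v) - F.nx v := by abel
    rw [h1, hdegv, h2nxv, hE1]; module
  have hdelv : F.del v = w := by
    rw [hv, map_add, map_smul, ← hw, hq, del_zeta_apply, hdelw]; simp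
  -- `Fp u = 0`, as `u` is primitive of degree `n`, and its parts of bosonic degree `0` and `2`
  -- vanish
  have hT : F.delT v = 0 := by
    have hFp : F.Fp u = 0 := Fp_eq_zero_of_primitive hdeg hF
    rw [Fp, LinearMap.sub_apply, sub_eq_zero, huv] at hFp
    simp only [map_sub, map_smul, hq, zeta_zeta_apply, smul_zero, sub_zero] at hFp
    have h1 := congrArg F.eul hFp
    have h2 := F.eul_zeta.apply_of_eigen (u := v) (μ := 1) (by rw [hE1, one_smul])
    have h3 := F.eul_delT.apply_of_eigen (u := v) (μ := 1) (by rw [hE1, one_smul])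
    have h4 := F.eul_delT.apply_of_eigen hEq
    rw [← hq] at hFp h1
    rw [map_sub, map_smul, h2, h3, h4, hFp] at h1
    have h5 : (2 : ℂ) • F.delT v = 0 := by
      have h6 := sub_eq_zero.2 h1
      rw [← h6]; module
    exact (smul_eq_zero.1 h5).resolve_left two_ne_zero
  have h2v := F.del_delT_apply v
  rw [hT, map_zero, hE1, hnyv, hdelv] at h2v
  have h3v : F.delT w = (2 : ℂ) • v := by
    rw [two_smul]; exact (sub_eq_zero.1 h2v.symm).symm
  rw [h3v, ← hq, huv]
  module

end Fock

namespace Fock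

variable {n : ℕ} {M : Type*} [AddCommGroup M] [Module ℂ M] (F : Fock n M)

/-! ### Occupation number states -/

/-- The creation operators of all modes. -/
def cre : Fin n ⊕ (Fin n ⊕ Fin n) → Module.End ℂ M
  | Sum.inl k => F.z k
  | Sum.inr i => F.c i

/-- The annihilation operators of all modes. -/
def ann : Fin n ⊕ (Fin n ⊕ Fin n) → Module.End ℂ M
  | Sum.inl k => F.d k
  | Sum.inr i => F.a i

lemma cre_ann_apply (p u) : F.cre p (F.ann p u) = F.num p u := by
  rcases p with k | i <;> rfl

lemma shifts_num_cre (p q) : Shifts (F.num p) (F.cre q) (if p = q then 1 else 0) := by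
  rcases p with k | i <;> rcases q with l | j
  · simpa [num, cre] using F.shifts_zd_z k l
  · simpa [num, cre] using F.shifts_zd_c k j
  · simpa [num, cre] using F.shifts_ca_z i l
  · simpa [num, cre] using F.shifts_ca_c i j

lemma shifts_num_ann (p q) : Shifts (F.num p) (F.ann q) (if p = q then -1 else 0) := by
  rcases p with k | i <;> rcases q with l | j
  · simpa [num, ann] using F.shifts_zd_d k l
  · simpa [num, ann] using F.shifts_zd_a k j
  · simpa [num, ann] using F.shifts_ca_d i l
  · simpa [num, ann] using F.shifts_ca_a i j

variable {F} {o : Fin n ⊕ (Fin n ⊕ Fin n) → ℕ} {u : M}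

lemma cre_mem_occ (hu : u ∈ F.Occ o) (q) : F.cre q u ∈ F.Occ (Function.update o q (o q + 1)) := by
  rw [mem_occ] at hu ⊢
  intro p
  rw [(F.shifts_num_cre p q).apply_of_eigen (hu p)]
  by_cases h : p = q
  · subst h; simp
  · simp [h]

lemma ann_mem_occ (hu : u ∈ F.Occ o) {q} (hq : 0 < o q) :
    F.ann q u ∈ F.Occ (Function.update o q (o q - 1)) := by
  rw [mem_occ] at hu ⊢
  intro p
  rw [(F.shifts_num_ann p q).apply_of_eigen (hu p)]
  by_cases h : p = q
  · subst h
    simp only [if_true, Function.update_self]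
    rw [Nat.cast_sub hq]; push_cast; rfl
  · simp [h]

lemma ann_eq_zero (hu : u ∈ F.Occ o) {q} (hq : o q = 0) : F.ann q u = 0 := by
  have h := (F.shifts_num_ann q q).apply_of_eigen (F.mem_occ.1 hu q)
  refine F.eq_zero_of_spectrum (t := fun o => (o q : ℂ)) (fun o v hv => F.mem_occ.1 hv q)
    (fun o _ => natCast_ne_of_re_neg (μ := -1) (by simp) _) ?_
  simpa [hq] using h

/-- The vector `v` spans the space of vectors annihilated by all annihilation operators. -/
structure IsVacuum (F : Fock n M) (v : M) : Prop where
  ne_zero : v ≠ 0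
  ann_eq_zero : ∀ p, F.ann p v = 0
  unique : ∀ u, (∀ p, F.ann p u = 0) → ∃ t : ℂ, u = t • v

/-- In a Fock space with a unique vacuum, a vector is determined up to scalars by its occupation
numbers. -/
lemma IsVacuum.occ_unique {v : M} (hv : F.IsVacuum v) {u' : M} (hu : u ∈ F.Occ o) (hu0 : u ≠ 0)
    (hu' : u' ∈ F.Occ o) : ∃ t : ℂ, u' = t • u := by
  obtain ⟨m, hm⟩ : ∃ m, m = ∑ p, o p := ⟨_, rfl⟩
  induction m generalizing o u u' with
  | zero =>
    have h0 : ∀ p, o p = 0 := fun p => (Finset.sum_eq_zero_iff.1 hm.symm) p (Finset.mem_univ p)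
    obtain ⟨t, ht⟩ := hv.unique u fun p => Fock.ann_eq_zero hu (h0 p)
    obtain ⟨t', ht'⟩ := hv.unique u' fun p => Fock.ann_eq_zero hu' (h0 p)
    have ht0 : t ≠ 0 := fun h => hu0 (by rw [ht, h, zero_smul])
    exact ⟨t' * t⁻¹, by rw [ht, ht', smul_smul, inv_mul_cancel_right₀ ht0]⟩
  | succ m ih =>
    obtain ⟨q, hq⟩ : ∃ q, 0 < o q := by
      by_contra hcon
      push Not at hcon
      have : ∑ p, o p = 0 := Finset.sum_eq_zero fun p _ => Nat.le_zero.1 (hcon p)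
      omega
    have hq0 : (o q : ℂ) ≠ 0 := by exact_mod_cast hq.ne'
    have hne : F.ann q u ≠ 0 := fun h => by
      have := F.cre_ann_apply q u
      rw [h, map_zero, F.mem_occ.1 hu q] at this
      exact hu0 ((smul_eq_zero.1 this.symm).resolve_left hq0)
    obtain ⟨t, ht⟩ := ih (ann_mem_occ hu hq) hne (ann_mem_occ hu' hq) (by
      rw [Finset.sum_update_of_mem (Finset.mem_univ q)]
      have := Finset.add_sum_erase Finset.univ o (Finset.mem_univ q)
      rw [← Finset.erase_eq]
      omega)
    refine ⟨t, ?_⟩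
    have h1 := congrArg (F.cre q) ht
    rw [map_smul, cre_ann_apply, cre_ann_apply, F.mem_occ.1 hu q, F.mem_occ.1 hu' q,
      smul_comm] at h1
    exact smul_right_injective M hq0 h1

/-- An involution of the Fock space that anticommutes with the bosonic operators, commutes with the
fermionic operators and fixes the vacuum. -/
structure IsParity (F : Fock n M) (v : M) (P : Module.End ℂ M) : Prop where
  z : ∀ k, P * F.z k = -(F.z k * P)
  d : ∀ k, P * F.d k = -(F.d k * P)
  c : ∀ i, P * F.c i = F.c i * P
  a : ∀ i, P * F.a i = F.a i * P
  vacuum : P v = v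
  sq : P * P = 1

namespace IsParity

variable {v : M} {P : Module.End ℂ M}

lemma zeta (hP : F.IsParity v P) : P * F.zeta = -(F.zeta * P) := by
  simp only [Fock.zeta, Finset.mul_sum, Finset.sum_mul, ← Finset.sum_neg_distrib]
  exact Finset.sum_congr rfl fun k _ => by
    rw [← mul_assoc, hP.z, neg_mul, mul_assoc, hP.c, mul_assoc]

lemma delT (hP : F.IsParity v P) : P * F.delT = -(F.delT * P) := by
  simp only [Fock.delT, Finset.mul_sum, Finset.sum_mul, ← Finset.sum_neg_distrib]
  exact Finset.sum_congr rfl fun k _ => by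
    rw [← mul_assoc, hP.d, neg_mul, mul_assoc, hP.c, mul_assoc]

lemma del (hP : F.IsParity v P) : P * F.del = -(F.del * P) := by
  simp only [Fock.del, Finset.mul_sum, Finset.sum_mul, ← Finset.sum_neg_distrib]
  exact Finset.sum_congr rfl fun k _ => by
    rw [← mul_assoc, hP.z, neg_mul, mul_assoc, hP.a, mul_assoc]

lemma div (hP : F.IsParity v P) : P * F.div = -(F.div * P) := by
  simp only [Fock.div, Finset.mul_sum, Finset.sum_mul, ← Finset.sum_neg_distrib]
  exact Finset.sum_congr rfl fun k _ => by
    rw [← mul_assoc, hP.d, neg_mul, mul_assoc, hP.a, mul_assoc]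

lemma Fp (hP : F.IsParity v P) : P * F.Fp = -(F.Fp * P) := by
  rw [Fock.Fp, mul_sub, sub_mul, hP.zeta, hP.delT]; abel

lemma Fm (hP : F.IsParity v P) : P * F.Fm = -(F.Fm * P) := by
  rw [Fock.Fm, mul_add, add_mul, hP.del, hP.div]; abel

lemma Fp_Fm (hP : F.IsParity v P) : P * (F.Fp * F.Fm) = F.Fp * F.Fm * P := by
  rw [← mul_assoc, hP.Fp, neg_mul, mul_assoc, hP.Fm, mul_neg, neg_neg, mul_assoc]

lemma ca (hP : F.IsParity v P) (i j) : P * (F.c i * F.a j) = F.c i * F.a j * P := by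
  rw [← mul_assoc, hP.c, mul_assoc, hP.a, mul_assoc]

lemma zd (hP : F.IsParity v P) (k l) : P * (F.z k * F.d l) = F.z k * F.d l * P := by
  rw [← mul_assoc, hP.z, neg_mul, mul_assoc, hP.d, mul_neg, neg_neg, mul_assoc]

lemma zz (hP : F.IsParity v P) (k l) : P * (F.z k * F.z l) = F.z k * F.z l * P := by
  rw [← mul_assoc, hP.z, neg_mul, mul_assoc, hP.z, mul_neg, neg_neg, mul_assoc]

lemma dd (hP : F.IsParity v P) (k l) : P * (F.d k * F.d l) = F.d k * F.d l * P := by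
  rw [← mul_assoc, hP.d, neg_mul, mul_assoc, hP.d, mul_neg, neg_neg, mul_assoc]

lemma genX (hP : F.IsParity v P) (k l) : P * F.genX k l = F.genX k l * P := by
  simp only [Fock.genX, mul_add, add_mul, hP.dd, hP.ca]

lemma genY (hP : F.IsParity v P) (k l) : P * F.genY k l = F.genY k l * P := by
  simp only [Fock.genY, mul_add, add_mul, mul_sub, sub_mul, hP.zz, hP.ca]

lemma genE (hP : F.IsParity v P) (k l) : P * F.genE k l = F.genE k l * P := by
  simp only [Fock.genE, mul_sub, sub_mul, hP.zd, hP.ca]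

lemma deg (hP : F.IsParity v P) : P * F.deg = F.deg * P := by
  simp only [Fock.deg, Fock.nx, Fock.ny, mul_add, add_mul, Finset.mul_sum, Finset.sum_mul, hP.ca]

end IsParity

lemma topOcc_succ {j e : ℕ} (hj : j < n) : topOcc n (j + 1) e =
    Function.update (topOcc n j e) (Sum.inr (Sum.inl ⟨j, hj⟩)) 1 := by
  funext p
  rcases p with k | k | k
  · simp [topOcc]
  · by_cases h : k = ⟨j, hj⟩
    · subst h; simp [topOcc]
    · have h' : (k : ℕ) ≠ j := fun h' => h (Fin.ext h')
      rw [Function.update_of_ne (by simpa using h)]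
      have : (k : ℕ) < j + 1 ↔ (k : ℕ) < j := by omega
      simp [topOcc, this]
  · simp [topOcc]

lemma topOcc_boson_succ {j e : ℕ} {q : Fin n} (hq : (q : ℕ) + 1 = n) : topOcc n j (e + 1) =
    Function.update (topOcc n j e) (Sum.inl q) (e + 1) := by
  funext p
  rcases p with k | k | k
  · by_cases h : k = q
    · subst h; simp [topOcc, hq]
    · have h' : (k : ℕ) + 1 ≠ n := fun h' => h (Fin.ext (by omega))
      rw [Function.update_of_ne (by simpa using h)]
      simp [topOcc, h']
  · simp [topOcc]
  · simp [topOcc]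

/-- The vector `ξ₁ ⋯ ξⱼ zₙᵉ` is nonzero and has the parity of `e`. -/
lemma exists_mem_topOcc (hn : 0 < n) {v : M} (hv : F.IsVacuum v) {P : Module.End ℂ M}
    (hP : F.IsParity v P) {j : ℕ} (hj : j ≤ n) (e : ℕ) :
    ∃ u ∈ F.Occ (topOcc n j e), u ≠ 0 ∧ P u = (-1 : ℂ) ^ e • u := by
  have hfermion : ∃ u ∈ F.Occ (topOcc n j 0), u ≠ 0 ∧ P u = u := by
    induction j with
    | zero =>
      refine ⟨v, F.mem_occ.2 fun p => ?_, hv.ne_zero, hP.vacuum⟩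
      rw [← cre_ann_apply, hv.ann_eq_zero, map_zero]
      rcases p with k | k | k <;> simp [topOcc]
    | succ j ih =>
      obtain ⟨u, hu, hu0, hPu⟩ := ih (by omega)
      refine ⟨F.x ⟨j, hj⟩ u, ?_, fun h => hu0 ?_, ?_⟩
      · have := cre_mem_occ hu (Sum.inr (Sum.inl ⟨j, hj⟩))
        rw [topOcc_succ (by omega)]
        simpa [topOcc, cre] using this
      · have h1 := F.ac_apply (Sum.inl ⟨j, hj⟩) u
        have h2 : F.a (Sum.inl ⟨j, hj⟩) u = 0 :=
          Fock.ann_eq_zero hu (q := Sum.inr (Sum.inl ⟨j, hj⟩)) (by simp [topOcc])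
        rw [h, h2, map_zero, map_zero, sub_zero] at h1
        exact h1.symm
      · have := LinearMap.congr_fun (hP.c (Sum.inl ⟨j, hj⟩)) u
        simpa [hPu] using this
  induction e with
  | zero => simpa using hfermion
  | succ e ih =>
    obtain ⟨u, hu, hu0, hPu⟩ := ih
    obtain ⟨q, hq⟩ : ∃ q : Fin n, (q : ℕ) + 1 = n := ⟨⟨n - 1, by omega⟩, by simp; omega⟩
    refine ⟨F.z q u, ?_, fun h => hu0 ?_, ?_⟩
    · have := cre_mem_occ hu (Sum.inl q)
      rw [topOcc_boson_succ hq]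
      simpa [topOcc, hq, cre] using this
    · have h1 := F.dz_apply q u
      have h2 := occ_z hu q
      rw [h, h2, map_zero] at h1
      have h3 : ((e : ℂ) + 1) • u = 0 := by
        rw [add_smul, one_smul]
        simpa [topOcc, hq] using h1.symm
      exact (smul_eq_zero.1 h3).resolve_left (by exact_mod_cast e.succ_ne_zero)
    · have := LinearMap.congr_fun (hP.z q) u
      simp only [Module.End.mul_apply, LinearMap.neg_apply, hPu, map_smul] at this
      rw [this, pow_succ]; module

/-! ### Existence of singular vectors -/

variable (F)

lemma genE_self_shifts_z (m k) : Shifts (F.genE m m) (F.z k) (-(if m = k then 1 else 0)) := by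
  rw [Shifts, genE_z]; split_ifs with h <;> simp [h]
lemma genE_self_shifts_d (m k) : Shifts (F.genE m m) (F.d k) (if m = k then 1 else 0) := by
  rw [Shifts, genE_d]
  by_cases h : m = k
  · simp [h]
  · simp [h, Ne.symm h]
lemma genE_self_shifts_x (m k) : Shifts (F.genE m m) (F.x k) (if m = k then 1 else 0) := by
  rw [Shifts, genE_x]; split_ifs with h <;> simp [h]
lemma genE_self_shifts_dx (m k) : Shifts (F.genE m m) (F.dx k) (-(if m = k then 1 else 0)) := by
  rw [Shifts, genE_dx]
  by_cases h : m = k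
  · simp [h]
  · simp [h, Ne.symm h]
lemma genE_self_shifts_y (m k) : Shifts (F.genE m m) (F.y k) (-(if m = k then 1 else 0)) := by
  rw [Shifts, genE_y]; split_ifs with h <;> simp [h]
lemma genE_self_shifts_dy (m k) : Shifts (F.genE m m) (F.dy k) (if m = k then 1 else 0) := by
  rw [Shifts, genE_dy]
  by_cases h : m = k
  · simp [h]
  · simp [h, Ne.symm h]

lemma genE_self_shifts_genX (m k l) : Shifts (F.genE m m) (F.genX k l)
    ((if m = k then 1 else 0) + if m = l then 1 else 0) :=
  ((F.genE_self_shifts_d m k).mul (F.genE_self_shifts_d m l)).add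
    (((F.genE_self_shifts_x m k).mul (F.genE_self_shifts_dy m l)).add
      (((F.genE_self_shifts_x m l).mul (F.genE_self_shifts_dy m k)).of_eq (add_comm _ _)))

lemma genE_self_shifts_genE (m k l) : Shifts (F.genE m m) (F.genE k l)
    ((if m = k then 1 else 0) - if m = l then 1 else 0) :=
  ((((F.genE_self_shifts_x m k).mul (F.genE_self_shifts_dx m l)).of_eq (by ring)).sub
    (((F.genE_self_shifts_y m l).mul (F.genE_self_shifts_dy m k)).of_eq (by ring))).sub
    (((F.genE_self_shifts_z m l).mul (F.genE_self_shifts_d m k)).of_eq (by ring))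

lemma genE_self_comm (k l) : F.genE k k * F.genE l l = F.genE l l * F.genE k k := by
  have := F.genE_self_shifts_genE k l l
  rwa [sub_self, Shifts, zero_smul, add_zero] at this

/-- An element of the Cartan subalgebra on which the positive roots take negative integer values,
normalized to have natural numbers as its eigenvalues. -/
def height : Module.End ℂ M := ∑ k : Fin n, ((n : ℂ) - k) • (1 - F.genE k k)

lemma height_shifts {X : Module.End ℂ M} {κ : Fin n → ℂ} (h : ∀ m, Shifts (F.genE m m) X (κ m)) :
    Shifts F.height X (-∑ k : Fin n, ((n : ℂ) - k) * κ k) :=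
  (Shifts.sum_left fun k _ => (Shifts.one_left.sub_left (h k)).smul_left _).of_eq (by simp)

variable {F}

lemma occ_height (hu : u ∈ F.Occ o) (ho : ∀ i, o (Sum.inr i) ≤ 1) :
    F.height u = ((∑ k : Fin n, (n - k) * ((1 - o (Sum.inr (Sum.inl k))) +
      o (Sum.inr (Sum.inr k)) + o (Sum.inl k)) : ℕ) : ℂ) • u := by
  simp only [height, LinearMap.sum_apply, LinearMap.smul_apply, LinearMap.sub_apply,
    Module.End.one_apply, occ_genE hu]
  push_cast
  rw [Finset.sum_smul]
  refine Finset.sum_congr rfl fun k _ => ?_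
  rw [Nat.cast_sub (ho _), Nat.cast_sub k.2.le]
  push_cast
  module

lemma iSup_eigenspace_height : ⨆ m : ℕ, Module.End.eigenspace F.height (m : ℂ) = ⊤ := by
  rw [eq_top_iff, ← F.iSup_occ]
  refine iSup_le fun o => ?_
  by_cases ho : F.Occ o = ⊥
  · simp [ho]
  · exact le_iSup_of_le _ fun u hu => Module.End.mem_eigenspace_iff.2
      (occ_height hu (F.occ_fermion_le_one ho))

lemma height_spectrum {μ : ℂ} (hu : F.height u = μ • u) (hμ : ∀ m : ℕ, (m : ℂ) ≠ μ) : u = 0 :=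
  eq_zero_of_eigenvalue_ne iSup_eigenspace_height (t := fun m : ℕ => (m : ℂ))
    (fun _ _ hv => Module.End.mem_eigenspace_iff.1 hv) (fun m _ => hμ m) hu

lemma iSup_eigenspace_of_occ {T : Module.End ℂ M} {t : (Fin n ⊕ (Fin n ⊕ Fin n) → ℕ) → ℂ}
    (hT : ∀ o, ∀ u ∈ F.Occ o, T u = t o • u) : ⨆ μ, Module.End.eigenspace T μ = ⊤ := by
  rw [eq_top_iff, ← F.iSup_occ]
  exact iSup_le fun o => le_iSup_of_le (t o) fun u hu => Module.End.mem_eigenspace_iff.2 (hT o u hu)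

lemma _root_.SymplecticSpinor.exists_common_eigenvector {ι : Type*} [Fintype ι]
    (T : ι → Module.End ℂ M) (hc : ∀ i j, T i * T j = T j * T i)
    (hT : ∀ i, ⨆ μ, Module.End.eigenspace (T i) μ = ⊤) {W : Submodule ℂ M} (hW : W ≠ ⊥)
    (hst : ∀ i, ∀ u ∈ W, T i u ∈ W) : ∃ u ∈ W, u ≠ 0 ∧ ∃ wt : ι → ℂ, ∀ i, T i u = wt i • u := by
  classical
  have key : ∀ s : Finset ι, ∃ W' ≤ W, W' ≠ ⊥ ∧ (∀ i, ∀ u ∈ W', T i u ∈ W') ∧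
      ∃ wt : ι → ℂ, ∀ i ∈ s, ∀ u ∈ W', T i u = wt i • u := by
    intro s
    induction s using Finset.induction_on with
    | empty => exact ⟨W, le_rfl, hW, hst, 0, by simp⟩
    | insert a s ha ih =>
      obtain ⟨W', hle, hne, hst', wt, hwt⟩ := ih
      obtain ⟨μ, hμ⟩ : ∃ μ, W' ⊓ Module.End.eigenspace (T a) μ ≠ ⊥ := by
        by_contra hcon
        push Not at hcon
        have := le_iSup_inf_eigenspace (e := id) Function.injective_id (hT a) (hst' a)
        simp only [id, hcon, iSup_bot] at this
        exact hne (le_bot_iff.1 this)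
      refine ⟨_, inf_le_left.trans hle, hμ, ?_, Function.update wt a μ, ?_⟩
      · rintro i u ⟨hu, hu'⟩
        refine ⟨hst' i u hu, Module.End.mem_eigenspace_iff.2 ?_⟩
        have := LinearMap.congr_fun (hc a i) u
        simp only [Module.End.mul_apply] at this
        rw [this, Module.End.mem_eigenspace_iff.1 hu', map_smul]
      · rintro i hi u ⟨hu, hu'⟩
        rcases Finset.mem_insert.1 hi with rfl | hi
        · rw [Function.update_self, Module.End.mem_eigenspace_iff.1 hu']
        · rw [Function.update_of_ne (fun h : i = a => ha (h ▸ hi)), hwt i hi u hu]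
  obtain ⟨W', hle, hne, -, wt, hwt⟩ := key Finset.univ
  obtain ⟨u, hu, hu0⟩ := Submodule.exists_mem_ne_zero_of_ne_bot hne
  exact ⟨u, hle hu, hu0, wt, fun i => hwt i (Finset.mem_univ i) u hu⟩

/-- A nonzero stable subspace contains a singular vector of extremal weight. -/
lemma exists_isSingular {U : Submodule ℂ M} (hU : U ≠ ⊥) (hX : ∀ k l, ∀ u ∈ U, F.genX k l u ∈ U)
    (hE : ∀ k l, ∀ u ∈ U, F.genE k l u ∈ U) :
    ∃ u ∈ U, u ≠ 0 ∧ (∃ wt, F.IsSingular wt u) ∧ ∃ m : ℂ, F.height u = m • u ∧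
      ∀ t : ℕ, 0 < t → ∀ v ∈ U, F.height v = (m - t) • v → v = 0 := by
  classical
  have hH : ∀ u ∈ U, F.height u ∈ U := by
    intro u hu
    simp only [height, LinearMap.sum_apply, LinearMap.smul_apply, LinearMap.sub_apply,
      Module.End.one_apply]
    exact U.sum_mem fun k _ => U.smul_mem _ (U.sub_mem hu (hE k k u hu))
  have hex : ∃ m : ℕ, U ⊓ Module.End.eigenspace F.height (m : ℂ) ≠ ⊥ := by
    by_contra hcon
    push Not at hcon
    have := le_iSup_inf_eigenspace (e := fun m : ℕ => (m : ℂ)) Nat.cast_injective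
      (iSup_eigenspace_height (F := F)) hH
    simp only [hcon, iSup_bot] at this
    exact hU (le_bot_iff.1 this)
  obtain ⟨m, hm, hmin⟩ : ∃ m : ℕ, U ⊓ Module.End.eigenspace F.height (m : ℂ) ≠ ⊥ ∧
      ∀ m' < m, U ⊓ Module.End.eigenspace F.height (m' : ℂ) = ⊥ :=
    ⟨Nat.find hex, Nat.find_spec hex, fun m' hm' => not_not.1 (Nat.find_min hex hm')⟩
  have hmin' : ∀ t : ℕ, 0 < t → ∀ v ∈ U, F.height v = ((m : ℂ) - t) • v → v = 0 := by
    intro t ht v hv hhv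
    by_cases htm : t ≤ m
    · rw [← Nat.cast_sub htm] at hhv
      have : v ∈ U ⊓ Module.End.eigenspace F.height ((m - t : ℕ) : ℂ) :=
        ⟨hv, Module.End.mem_eigenspace_iff.2 hhv⟩
      rwa [hmin (m - t) (by omega)] at this
    · refine height_spectrum hhv (natCast_ne_of_re_neg ?_)
      have : (m : ℝ) < t := by exact_mod_cast not_le.1 htm
      simpa using this
  obtain ⟨u, ⟨huU, hum⟩, hu0, wt, hwt⟩ := exists_common_eigenvector (fun k => F.genE k k)
    F.genE_self_comm (fun k => iSup_eigenspace_of_occ fun o u hu => occ_genE hu k) hm (by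
      rintro k u ⟨hu, hu'⟩
      refine ⟨hE k k u hu, Module.End.mem_eigenspace_iff.2 ?_⟩
      have := (F.height_shifts fun m => F.genE_self_shifts_genE m k k).apply_of_eigen
        (Module.End.mem_eigenspace_iff.1 hu')
      simpa using this)
  replace hum := Module.End.mem_eigenspace_iff.1 hum
  refine ⟨u, huU, hu0, ⟨wt, ?_, ?_, hwt⟩, m, hum, hmin'⟩
  · intro k l
    refine hmin' ((n - k) + (n - l)) (by omega) _ (hX k l u huU) ?_
    rw [(F.height_shifts fun m => F.genE_self_shifts_genX m k l).apply_of_eigen hum]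
    congr 1
    simp only [mul_add, Finset.sum_add_distrib, mul_ite, mul_one, mul_zero, Finset.sum_ite_eq',
      Finset.mem_univ, if_true]
    push_cast [Nat.cast_sub k.2.le, Nat.cast_sub l.2.le]
    ring
  · intro k l hkl
    rw [Fin.lt_def] at hkl
    refine hmin' (l - k) (by omega) _ (hE k l u huU) ?_
    rw [(F.height_shifts fun m => F.genE_self_shifts_genE m k l).apply_of_eigen hum]
    congr 1
    simp only [mul_sub, Finset.sum_sub_distrib, mul_ite, mul_one, mul_zero, Finset.sum_ite_eq',
      Finset.mem_univ, if_true]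
    push_cast [Nat.cast_sub hkl.le]
    ring

end Fock

namespace Fock

variable {n : ℕ} {M : Type*} [AddCommGroup M] [Module ℂ M] (F : Fock n M)

/-! ### The contragredient Fock space -/

/-- The functionals that vanish on high powers of the bosonic creation operators, so that the
transposes of these operators are locally nilpotent. -/
def dualSpace : Submodule ℂ (Module.Dual ℂ M) where
  carrier := {f | ∀ k, ∃ r : ℕ, ∀ u, f ((F.z k ^ r) u) = 0}
  zero_mem' := fun _ => ⟨0, fun _ => rfl⟩
  add_mem' := by
    intro f g hf hg k
    obtain ⟨r, hr⟩ := hf k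
    obtain ⟨t, ht⟩ := hg k
    refine ⟨r + t, fun u => ?_⟩
    rw [LinearMap.add_apply, pow_add, Module.End.mul_apply, hr, zero_add, ← Module.End.mul_apply,
      ← pow_add, add_comm, pow_add, Module.End.mul_apply, ht]
  smul_mem' := by
    intro c f hf k
    obtain ⟨r, hr⟩ := hf k
    exact ⟨r, fun u => by simp [hr]⟩

lemma comp_mem_dualSpace {T : Module.End ℂ M} (hT : ∀ k, F.z k * T = T * F.z k)
    {f : Module.Dual ℂ M} (hf : f ∈ F.dualSpace) : f ∘ₗ T ∈ F.dualSpace := by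
  intro k
  obtain ⟨r, hr⟩ := hf k
  refine ⟨r, fun u => ?_⟩
  have h : Commute (F.z k ^ r) T := Commute.pow_left (hT k) r
  have := LinearMap.congr_fun h.eq u
  simp only [Module.End.mul_apply] at this
  rw [LinearMap.comp_apply, ← this, hr]

lemma comp_d_mem_dualSpace (l : Fin n) {f : Module.Dual ℂ M} (hf : f ∈ F.dualSpace) :
    f ∘ₗ F.d l ∈ F.dualSpace := by
  intro k
  obtain ⟨r, hr⟩ := hf k
  by_cases h : l = k
  · subst h
    refine ⟨r + 1, fun u => ?_⟩
    have h1 : ∀ (m : ℕ) (u : M), F.d l ((F.z l ^ m) u) =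
        (F.z l ^ m) (F.d l u) + (m : ℂ) • (F.z l ^ (m - 1)) u := by
      intro m
      induction m with
      | zero => intro u; simp
      | succ m ih =>
        intro u
        rw [pow_succ', Module.End.mul_apply, dz_apply, ih, map_add, map_smul,
          ← Module.End.mul_apply, ← Module.End.mul_apply, ← pow_succ', ← Module.End.mul_apply]
        rcases m with _ | m
        · simp
        · rw [Nat.add_sub_cancel, Nat.add_sub_cancel, ← pow_succ']
          push_cast
          module
    rw [LinearMap.comp_apply, h1, map_add, map_smul, Nat.add_sub_cancel, hr, pow_succ,
      Module.End.mul_apply, hr]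
    simp
  · refine ⟨r, fun u => ?_⟩
    have h1 : Commute (F.d l) (F.z k) := by
      have := F.dz l k
      rwa [if_neg h, add_zero] at this
    have := LinearMap.congr_fun (h1.pow_right r).eq u
    simp only [Module.End.mul_apply] at this
    rw [LinearMap.comp_apply, this, hr]

/-- The transpose of an operator, as an operator on `dualSpace`. -/
def transpose (T : Module.End ℂ M) (hT : ∀ f ∈ F.dualSpace, f ∘ₗ T ∈ F.dualSpace) :
    Module.End ℂ F.dualSpace where
  toFun f := ⟨f.1 ∘ₗ T, hT f.1 f.2⟩
  map_add' _ _ := rfl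
  map_smul' _ _ := rfl

@[simp] lemma transpose_apply {T : Module.End ℂ M} (hT : ∀ f ∈ F.dualSpace, f ∘ₗ T ∈ F.dualSpace)
    (f : F.dualSpace) (u : M) : (F.transpose T hT f).1 u = f.1 (T u) := rfl

/-- The signs of the transposed fermionic operators; with them, the transpose of `genY` is `genX`
of the contragredient Fock space. -/
def sign : Fin n ⊕ Fin n → ℂ := Sum.elim (fun _ => 1) (fun _ => -1)

lemma sign_mul_self (i : Fin n ⊕ Fin n) : sign i * sign i = 1 := by
  rcases i with i | i <;> simp [sign]

/-- The contragredient Fock space: transposition exchanges creation and annihilation operators. -/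
def dual : Fock n F.dualSpace where
  z k := F.transpose (F.d k) fun _ hf => F.comp_d_mem_dualSpace k hf
  d k := F.transpose (F.z k) fun _ hf => F.comp_mem_dualSpace (fun l => F.zz l k) hf
  c i := sign i • F.transpose (F.a i) fun _ hf => F.comp_mem_dualSpace (fun l => F.za l i) hf
  a i := sign i • F.transpose (F.c i) fun _ hf => F.comp_mem_dualSpace (fun l => F.zc l i) hf
  zz k l := by
    ext f u
    have := congrArg f.1 (LinearMap.congr_fun (F.dd l k) u)
    simpa using this
  dd k l := by
    ext f u
    have := congrArg f.1 (LinearMap.congr_fun (F.zz l k) u)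
    simpa using this
  dz k l := by
    ext f u
    have := congrArg f.1 (LinearMap.congr_fun (F.dz l k) u)
    by_cases h : k = l
    · subst h; simpa using this
    · simpa [h, Ne.symm h] using this
  cc i j := by
    ext f u
    have := congrArg f.1 (LinearMap.congr_fun (F.aa j i) u)
    simp only [Module.End.mul_apply, LinearMap.neg_apply, map_neg] at this
    simp [this, mul_left_comm]
  aa i j := by
    ext f u
    have := congrArg f.1 (LinearMap.congr_fun (F.cc j i) u)
    simp only [Module.End.mul_apply, LinearMap.neg_apply, map_neg] at this
    simp [this, mul_left_comm]
  ac i j := by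
    ext f u
    have := congrArg f.1 (LinearMap.congr_fun (F.ac j i) u)
    by_cases h : i = j
    · subst h
      simp only [Module.End.mul_apply, LinearMap.neg_apply, LinearMap.add_apply, map_add, map_neg,
        if_true, Module.End.one_apply] at this
      simp [this, ← mul_assoc, mul_add, sign_mul_self]
    · simp only [Module.End.mul_apply, LinearMap.neg_apply, map_neg, if_neg (Ne.symm h),
        add_zero] at this
      simp [this, h, mul_left_comm]
  zc k i := by
    ext f u
    have := congrArg f.1 (LinearMap.congr_fun (F.da k i) u)
    simp only [Module.End.mul_apply] at this
    simp [this]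
  za k i := by
    ext f u
    have := congrArg f.1 (LinearMap.congr_fun (F.dc k i) u)
    simp only [Module.End.mul_apply] at this
    simp [this]
  dc k i := by
    ext f u
    have := congrArg f.1 (LinearMap.congr_fun (F.za k i) u)
    simp only [Module.End.mul_apply] at this
    simp [this]
  da k i := by
    ext f u
    have := congrArg f.1 (LinearMap.congr_fun (F.zc k i) u)
    simp only [Module.End.mul_apply] at this
    simp [this]
  nilpotent k f := by
    obtain ⟨r, hr⟩ := f.2 k
    refine ⟨r, ?_⟩
    ext u
    refine Eq.trans ?_ (hr u)
    clear hr
    induction r generalizing u with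
    | zero => rfl
    | succ r ih =>
      rw [pow_succ', Module.End.mul_apply, transpose_apply, ih, pow_succ]
      rfl

section DualApply

variable (f : F.dualSpace) (u : M)

@[simp] lemma dual_z (k) : (F.dual.z k f).1 u = f.1 (F.d k u) := rfl
@[simp] lemma dual_d (k) : (F.dual.d k f).1 u = f.1 (F.z k u) := rfl
@[simp] lemma dual_x (k) : (F.dual.c (Sum.inl k) f).1 u = f.1 (F.a (Sum.inl k) u) :=
  one_mul (f.1 (F.a (Sum.inl k) u))
@[simp] lemma dual_y (k) : (F.dual.c (Sum.inr k) f).1 u = -f.1 (F.a (Sum.inr k) u) :=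
  neg_one_mul (f.1 (F.a (Sum.inr k) u))
@[simp] lemma dual_dx (k) : (F.dual.a (Sum.inl k) f).1 u = f.1 (F.c (Sum.inl k) u) :=
  one_mul (f.1 (F.c (Sum.inl k) u))
@[simp] lemma dual_dy (k) : (F.dual.a (Sum.inr k) f).1 u = -f.1 (F.c (Sum.inr k) u) :=
  neg_one_mul (f.1 (F.c (Sum.inr k) u))

lemma dual_genX (k l) : (F.dual.genX k l f).1 u = f.1 (F.genY k l u) := by
  have h := congrArg f.1 (LinearMap.congr_fun (F.zz l k) u)
  simp only [Module.End.mul_apply] at h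
  simp [genX, genY, h]
  ring

lemma dual_genE (k l) : (F.dual.genE k l f).1 u = f.1 (F.genE l k u) := by
  simp [genE]

lemma dual_zeta : (F.dual.zeta f).1 u = f.1 (F.div u) := by
  have h : ∀ k, F.a (Sum.inl k) (F.d k u) = F.d k (F.a (Sum.inl k) u) := fun k =>
    (LinearMap.congr_fun (F.da k (Sum.inl k)) u).symm
  simp [zeta, div, LinearMap.sum_apply, h]

lemma dual_delT : (F.dual.delT f).1 u = -f.1 (F.del u) := by
  have h : ∀ k, F.a (Sum.inr k) (F.z k u) = F.z k (F.a (Sum.inr k) u) := fun k =>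
    (LinearMap.congr_fun (F.za k (Sum.inr k)) u).symm
  simp [delT, del, LinearMap.sum_apply, h]

lemma dual_Fm : (F.dual.Fm f).1 u = f.1 (F.Fp u) := by
  have h : ∀ k, F.c (Sum.inr k) (F.d k u) = F.d k (F.c (Sum.inr k) u) := fun k =>
    (LinearMap.congr_fun (F.dc k (Sum.inr k)) u).symm
  have h' : ∀ k, F.c (Sum.inl k) (F.z k u) = F.z k (F.c (Sum.inl k) u) := fun k =>
    (LinearMap.congr_fun (F.zc k (Sum.inl k)) u).symm
  simp [Fm, Fp, del, div, zeta, delT, LinearMap.sum_apply, h, h']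
  ring

lemma dual_deg : (F.dual.deg f).1 u = f.1 (F.deg u) := by
  simp [deg, nx, ny, LinearMap.sum_apply]

lemma dual_num (p) : (F.dual.num p f).1 u = f.1 (F.num p u) := by
  rcases p with k | k | k <;> simp [num]

end DualApply

variable {F}

/-- A functional with given occupation numbers does not vanish on a nonzero vector with the same
occupation numbers. -/
lemma IsVacuum.apply_ne_zero {v : M} (hv : F.IsVacuum v) {o : Fin n ⊕ (Fin n ⊕ Fin n) → ℕ}
    {f : F.dualSpace} (hf : f ∈ F.dual.Occ o) (hf0 : f ≠ 0) {u : M} (hu : u ∈ F.Occ o)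
    (hu0 : u ≠ 0) : f.1 u ≠ 0 := by
  intro h
  refine hf0 (Subtype.ext (LinearMap.ker_eq_top.1 (eq_top_iff.2 ?_)))
  rw [← F.iSup_occ]
  refine iSup_le fun o' w hw => ?_
  rw [LinearMap.mem_ker]
  by_cases ho : o' = o
  · subst ho
    obtain ⟨t, rfl⟩ := hv.occ_unique hu hu0 hw
    rw [map_smul, h, smul_zero]
  · obtain ⟨p, hp⟩ := Function.ne_iff.1 ho
    have h1 := F.dual_num f w p
    rw [F.mem_occ.1 hw p, F.dual.mem_occ.1 hf p, map_smul] at h1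
    simp only [SetLike.val_smul, LinearMap.smul_apply, smul_eq_mul] at h1
    exact (mul_eq_mul_right_iff.1 h1).resolve_left fun h2 => hp (by exact_mod_cast h2.symm)

end Fock

/-! ### Eigenspace complements -/

section CoEigenspace

variable {V : Type*} [AddCommGroup V] [Module ℂ V] {T S : Module.End ℂ V} {μ : ℂ}

/-- The sum of the eigenspaces of `T` for the eigenvalues other than `μ`. -/
def coEigenspace (T : Module.End ℂ V) (μ : ℂ) : Submodule ℂ V :=
  ⨆ ν, ⨆ _ : ν ≠ μ, Module.End.eigenspace T ν

lemma mem_coEigenspace {ν : ℂ} (h : ν ≠ μ) {u : V} (hu : T u = ν • u) : u ∈ coEigenspace T μ :=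
  Submodule.mem_iSup_of_mem ν (Submodule.mem_iSup_of_mem h (Module.End.mem_eigenspace_iff.2 hu))

lemma coEigenspace_stable (h : S * T = T * S) {u : V} (hu : u ∈ coEigenspace T μ) :
    S u ∈ coEigenspace T μ := by
  have : coEigenspace T μ ≤ (coEigenspace T μ).comap S := by
    refine iSup₂_le fun ν hν u hu => mem_coEigenspace hν ?_
    have h' := LinearMap.congr_fun h u
    simp only [Module.End.mul_apply] at h'
    rw [← h', Module.End.mem_eigenspace_iff.1 hu, map_smul]
  exact this hu

lemma mem_of_mem_sup_coEigenspace (hT : ⨆ ν, Module.End.eigenspace T ν = ⊤) {p : Submodule ℂ V}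
    (hp : ∀ u ∈ p, T u ∈ p) {x : V} (hx : T x = μ • x) (h : x ∈ p ⊔ coEigenspace T μ) :
    x ∈ p := by
  have hle : p ⊔ coEigenspace T μ ≤ (p ⊓ Module.End.eigenspace T μ) ⊔ coEigenspace T μ := by
    refine sup_le ((le_iSup_inf_eigenspace (e := id) Function.injective_id hT hp).trans
      (iSup_le fun ν => ?_)) le_sup_right
    by_cases hν : ν = μ
    · subst hν; exact le_sup_left
    · exact (inf_le_right.trans fun u hu =>
        mem_coEigenspace hν (Module.End.mem_eigenspace_iff.1 hu)).trans le_sup_right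
  obtain ⟨a, ha, b, hb, hab⟩ := Submodule.mem_sup.1 (hle h)
  have hb' : b ∈ Module.End.eigenspace T μ := by
    rw [← sub_eq_iff_eq_add'.2 hab.symm]
    exact Submodule.sub_mem _ (Module.End.mem_eigenspace_iff.2 hx) ha.2
  have h0 : b = 0 := (Submodule.disjoint_def.1 (Module.End.eigenspaces_iSupIndep T μ)) b hb' hb
  rw [← hab, h0, add_zero]
  exact ha.1

lemma iSup_eigenspace_involution (h : T * T = 1) : ⨆ ν, Module.End.eigenspace T ν = ⊤ := by
  rw [eq_top_iff]
  intro u _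
  have h1 : T (T u) = u := LinearMap.congr_fun h u
  have e : u = (1 / 2 : ℂ) • (u + T u) + (1 / 2 : ℂ) • (u - T u) := by module
  rw [e]
  refine Submodule.add_mem _ (Submodule.mem_iSup_of_mem 1 ?_) (Submodule.mem_iSup_of_mem (-1) ?_)
  · rw [Module.End.mem_eigenspace_iff, map_smul, map_add, h1]; module
  · rw [Module.End.mem_eigenspace_iff, map_smul, map_sub, h1]; module

end CoEigenspace

namespace Fock

variable {n : ℕ} {M : Type*} [AddCommGroup M] [Module ℂ M] (F : Fock n M)

lemma deg_genX (k l) : Shifts F.deg (F.genX k l) 0 :=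
  (((F.nx_d k).mul (F.nx_d l)).add_left ((F.ny_d k).mul (F.ny_d l))).of_eq (by simp) |>.add <|
  ((((F.nx_x k).mul (F.nx_dy l)).add_left ((F.ny_x k).mul (F.ny_dy l))).of_eq (by simp)).add
  ((((F.nx_x l).mul (F.nx_dy k)).add_left ((F.ny_x l).mul (F.ny_dy k))).of_eq (by simp))

lemma deg_genY (k l) : Shifts F.deg (F.genY k l) 0 :=
  (((F.nx_z k).mul (F.nx_z l)).add_left ((F.ny_z k).mul (F.ny_z l))).of_eq (by simp) |>.sub <|
  ((((F.nx_y k).mul (F.nx_dx l)).add_left ((F.ny_y k).mul (F.ny_dx l))).of_eq (by simp)).add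
  ((((F.nx_y l).mul (F.nx_dx k)).add_left ((F.ny_y l).mul (F.ny_dx k))).of_eq (by simp))

lemma deg_genE (k l) : Shifts F.deg (F.genE k l) 0 :=
  ((((F.nx_x k).mul (F.nx_dx l)).add_left ((F.ny_x k).mul (F.ny_dx l))).of_eq (by simp)).sub
  ((((F.nx_y l).mul (F.nx_dy k)).add_left ((F.ny_y l).mul (F.ny_dy k))).of_eq (by simp)) |>.sub <|
  (((F.nx_z l).mul (F.nx_d k)).add_left ((F.ny_z l).mul (F.ny_d k))).of_eq (by simp)

lemma iSup_eigenspace_deg : ⨆ i : ℕ, Module.End.eigenspace F.deg (i : ℂ) = ⊤ := by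
  rw [eq_top_iff, ← F.iSup_occ]
  refine iSup_le fun o => le_iSup_of_le (∑ k, o (Sum.inr (Sum.inl k)) +
    ∑ k, o (Sum.inr (Sum.inr k))) fun u hu => Module.End.mem_eigenspace_iff.2 ?_
  rw [deg, LinearMap.add_apply, occ_nx hu, occ_ny hu]
  push_cast
  rw [add_smul]

lemma iSup_sector : ⨆ i, ⨆ j, F.sector i j = ⊤ := by
  rw [eq_top_iff, ← F.iSup_eigenspace_deg]
  refine iSup_le fun i u hu => Submodule.mem_iSup_of_mem i ?_
  replace hu := Module.End.mem_eigenspace_iff.1 hu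
  rcases le_total i n with h | h
  · exact (iSup₂_le fun j _ => le_iSup (fun j => F.sector i j) j :
      ⨆ j, ⨆ _ : j ≤ i, F.sector i j ≤ _) (F.mem_iSup_sector_of_le h hu)
  · exact (iSup₂_le fun j _ => le_iSup (fun j => F.sector i j) j :
      ⨆ j, ⨆ _ : i + j ≤ 2 * n, F.sector i j ≤ _) (F.mem_iSup_sector_of_ge h hu)

lemma iSup_eigenspace_Fp_Fm : ⨆ μ, Module.End.eigenspace (F.Fp * F.Fm) μ = ⊤ := by
  rw [eq_top_iff, ← F.iSup_sector]
  exact iSup₂_le fun i j => le_iSup_of_le (stringValue n i j) inf_le_right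

/-- The vectors of parity `(-1) ^ s` in `sector i j`; for `(i, j)` in `Ξ` these are the irreducible
summands. -/
noncomputable def part (P : Module.End ℂ M) (i j s : ℕ) : Submodule ℂ M :=
  F.sector i j ⊓ Module.End.eigenspace P ((-1) ^ s)

variable {F} in
lemma mem_part {P : Module.End ℂ M} {i j s : ℕ} {u : M} : u ∈ F.part P i j s ↔
    F.deg u = (i : ℂ) • u ∧ F.Fp (F.Fm u) = stringValue n i j • u ∧ P u = (-1 : ℂ) ^ s • u := by
  rw [part, Submodule.mem_inf, mem_sector, Module.End.mem_eigenspace_iff, and_assoc]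

/-- The highest weight vectors of the primitive part of degree `j`: those with occupation numbers
`topOcc n j e`, except that for `j = n` and odd spinors the space `Occ (topOcc n n 1)` contains no
primitive vectors, and is replaced by the span of a vector built from `Occ (topOcc n (n - 1) 2)`. -/
def IsTop (j e : ℕ) (u : M) : Prop :=
  if j = n ∧ e = 1 then
    ∃ w ∈ F.Occ (topOcc n (n - 1) 2), u = (1 / 2 : ℂ) • F.delT w - (1 / 3 : ℂ) • F.zeta w
  else u ∈ F.Occ (topOcc n j e)

variable {F}

lemma IsSingular.isTop (hn : 0 < n) {wt : Fin n → ℂ} {u : M} (h : F.IsSingular wt u) (hu0 : u ≠ 0)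
    (hF : F.Fm u = 0) {j : ℕ} (hj : j ≤ n) (hdeg : F.deg u = (j : ℂ) • u) :
    ∃ e < 2, F.IsTop j e u := by
  by_cases hdel : F.del u = 0
  · rcases h.mem_occ_of_del_eq_zero hn hu0 hF hdeg hdel with h1 | ⟨hjn, h1⟩
    · exact ⟨0, by norm_num, by rwa [IsTop, if_neg (by simp)]⟩
    · exact ⟨1, by norm_num, by rwa [IsTop, if_neg (by simp [hjn])]⟩
  · obtain ⟨hjn, hw, hu⟩ := h.eq_of_del_ne_zero hn hF hj hdeg hdel
    exact ⟨1, by norm_num, by rw [IsTop, if_pos ⟨hjn, rfl⟩]; exact ⟨_, hw, hu⟩⟩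

section TopVectors

variable {j e : ℕ} {w : M}

lemma d_eq_zero_of_topOcc (hw : w ∈ F.Occ (topOcc n j e)) {k : Fin n} (hk : (k : ℕ) + 1 ≠ n) :
    F.d k w = 0 := Fock.ann_eq_zero hw (q := Sum.inl k) (by simp [topOcc, hk])

lemma dx_eq_zero_of_topOcc (hw : w ∈ F.Occ (topOcc n j e)) {k : Fin n} (hk : ¬(k : ℕ) < j) :
    F.dx k w = 0 := Fock.ann_eq_zero hw (q := Sum.inr (Sum.inl k)) (by simp [topOcc, hk])

lemma dy_eq_zero_of_topOcc (hw : w ∈ F.Occ (topOcc n j e)) (k : Fin n) :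
    F.dy k w = 0 := Fock.ann_eq_zero hw (q := Sum.inr (Sum.inr k)) (by simp [topOcc])

lemma del_eq_zero_of_topOcc (hw : w ∈ F.Occ (topOcc n j e)) : F.del w = 0 := by
  simp [del, LinearMap.sum_apply, dy_eq_zero_of_topOcc hw]

lemma div_eq_zero_of_topOcc (hw : w ∈ F.Occ (topOcc n j e)) (h : e = 0 ∨ j < n) :
    F.div w = 0 := by
  rw [div, LinearMap.sum_apply]
  refine Finset.sum_eq_zero fun k _ => ?_
  by_cases hk : (k : ℕ) + 1 = n
  · rcases h with rfl | h
    · have hd : F.d k w = 0 := Fock.ann_eq_zero hw (q := Sum.inl k) (by simp [topOcc])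
      have := LinearMap.congr_fun (F.da k (Sum.inl k)) w
      rw [this, Module.End.mul_apply, hd, map_zero]
    · rw [Module.End.mul_apply, dx_eq_zero_of_topOcc hw (by omega), map_zero]
  · have := LinearMap.congr_fun (F.da k (Sum.inl k)) w
    rw [this, Module.End.mul_apply, d_eq_zero_of_topOcc hw hk, map_zero]

lemma deg_of_topOcc (hj : j ≤ n) (hw : w ∈ F.Occ (topOcc n j e)) : F.deg w = (j : ℂ) • w := by
  rw [deg, LinearMap.add_apply, occ_nx hw, occ_ny hw]
  have : (∑ k : Fin n, ((topOcc n j e (Sum.inr (Sum.inl k)) : ℕ) : ℂ)) = j := by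
    rw [← Nat.cast_sum]
    congr 1
    simp only [topOcc, Finset.sum_boole, Nat.cast_id]
    rw [Fin.card_filter_val_lt, min_eq_right hj]
  rw [this]
  simp [topOcc]

lemma eul_of_topOcc (hn : 0 < n) (hw : w ∈ F.Occ (topOcc n j e)) : F.eul w = (e : ℂ) • w := by
  obtain ⟨q, hq⟩ : ∃ q : Fin n, (q : ℕ) + 1 = n := ⟨⟨n - 1, by omega⟩, by simp; omega⟩
  have h : ∀ k : Fin n, (k : ℕ) + 1 = n ↔ k = q := fun k => by rw [Fin.ext_iff]; omega
  rw [occ_eul hw]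
  simp [topOcc, h]

lemma ny_of_topOcc (hw : w ∈ F.Occ (topOcc n j e)) : F.ny w = 0 := by
  rw [occ_ny hw]; simp [topOcc]

lemma genE_self_of_topOcc (hw : w ∈ F.Occ (topOcc n j e)) (k : Fin n) : F.genE k k w =
    ((if (k : ℕ) < j then 1 else 0) - if (k : ℕ) + 1 = n then (e : ℂ) else 0) • w := by
  rw [occ_genE hw]; simp [topOcc]

/-- The exceptional highest weight vector. -/
lemma del_div_special (hn : 0 < n) (hw : w ∈ F.Occ (topOcc n (n - 1) 2)) :
    F.del ((1 / 2 : ℂ) • F.delT w - (1 / 3 : ℂ) • F.zeta w) = w ∧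
    F.div ((1 / 2 : ℂ) • F.delT w - (1 / 3 : ℂ) • F.zeta w) = -w := by
  have h1 := del_eq_zero_of_topOcc hw
  have h2 := div_eq_zero_of_topOcc hw (Or.inr (by omega))
  have h3 := ny_of_topOcc hw
  have h4 := eul_of_topOcc hn hw
  have h5 : F.nx w = ((n : ℂ) - 1) • w := by
    have := deg_of_topOcc (by omega) hw
    rw [deg, LinearMap.add_apply, h3, add_zero, Nat.cast_sub hn] at this
    simpa using this
  constructor
  · rw [map_sub, map_smul, map_smul, del_delT_apply, del_zeta_apply, h1, h3, h4]
    simp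
  · rw [map_sub, map_smul, map_smul, div_delT_apply, div_zeta_apply, h2, h4, h5]
    simp only [map_zero]
    push_cast
    module

end TopVectors

namespace IsTop

variable {j e : ℕ} {u : M}

lemma Fm_eq_zero (hn : 0 < n) (hj : j ≤ n) (he : e < 2) (h : F.IsTop j e u) : F.Fm u = 0 := by
  rw [IsTop] at h
  rw [Fm, LinearMap.add_apply]
  split_ifs at h with hc
  · obtain ⟨w, hw, rfl⟩ := h
    rw [(del_div_special hn hw).1, (del_div_special hn hw).2, add_neg_cancel]
  · rw [del_eq_zero_of_topOcc h, div_eq_zero_of_topOcc h (by omega), add_zero]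

lemma deg_apply (hn : 0 < n) (hj : j ≤ n) (h : F.IsTop j e u) : F.deg u = (j : ℂ) • u := by
  rw [IsTop] at h
  split_ifs at h with hc
  · obtain ⟨w, hw, rfl⟩ := h
    have h1 := deg_of_topOcc (by omega) hw
    have h2 := ((F.nx_delT.add_left F.ny_delT).of_eq (zero_add 1)).apply_of_eigen h1
    have h3 := ((F.nx_zeta.add_left F.ny_zeta).of_eq (add_zero 1)).apply_of_eigen h1
    have h4 : ((n - 1 : ℕ) : ℂ) + 1 = n := by exact_mod_cast Nat.sub_add_cancel hn
    rw [h4] at h2 h3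
    change F.deg _ = _ at h2
    change F.deg _ = _ at h3
    rw [map_sub, map_smul, map_smul, h2, h3, hc.1]
    module
  · exact deg_of_topOcc hj h

/-- The weight of a highest weight vector. -/
lemma genE_self (h : F.IsTop j e u) (k : Fin n) : F.genE k k u =
    (if j = n ∧ e = 1 then (if (k : ℕ) + 1 = n then -2 else 1) else
      (if (k : ℕ) < j then 1 else 0) - if (k : ℕ) + 1 = n then (e : ℂ) else 0) • u := by
  rw [IsTop] at h
  split_ifs at h with hc
  · obtain ⟨w, hw, rfl⟩ := h
    have h1 := LinearMap.congr_fun (F.genE_delT k k) w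
    have h2 := LinearMap.congr_fun (F.genE_zeta k k) w
    simp only [Module.End.mul_apply, genE_self_of_topOcc hw, map_smul] at h1 h2
    rw [map_sub, map_smul, map_smul, h1, h2, if_pos hc]
    by_cases hk : (k : ℕ) + 1 = n
    · rw [if_neg (by omega), if_pos hk, if_pos hk]; push_cast; module
    · have := k.2
      rw [if_pos (by omega), if_neg hk, if_neg hk]; module
  · rw [if_neg hc]
    exact genE_self_of_topOcc h k

lemma unique {v : M} (hv : F.IsVacuum v) (h : F.IsTop j e u) (hu0 : u ≠ 0) {u' : M}
    (h' : F.IsTop j e u') : ∃ t : ℂ, u' = t • u := by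
  rw [IsTop] at h h'
  split_ifs at h h' with hc
  · obtain ⟨w, hw, rfl⟩ := h
    obtain ⟨w', hw', rfl⟩ := h'
    obtain ⟨t, rfl⟩ := hv.occ_unique hw (fun h0 => hu0 (by simp [h0])) hw'
    refine ⟨t, ?_⟩
    simp only [map_smul]
    module
  · exact hv.occ_unique h hu0 h'

lemma exists_parity {v : M} (hv : F.IsVacuum v) (hn : 0 < n) {P : Module.End ℂ M}
    (hP : F.IsParity v P) (hj : j ≤ n) (e : ℕ) :
    ∃ u, F.IsTop j e u ∧ u ≠ 0 ∧ P u = (-1 : ℂ) ^ e • u := by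
  by_cases hc : j = n ∧ e = 1
  · obtain ⟨w, hw, hw0, hPw⟩ := exists_mem_topOcc hn hv hP (j := n - 1) (by omega) 2
    refine ⟨(1 / 2 : ℂ) • F.delT w - (1 / 3 : ℂ) • F.zeta w, ?_, fun h0 => hw0 ?_, ?_⟩
    · rw [IsTop, if_pos hc]; exact ⟨w, hw, rfl⟩
    · rw [← (del_div_special hn hw).1, h0, map_zero]
    · have h1 := LinearMap.congr_fun hP.delT w
      have h2 := LinearMap.congr_fun hP.zeta w
      simp only [Module.End.mul_apply, LinearMap.neg_apply, hPw, map_smul] at h1 h2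
      rw [map_sub, map_smul, map_smul, h1, h2, hc.2]
      module
  · obtain ⟨u, hu, hu0, hPu⟩ := exists_mem_topOcc hn hv hP hj e
    exact ⟨u, by rwa [IsTop, if_neg hc], hu0, hPu⟩

lemma parity {v : M} (hv : F.IsVacuum v) (hn : 0 < n) {P : Module.End ℂ M}
    (hP : F.IsParity v P) (hj : j ≤ n) (h : F.IsTop j e u) : P u = (-1 : ℂ) ^ e • u := by
  obtain ⟨u', h', hu0', hPu'⟩ := exists_parity hv hn hP hj e
  obtain ⟨t, rfl⟩ := unique hv h' hu0' h
  rw [map_smul, hPu', smul_comm]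

/-- Corresponding highest weight vectors of a Fock space and of its contragredient are not
orthogonal. -/
lemma apply_ne_zero {v : M} (hv : F.IsVacuum v) (hn : 0 < n) {f : F.dualSpace}
    (hf : F.dual.IsTop j e f) (hf0 : f ≠ 0) (h : F.IsTop j e u) (hu0 : u ≠ 0) : f.1 u ≠ 0 := by
  rw [IsTop] at h hf
  split_ifs at h hf with hc
  · obtain ⟨w, hw, hwu⟩ := h
    obtain ⟨g, hg, rfl⟩ := hf
    have h1 : ((1 / 2 : ℂ) • F.dual.delT g - (1 / 3 : ℂ) • F.dual.zeta g).1 u =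
        -(1 / 6) * g.1 w := by
      have e1 : ((1 / 2 : ℂ) • F.dual.delT g - (1 / 3 : ℂ) • F.dual.zeta g).1 u =
        (1 / 2 : ℂ) * (F.dual.delT g).1 u - (1 / 3 : ℂ) * (F.dual.zeta g).1 u := rfl
      rw [e1, dual_delT, dual_zeta, hwu, (del_div_special hn hw).1, (del_div_special hn hw).2,
        map_neg]
      ring
    rw [h1]
    exact mul_ne_zero (by norm_num) (hv.apply_ne_zero hg (fun h0 => hf0 (by simp [h0])) hw
      fun h0 => hu0 (by simp [hwu, h0]))
  · exact hv.apply_ne_zero hf hf0 h hu0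

end IsTop

end Fock

namespace Fock

variable {n : ℕ} {M : Type*} [AddCommGroup M] [Module ℂ M] {F : Fock n M} {v : M}
  {P : Module.End ℂ M} {i j s : ℕ}

/-! ### Irreducibility -/

/-- A subspace stable under the operators of `𝔰𝔭(2n)`. -/
structure IsStable (F : Fock n M) (N : Submodule ℂ M) : Prop where
  genX : ∀ k l, ∀ u ∈ N, F.genX k l u ∈ N
  genY : ∀ k l, ∀ u ∈ N, F.genY k l u ∈ N
  genE : ∀ k l, ∀ u ∈ N, F.genE k l u ∈ N

lemma part_stable_of_comm {T : Module.End ℂ M} (hp : T * F.Fp = F.Fp * T)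
    (hm : T * F.Fm = F.Fm * T) (hd : Shifts F.deg T 0) (hPT : P * T = T * P) {u : M}
    (hu : u ∈ F.part P i j s) : T u ∈ F.part P i j s := by
  obtain ⟨h1, h2, h3⟩ := mem_part.1 hu
  refine mem_part.2 ⟨?_, ?_, ?_⟩
  · rw [hd.apply_of_eigen h1, add_zero]
  · have e1 := LinearMap.congr_fun hp (F.Fm u)
    have e2 := LinearMap.congr_fun hm u
    simp only [Module.End.mul_apply] at e1 e2
    rw [← e2, ← e1, h2, map_smul]
  · have e := LinearMap.congr_fun hPT u
    simp only [Module.End.mul_apply] at e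
    rw [e, h3, map_smul]

lemma part_stable (hP : F.IsParity v P) (i j s : ℕ) : F.IsStable (F.part P i j s) where
  genX k l _ hu := part_stable_of_comm (F.genX_Fp k l) (F.genX_Fm k l) (F.deg_genX k l)
    (hP.genX k l) hu
  genY k l _ hu := part_stable_of_comm (F.genY_Fp k l) (F.genY_Fm k l) (F.deg_genY k l)
    (hP.genY k l) hu
  genE k l _ hu := part_stable_of_comm (F.genE_Fp k l) (F.genE_Fm k l) (F.deg_genE k l)
    (hP.genE k l) hu

lemma Fm_eq_zero_of_mem_part (hj : j ≤ n) {u : M} (hu : u ∈ F.part P j j s) : F.Fm u = 0 :=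
  F.Fm_eq_zero_of_mem_sector_self hj hu.1

/-- A nonzero stable subspace of a primitive part contains the highest weight vector. -/
lemma exists_isTop_mem (hv : F.IsVacuum v) (hn : 0 < n) (hP : F.IsParity v P) (hj : j ≤ n)
    (hs : s < 2) {N : Submodule ℂ M} (hN : N ≠ ⊥) (hle : N ≤ F.part P j j s)
    (hst : F.IsStable N) : ∃ u ∈ N, u ≠ 0 ∧ F.IsTop j s u ∧ ∃ m : ℂ, F.height u = m • u ∧
      ∀ t : ℕ, 0 < t → ∀ v ∈ N, F.height v = (m - t) • v → v = 0 := by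
  obtain ⟨u, huN, hu0, ⟨wt, hwt⟩, hm⟩ := exists_isSingular hN hst.genX hst.genE
  have hu := hle huN
  obtain ⟨e, he, htop⟩ := hwt.isTop hn hu0 (Fm_eq_zero_of_mem_part hj hu) hj (mem_part.1 hu).1
  have h1 := htop.parity hv hn hP hj
  rw [(mem_part.1 hu).2.2] at h1
  have h2 := smul_left_injective ℂ hu0 h1
  have : s = e := by
    interval_cases s <;> interval_cases e <;> first | rfl | (exfalso; norm_num at h2)
  subst this
  exact ⟨u, huN, hu0, htop, hm⟩

lemma exists_isTop_mem_part (hv : F.IsVacuum v) (hn : 0 < n) (hP : F.IsParity v P) (hj : j ≤ n)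
    (hs : s < 2) : ∃ u ∈ F.part P j j s, u ≠ 0 ∧ F.IsTop j s u := by
  obtain ⟨u, hu, hu0, hPu⟩ := IsTop.exists_parity hv hn hP hj s
  refine ⟨u, mem_part.2 ⟨hu.deg_apply hn hj, ?_, hPu⟩, hu0, hu⟩
  rw [hu.Fm_eq_zero hn hj hs, map_zero, stringValue_self, zero_smul]

/-- The central element `∑ genE k k` of `𝔤𝔩(n)` is diagonal on occupation number states. -/
lemma occ_sum_genE {o : Fin n ⊕ (Fin n ⊕ Fin n) → ℕ} {u : M} (hu : u ∈ F.Occ o) :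
    (∑ k, F.genE k k) u = ((∑ k, (o (Sum.inr (Sum.inl k)) : ℂ)) -
      (∑ k, (o (Sum.inr (Sum.inr k)) : ℂ)) - ∑ k, (o (Sum.inl k) : ℂ)) • u := by
  simp only [LinearMap.sum_apply, occ_genE hu]
  rw [← Finset.sum_smul, Finset.sum_sub_distrib, Finset.sum_sub_distrib]

/-- A functional vanishing on all but one eigenspace of the central element of `𝔤𝔩(n)` belongs to
the contragredient Fock space: powers of the bosonic creation operators shift the eigenvalue. -/
lemma mem_dualSpace_of_coEigenspace {μ : ℂ} {f : Module.Dual ℂ M}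
    (hf : ∀ u ∈ coEigenspace (∑ k, F.genE k k) μ, f u = 0) : f ∈ F.dualSpace := by
  intro k
  obtain ⟨r, hr⟩ := exists_nat_gt ((n : ℝ) - μ.re)
  refine ⟨r, fun u => ?_⟩
  have hz : Shifts (∑ k, F.genE k k) (F.z k ^ r) (-r) := by
    clear hr
    induction r with
    | zero => simp [Shifts]
    | succ r ih =>
      rw [pow_succ]
      refine (ih.mul (Shifts.sum_left fun m _ => F.genE_self_shifts_z m k)).of_eq ?_
      simp
      ring
  have hle : ⨆ o, F.Occ o ≤ LinearMap.ker (f ∘ₗ F.z k ^ r) := by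
    refine iSup_le fun o => ?_
    by_cases ho : F.Occ o = ⊥
    · simp [ho]
    intro w hw
    refine LinearMap.mem_ker.2 (hf _ (mem_coEigenspace ?_ (hz.apply_of_eigen (occ_sum_genE hw))))
    intro h
    have hb : ∑ k, (o (Sum.inr (Sum.inl k)) : ℝ) ≤ n := by
      have : ∑ k : Fin n, o (Sum.inr (Sum.inl k)) ≤ ∑ _k : Fin n, 1 :=
        Finset.sum_le_sum fun k _ => F.occ_fermion_le_one ho _
      simp only [Finset.sum_const, Finset.card_univ, Fintype.card_fin, smul_eq_mul, mul_one] at this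
      exact_mod_cast this
    have h1 : 0 ≤ ∑ k, (o (Sum.inr (Sum.inr k)) : ℝ) := Finset.sum_nonneg fun _ _ => by positivity
    have h2 : 0 ≤ ∑ k, (o (Sum.inl k) : ℝ) := Finset.sum_nonneg fun _ _ => by positivity
    have h3 := congrArg Complex.re h
    simp only [Complex.add_re, Complex.sub_re, Complex.re_sum, Complex.natCast_re,
      Complex.neg_re] at h3
    linarith
  rw [F.iSup_occ] at hle
  exact LinearMap.mem_ker.1 (hle (Submodule.mem_top (x := u)))

/-- The primitive vectors of given degree and parity form an irreducible module. Otherwise the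
functionals on the quotient by a proper stable subspace would give a highest weight vector of the
contragredient Fock space that is orthogonal to all highest weight vectors. -/
theorem part_irreducible_self (hv : F.IsVacuum v) (hn : 0 < n) (hP : F.IsParity v P) (hj : j ≤ n)
    (hs : s < 2) {N : Submodule ℂ M} (hN : N ≠ ⊥) (hle : N ≤ F.part P j j s)
    (hst : F.IsStable N) : N = F.part P j j s := by
  refine le_antisymm hle ?_
  by_contra hcon
  set H : Module.End ℂ M := ∑ k, F.genE k k with hH
  set A : Module.End ℂ M := F.Fp * F.Fm with hA
  have hHstable : ∀ {W : Submodule ℂ M}, F.IsStable W → ∀ u ∈ W, H u ∈ W := by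
    intro W hW u hu
    rw [hH, LinearMap.sum_apply]
    exact W.sum_mem fun k _ => hW.genE k k u hu
  have hHdiag : ⨆ ν, Module.End.eigenspace H ν = ⊤ :=
    iSup_eigenspace_of_occ (fun o u hu => occ_sum_genE hu)
  have hdegdiag : ⨆ ν, Module.End.eigenspace F.deg ν = ⊤ :=
    eq_top_iff.2 (F.iSup_eigenspace_deg ▸ iSup_le fun i : ℕ =>
      le_iSup (fun ν => Module.End.eigenspace F.deg ν) (i : ℂ))
  -- the four operators commute
  have hPA : P * A = A * P := hP.Fp_Fm
  have hdA : F.deg * A = A * F.deg := by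
    have := F.deg_Fp.mul F.deg_Fm
    rwa [add_neg_cancel, Shifts, zero_smul, add_zero] at this
  have hHA : H * A = A * H := by
    rw [hA, hH, Finset.sum_mul, Finset.mul_sum]
    exact Finset.sum_congr rfl fun k _ => by
      rw [← mul_assoc, genE_Fp, mul_assoc, genE_Fm, mul_assoc]
  have hHP : H * P = P * H := by
    rw [hH, Finset.sum_mul, Finset.mul_sum]
    exact Finset.sum_congr rfl fun k _ => (hP.genE k k).symm
  have hHd : H * F.deg = F.deg * H := by
    rw [hH, Finset.sum_mul, Finset.mul_sum]
    refine Finset.sum_congr rfl fun k _ => ?_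
    have := F.deg_genE k k
    rw [Shifts, zero_smul, add_zero] at this
    exact this.symm
  -- an eigenvector of `H` outside `N`
  obtain ⟨μ, x, hx, hxμ, hxN⟩ : ∃ μ, ∃ x ∈ F.part P j j s, H x = μ • x ∧ x ∉ N := by
    by_contra hno
    push Not at hno
    refine hcon ((le_iSup_inf_eigenspace (e := id) Function.injective_id hHdiag
      (hHstable (part_stable hP j j s))).trans (iSup_le fun μ u hu => ?_))
    exact hno μ u hu.1 (Module.End.mem_eigenspace_iff.1 hu.2)
  obtain ⟨hx1, hx2, hx3⟩ := mem_part.1 hx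
  have hAx : A x = (0 : ℂ) • x := by
    rw [← stringValue_self n j]; exact hx2
  set K := ((N ⊔ coEigenspace A 0) ⊔ coEigenspace F.deg j) ⊔ coEigenspace P ((-1) ^ s) with hK
  have hxK : x ∉ K ⊔ coEigenspace H μ := by
    intro h
    refine hxN (mem_of_mem_sup_coEigenspace F.iSup_eigenspace_Fp_Fm ?_ hAx
      (mem_of_mem_sup_coEigenspace hdegdiag ?_ hx1
        (mem_of_mem_sup_coEigenspace (iSup_eigenspace_involution hP.sq) ?_ hx3
          (mem_of_mem_sup_coEigenspace hHdiag ?_ hxμ h))))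
    · intro u hu
      have : F.Fp (F.Fm u) = 0 := by
        rw [Fm_eq_zero_of_mem_part hj (hle hu), map_zero]
      change F.Fp (F.Fm u) ∈ N
      rw [this]; exact N.zero_mem
    · intro u hu
      obtain ⟨a, ha, b, hb, rfl⟩ := Submodule.mem_sup.1 hu
      rw [map_add, (mem_part.1 (hle ha)).1]
      exact Submodule.add_mem_sup (N.smul_mem _ ha) (coEigenspace_stable hdA hb)
    · intro u hu
      obtain ⟨y, hy, c, hc, rfl⟩ := Submodule.mem_sup.1 hu
      obtain ⟨a, ha, b, hb, rfl⟩ := Submodule.mem_sup.1 hy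
      rw [map_add, map_add, (mem_part.1 (hle ha)).2.2]
      exact Submodule.add_mem_sup (Submodule.add_mem_sup (N.smul_mem _ ha)
        (coEigenspace_stable hPA hb)) (coEigenspace_stable hP.deg hc)
    · intro u hu
      obtain ⟨y, hy, c, hc, rfl⟩ := Submodule.mem_sup.1 hu
      obtain ⟨y', hy', b, hb, rfl⟩ := Submodule.mem_sup.1 hy
      obtain ⟨a, ha, d, hd, rfl⟩ := Submodule.mem_sup.1 hy'
      rw [map_add, map_add, map_add]
      exact Submodule.add_mem_sup (Submodule.add_mem_sup (Submodule.add_mem_sup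
        (hHstable hst _ ha) (coEigenspace_stable hHA hd)) (coEigenspace_stable hHd hb))
        (coEigenspace_stable hHP hc)
  -- a functional that vanishes on `N` and on all eigenspaces not containing `x`
  obtain ⟨f, hfx, hfK⟩ := Submodule.exists_le_ker_of_notMem hxK
  have hfN : ∀ u ∈ N, f u = 0 := fun u hu => LinearMap.mem_ker.1 (hfK
    (Submodule.mem_sup_left (Submodule.mem_sup_left (Submodule.mem_sup_left
      (Submodule.mem_sup_left hu)))))
  have hfA : ∀ u ∈ coEigenspace A 0, f u = 0 := fun u hu => LinearMap.mem_ker.1 (hfK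
    (Submodule.mem_sup_left (Submodule.mem_sup_left (Submodule.mem_sup_left
      (Submodule.mem_sup_right hu)))))
  have hfd : ∀ u ∈ coEigenspace F.deg j, f u = 0 := fun u hu => LinearMap.mem_ker.1 (hfK
    (Submodule.mem_sup_left (Submodule.mem_sup_left (Submodule.mem_sup_right hu))))
  have hfP : ∀ u ∈ coEigenspace P ((-1) ^ s), f u = 0 := fun u hu => LinearMap.mem_ker.1 (hfK
    (Submodule.mem_sup_left (Submodule.mem_sup_right hu)))
  have hfD : f ∈ F.dualSpace := mem_dualSpace_of_coEigenspace fun u hu => LinearMap.mem_ker.1 (hfK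
    (Submodule.mem_sup_right hu))
  -- the functionals that factor through the quotient of the primitive part by `N`
  let Q : Submodule ℂ F.dualSpace :=
    { carrier := {g | (∀ u ∈ N, g.1 u = 0) ∧ (∀ u, g.1 (F.Fp u) = 0) ∧
        (∀ u, g.1 (F.deg u) = j * g.1 u) ∧ ∀ u, g.1 (P u) = (-1) ^ s * g.1 u}
      zero_mem' := ⟨fun _ _ => rfl, fun _ => rfl, fun _ => by simp, fun _ => by simp⟩
      add_mem' := by
        rintro g g' ⟨h1, h2, h3, h4⟩ ⟨h1', h2', h3', h4'⟩
        refine ⟨fun u hu => ?_, fun u => ?_, fun u => ?_, fun u => ?_⟩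
        · simp [h1 u hu, h1' u hu]
        · simp [h2 u, h2' u]
        · simp [h3 u, h3' u, mul_add]
        · simp [h4 u, h4' u, mul_add]
      smul_mem' := by
        rintro c g ⟨h1, h2, h3, h4⟩
        refine ⟨fun u hu => ?_, fun u => ?_, fun u => ?_, fun u => ?_⟩
        · simp [h1 u hu]
        · simp [h2 u]
        · simp [h3 u, mul_left_comm]
        · simp [h4 u, mul_left_comm] }
  have eigen_ext : ∀ {T : Module.End ℂ M} {ν : ℂ}, ⨆ ν, Module.End.eigenspace T ν = ⊤ →
      (∀ u ∈ coEigenspace T ν, f u = 0) → ∀ u, f (T u) = ν * f u := by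
    intro T ν hT hf u
    have hle : ⨆ ν, Module.End.eigenspace T ν ≤ LinearMap.ker (f ∘ₗ T - ν • f) := by
      refine iSup_le fun ν' w hw => LinearMap.mem_ker.2 ?_
      replace hw := Module.End.mem_eigenspace_iff.1 hw
      rw [LinearMap.sub_apply, LinearMap.comp_apply, LinearMap.smul_apply, hw, map_smul]
      by_cases hνν : ν' = ν
      · rw [hνν, sub_self]
      · rw [hf w (mem_coEigenspace hνν hw), smul_zero, smul_zero, sub_zero]
    rw [hT] at hle
    have := LinearMap.mem_ker.1 (hle (Submodule.mem_top (x := u)))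
    rwa [LinearMap.sub_apply, sub_eq_zero] at this
  have hfQ : (⟨f, hfD⟩ : F.dualSpace) ∈ Q := by
    refine ⟨hfN, fun u => ?_, eigen_ext hdegdiag hfd,
      eigen_ext (iSup_eigenspace_involution hP.sq) hfP⟩
    have hle : ⨆ i : ℕ, Module.End.eigenspace F.deg (i : ℂ) ≤ LinearMap.ker (f ∘ₗ F.Fp) := by
      refine iSup_le fun i w hw => LinearMap.mem_ker.2 ?_
      replace hw := Module.End.mem_eigenspace_iff.1 hw
      rw [LinearMap.comp_apply]
      by_cases hi : i + 1 = j
      · have hle' : ⨆ j', ⨆ _ : j' ≤ i, F.sector i j' ≤ LinearMap.ker (f ∘ₗ F.Fp) := by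
          refine iSup₂_le fun j' hj' w hw => LinearMap.mem_ker.2 (hfA _ ?_)
          refine mem_coEigenspace ?_ (F.mem_sector.1 (F.Fp_mem_sector hw)).2
          exact stringValue_ne_zero (by omega) (by omega)
        exact LinearMap.mem_ker.1 (hle' (F.mem_iSup_sector_of_le (by omega) hw))
      · refine hfd _ (mem_coEigenspace ?_ (F.deg_Fp.apply_of_eigen hw))
        exact_mod_cast hi
    rw [F.iSup_eigenspace_deg] at hle
    exact LinearMap.mem_ker.1 (hle (Submodule.mem_top (x := u)))
  have hQstable : ∀ {T : Module.End ℂ F.dualSpace} {S : Module.End ℂ M},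
      (∀ g u, (T g).1 u = g.1 (S u)) → (∀ u ∈ N, S u ∈ N) → S * F.Fp = F.Fp * S →
      Shifts F.deg S 0 → P * S = S * P → ∀ g ∈ Q, T g ∈ Q := by
    rintro T S hTS hS hSp hSd hPS g ⟨h1, h2, h3, h4⟩
    rw [Shifts, zero_smul, add_zero] at hSd
    refine ⟨fun u hu => ?_, fun u => ?_, fun u => ?_, fun u => ?_⟩
    · rw [hTS, h1 _ (hS u hu)]
    · have := LinearMap.congr_fun hSp u
      simp only [Module.End.mul_apply] at this
      rw [hTS, this, h2]
    · have := LinearMap.congr_fun hSd u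
      simp only [Module.End.mul_apply] at this
      rw [hTS, hTS, ← this, h3]
    · have := LinearMap.congr_fun hPS u
      simp only [Module.End.mul_apply] at this
      rw [hTS, hTS, ← this, h4]
  have hQ0 : Q ≠ ⊥ := by
    intro h
    rw [h, Submodule.mem_bot] at hfQ
    exact hfx (LinearMap.congr_fun (congrArg Subtype.val hfQ) x)
  obtain ⟨g, ⟨hgN, hgp, hgd, hgP⟩, hg0, ⟨wt, hwt⟩, -⟩ := exists_isSingular (F := F.dual) hQ0
    (fun k l => hQstable (fun g u => F.dual_genX g u k l) (hst.genY k l) (F.genY_Fp k l)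
      (F.deg_genY k l) (hP.genY k l))
    (fun k l => hQstable (fun g u => F.dual_genE g u k l) (hst.genE l k) (F.genE_Fp l k)
      (F.deg_genE l k) (hP.genE l k))
  obtain ⟨e, he, htop⟩ := hwt.isTop hn hg0 (j := j) (by ext u; rw [dual_Fm, hgp]; rfl) hj
    (by ext u; rw [dual_deg, hgd]; rfl)
  by_cases hes : e = s
  -- a singular functional of the parity of `N` would not vanish on the singular vector in `N`
  · subst hes
    obtain ⟨u, huN, hu0, hu, -⟩ := exists_isTop_mem hv hn hP hj hs hN hle hst
    exact htop.apply_ne_zero hv hn hg0 hu hu0 (hgN u huN)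
  -- one of the other parity would not vanish on a vector of the other parity
  · obtain ⟨u, hu, hu0, hPu⟩ := IsTop.exists_parity hv hn hP hj e
    refine htop.apply_ne_zero hv hn hg0 hu hu0 ?_
    have h1 := hgP u
    rw [hPu, map_smul, smul_eq_mul] at h1
    refine (mul_eq_mul_right_iff.1 h1).resolve_left fun h2 => hes ?_
    interval_cases s <;> interval_cases e <;> first | rfl | (exfalso; norm_num at h2)

/-! ### Transport along the raising operator -/

/-- The data of an irreducible highest weight module: `N` is irreducible and contains a highest
weight vector, on which `genE k k` acts by `wt k`. -/
structure IsHighestWeightPart (F : Fock n M) (N : Submodule ℂ M) (wt : Fin n → ℂ) : Prop where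
  irreducible : ∀ N' ≤ N, N' ≠ ⊥ → F.IsStable N' → N' = N
  exists_top : ∃ u ∈ N, u ≠ 0 ∧ (∀ k, F.genE k k u = wt k • u) ∧ ∃ m : ℂ, F.height u = m • u ∧
      ∀ t : ℕ, 0 < t → ∀ v ∈ N, F.height v = (m - t) • v → v = 0

/-- The eigenvalues of `genE k k` on the highest weight vector of the primitive part of degree `j`
and parity `(-1) ^ e`. -/
noncomputable def topWeight (n j e : ℕ) (k : Fin n) : ℂ :=
  if j = n ∧ e = 1 then (if (k : ℕ) + 1 = n then -2 else 1) else
    (if (k : ℕ) < j then 1 else 0) - if (k : ℕ) + 1 = n then (e : ℂ) else 0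

lemma isHighestWeightPart_self (hv : F.IsVacuum v) (hn : 0 < n) (hP : F.IsParity v P) (hj : j ≤ n)
    (hs : s < 2) : F.IsHighestWeightPart (F.part P j j s) (topWeight n j s) := by
  refine ⟨fun N hle hN hst => part_irreducible_self hv hn hP hj hs hN hle hst, ?_⟩
  obtain ⟨u, hu, hu0, -⟩ := exists_isTop_mem_part hv hn hP hj hs
  obtain ⟨u, hu, hu0, htop, hm⟩ := exists_isTop_mem hv hn hP hj hs
    (fun h => hu0 (by rwa [h, Submodule.mem_bot] at hu)) le_rfl (part_stable hP j j s)
  exact ⟨u, hu, hu0, htop.genE_self, hm⟩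

lemma Fp_mem_part (hP : F.IsParity v P) {u : M} (hu : u ∈ F.part P i j s) :
    F.Fp u ∈ F.part P (i + 1) j (s + 1) := by
  refine ⟨F.Fp_mem_sector hu.1, Module.End.mem_eigenspace_iff.2 ?_⟩
  have := LinearMap.congr_fun hP.Fp u
  simp only [Module.End.mul_apply, LinearMap.neg_apply] at this
  rw [this, (mem_part.1 hu).2.2, map_smul, pow_succ]
  module

lemma Fm_mem_part (hP : F.IsParity v P) {u : M} (hu : u ∈ F.part P (i + 1) j (s + 1)) :
    F.Fm u ∈ F.part P i j s := by
  refine ⟨F.Fm_mem_sector hu.1, Module.End.mem_eigenspace_iff.2 ?_⟩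
  have := LinearMap.congr_fun hP.Fm u
  simp only [Module.End.mul_apply, LinearMap.neg_apply] at this
  rw [this, (mem_part.1 hu).2.2, map_smul, pow_succ]
  module

lemma height_comm {T : Module.End ℂ M} (h : ∀ k, F.genE k k * T = T * F.genE k k) (u : M) :
    F.height (T u) = T (F.height u) := by
  have := (F.height_shifts (X := T) (κ := 0) fun m => by rw [Shifts, h]; simp).apply u
  simpa using this

lemma isHighestWeightPart_succ (hP : F.IsParity v P) {wt : Fin n → ℂ} (hj : j ≤ i)
    (hij : i + 1 + j ≤ 2 * n) (h : F.IsHighestWeightPart (F.part P i j s) wt) :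
    F.IsHighestWeightPart (F.part P (i + 1) j (s + 1)) wt := by
  have hc : stringValue n (i + 1) j ≠ 0 := stringValue_ne_zero (by omega) hij
  have hinj : ∀ u ∈ F.part P (i + 1) j (s + 1), F.Fm u = 0 → u = 0 := by
    intro u hu h0
    have h1 := (mem_part.1 hu).2.1
    rw [h0, map_zero] at h1
    exact (smul_eq_zero.1 h1.symm).resolve_left hc
  constructor
  · intro N hle hN hst
    have hmap : N.map F.Fm = F.part P i j s := by
      have hcomm : ∀ {T : Module.End ℂ M}, T * F.Fm = F.Fm * T → (∀ u ∈ N, T u ∈ N) →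
          ∀ u ∈ N.map F.Fm, T u ∈ N.map F.Fm := by
        rintro T hT hTN _ ⟨u, hu, rfl⟩
        exact ⟨T u, hTN u hu, (LinearMap.congr_fun hT u).symm⟩
      refine h.irreducible _ ?_ ?_ ⟨fun k l => hcomm (F.genX_Fm k l) (hst.genX k l),
        fun k l => hcomm (F.genY_Fm k l) (hst.genY k l),
        fun k l => hcomm (F.genE_Fm k l) (hst.genE k l)⟩
      · rintro _ ⟨u, hu, rfl⟩
        exact Fm_mem_part hP (hle hu)
      · intro h0
        obtain ⟨u, hu, hu0⟩ := Submodule.exists_mem_ne_zero_of_ne_bot hN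
        refine hu0 (hinj u (hle hu) ?_)
        have : F.Fm u ∈ N.map F.Fm := ⟨u, hu, rfl⟩
        rwa [h0, Submodule.mem_bot] at this
    refine le_antisymm hle fun u hu => ?_
    obtain ⟨w, hw, hwu⟩ : F.Fm u ∈ N.map F.Fm := hmap ▸ Fm_mem_part hP hu
    have h0 := hinj (w - u) (Submodule.sub_mem _ (hle hw) hu) (by rw [map_sub, hwu, sub_self])
    rwa [← sub_eq_zero.1 h0]
  · obtain ⟨u, hu, hu0, hwt, m, hm, hmin⟩ := h.exists_top
    refine ⟨F.Fp u, Fp_mem_part hP hu, fun h0 => hu0 ?_, fun k => ?_, m, ?_, ?_⟩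
    · have := F.Fm_Fp_of_mem_sector hu.1
      rw [h0, map_zero] at this
      exact (smul_eq_zero.1 this.symm).resolve_left hc
    · have := LinearMap.congr_fun (F.genE_Fp k k) u
      simp only [Module.End.mul_apply] at this
      rw [this, hwt, map_smul]
    · rw [height_comm fun k => F.genE_Fp k k, hm, map_smul]
    · intro t ht w hw hhw
      refine hinj w hw (hmin t ht _ (Fm_mem_part hP hw) ?_)
      rw [height_comm fun k => F.genE_Fm k k, hhw, map_smul]

lemma isHighestWeightPart (hv : F.IsVacuum v) (hn : 0 < n) (hP : F.IsParity v P) {e : ℕ}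
    (he : e < 2) (hj : j ≤ n) {t : ℕ} (ht : j + t + j ≤ 2 * n) :
    F.IsHighestWeightPart (F.part P (j + t) j (e + t)) (topWeight n j e) := by
  induction t with
  | zero => exact isHighestWeightPart_self hv hn hP hj he
  | succ t ih => exact isHighestWeightPart_succ hP (Nat.le_add_right j t) (by omega) (ih (by omega))

end Fock

variable {n : ℕ}

/-! ### The bosonic Fock operators on Schwartz functions -/

/-- The creation operator `2πxₖ - ∂ₖ`. -/
noncomputable def creS (k : Fin n) : Module.End ℂ (Schwartz n) :=
  (2 * Real.pi : ℂ) • mulCoord k - partialDeriv k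

/-- The annihilation operator `(∂ₖ + 2πxₖ) / 4π`. -/
noncomputable def annS (k : Fin n) : Module.End ℂ (Schwartz n) :=
  (1 / (4 * Real.pi) : ℂ) • (partialDeriv k + (2 * Real.pi : ℂ) • mulCoord k)

lemma ofReal_pi_ne_zero : (Real.pi : ℂ) ≠ 0 := by exact_mod_cast Real.pi_ne_zero

lemma creS_comm (k l : Fin n) : creS k * creS l = creS l * creS k := by
  have h1 := partialDeriv_mulCoord k l
  have h2 := partialDeriv_mulCoord l k
  simp only [creS, mul_sub, sub_mul, smul_mul_assoc, mul_smul_comm, h1, h2, mulCoord_comm l k,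
    partialDeriv_comm l k]
  by_cases h : k = l
  · subst h; module
  · rw [if_neg h, if_neg (Ne.symm h)]; module

lemma annS_comm (k l : Fin n) : annS k * annS l = annS l * annS k := by
  have h1 := partialDeriv_mulCoord k l
  have h2 := partialDeriv_mulCoord l k
  simp only [annS, mul_add, add_mul, smul_mul_assoc, mul_smul_comm, h1, h2, mulCoord_comm l k,
    partialDeriv_comm l k]
  by_cases h : k = l
  · subst h; module
  · rw [if_neg h, if_neg (Ne.symm h)]; module

lemma annS_creS (k l : Fin n) : annS k * creS l = creS l * annS k + if k = l then 1 else 0 := by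
  have h1 := partialDeriv_mulCoord k l
  have h2 := partialDeriv_mulCoord l k
  have hpi := ofReal_pi_ne_zero
  simp only [annS, creS, mul_add, add_mul, mul_sub, sub_mul, smul_mul_assoc, mul_smul_comm, h1, h2,
    mulCoord_comm l k, partialDeriv_comm l k]
  by_cases h : k = l
  · subst h
    simp only [if_true]
    match_scalars <;> field_simp <;> ring
  · rw [if_neg h, if_neg (Ne.symm h)]; module

/-! ### A basis of the Lie algebra adapted to the Fock operators -/

lemma fromBlocks_mem_sp {A B C : Matrix (Fin n) (Fin n) ℂ} (hB : Bᵀ = B) (hC : Cᵀ = C) :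
    Matrix.fromBlocks A B C (-Aᵀ) ∈ LieAlgebra.Symplectic.sp (Fin n) ℂ := by
  change _ ∈ skewAdjointMatricesLieSubalgebra (Matrix.J (Fin n) ℂ)
  rw [mem_skewAdjointMatricesLieSubalgebra, mem_skewAdjointMatricesSubmodule,
    Matrix.IsSkewAdjoint, Matrix.IsAdjointPair, Matrix.J, Matrix.fromBlocks_transpose,
    Matrix.fromBlocks_neg, Matrix.fromBlocks_multiply, Matrix.fromBlocks_multiply]
  simp [hB, hC]

/-- The symmetric matrix with entries one at `(k, l)` and `(l, k)`, and two if `k = l`. -/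
def symm (k l : Fin n) : Matrix (Fin n) (Fin n) ℂ := Matrix.single k l 1 + Matrix.single l k 1

lemma symm_transpose (k l : Fin n) : (symm k l)ᵀ = symm k l := by
  simp [symm, add_comm]

/-- The root vector of `εₖ + εₗ` acting on Schwartz functions by `dₖ dₗ`, with `dₖ = annS k`. -/
noncomputable def spX (k l : Fin n) : SpC n :=
  ⟨Matrix.fromBlocks ((-1 / (8 * Real.pi) : ℂ) • symm k l)
    ((Complex.I / (8 * Real.pi) : ℂ) • symm k l) ((Complex.I / (8 * Real.pi) : ℂ) • symm k l)
    (-((-1 / (8 * Real.pi) : ℂ) • symm k l)ᵀ),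
    fromBlocks_mem_sp (by rw [Matrix.transpose_smul, symm_transpose])
      (by rw [Matrix.transpose_smul, symm_transpose])⟩

/-- The root vector of `-εₖ - εₗ` acting on Schwartz functions by `zₖ zₗ`, with `zₖ = creS k`. -/
noncomputable def spY (k l : Fin n) : SpC n :=
  ⟨Matrix.fromBlocks ((2 * Real.pi : ℂ) • symm k l)
    ((2 * Real.pi * Complex.I : ℂ) • symm k l) ((2 * Real.pi * Complex.I : ℂ) • symm k l)
    (-((2 * Real.pi : ℂ) • symm k l)ᵀ),
    fromBlocks_mem_sp (by rw [Matrix.transpose_smul, symm_transpose])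
      (by rw [Matrix.transpose_smul, symm_transpose])⟩

/-- The root vector of `εₖ - εₗ` acting on Schwartz functions by `-zₗ dₖ - δₖₗ / 2`. -/
noncomputable def spE (k l : Fin n) : SpC n :=
  ⟨Matrix.fromBlocks ((1 / 2 : ℂ) • (Matrix.single k l 1 - Matrix.single l k 1))
    ((Complex.I / 2 : ℂ) • symm k l) ((-Complex.I / 2 : ℂ) • symm k l)
    (-((1 / 2 : ℂ) • (Matrix.single k l 1 - Matrix.single l k 1))ᵀ),
    fromBlocks_mem_sp (by rw [Matrix.transpose_smul, symm_transpose])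
      (by rw [Matrix.transpose_smul, symm_transpose])⟩

lemma cartanH_eq (k : Fin n) : cartanH k = spE k k := by
  refine Subtype.ext ?_
  simp only [cartanH, spE, symm, sub_self, smul_zero, Matrix.transpose_zero, neg_zero]
  congr 1 <;> ext i j <;> simp [Matrix.single_apply] <;> split_ifs <;> ring

lemma quad_single {A : Type*} [Ring A] [Algebra ℂ A] (u v : Fin n → A) (k l : Fin n) :
    quad u v (Matrix.single k l 1) = u k * v l := by
  rw [quad, Finset.sum_eq_single k, Finset.sum_eq_single l] <;>
    simp +contextual [Matrix.single_apply, eq_comm]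

lemma weilOp_spX (k l : Fin n) : weilOp (spX k l).1 = annS k * annS l := by
  have h1 := partialDeriv_mulCoord k l
  have h2 := partialDeriv_mulCoord l k
  have hpi := ofReal_pi_ne_zero
  rw [weilOp_eq]
  simp only [spX, Matrix.toBlocks_fromBlocks₁₁, Matrix.toBlocks_fromBlocks₁₂,
    Matrix.toBlocks_fromBlocks₂₁, Matrix.transpose_smul, Matrix.transpose_add,
    Matrix.transpose_single, quad_smul, Matrix.trace_smul, symm, quad_add, quad_single, annS,
    mul_add, add_mul, smul_mul_assoc, mul_smul_comm, h1, mulCoord_comm l k, partialDeriv_comm l k,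
    Matrix.trace_add]
  by_cases h : k = l
  · subst h
    simp only [if_true, Matrix.trace_single_eq_same, smul_eq_mul]
    match_scalars <;> field_simp <;> (try simp) <;> ring
  · simp only [if_neg h, Matrix.trace_single_eq_of_ne _ _ _ h,
      Matrix.trace_single_eq_of_ne _ _ _ (Ne.symm h), smul_eq_mul]
    match_scalars <;> field_simp <;> (try simp) <;> ring

lemma weilOp_spY (k l : Fin n) : weilOp (spY k l).1 = creS k * creS l := by
  have h1 := partialDeriv_mulCoord k l
  have h2 := partialDeriv_mulCoord l k
  have hpi := ofReal_pi_ne_zero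
  rw [weilOp_eq]
  simp only [spY, Matrix.toBlocks_fromBlocks₁₁, Matrix.toBlocks_fromBlocks₁₂,
    Matrix.toBlocks_fromBlocks₂₁, Matrix.transpose_smul, Matrix.transpose_add,
    Matrix.transpose_single, quad_smul, Matrix.trace_smul, symm, quad_add, quad_single, creS,
    mul_sub, sub_mul, smul_mul_assoc, mul_smul_comm, h1, mulCoord_comm l k, partialDeriv_comm l k,
    Matrix.trace_add]
  by_cases h : k = l
  · subst h
    simp only [if_true, Matrix.trace_single_eq_same, smul_eq_mul]
    match_scalars <;> field_simp <;> (try simp) <;> ring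
  · simp only [if_neg h, Matrix.trace_single_eq_of_ne _ _ _ h,
      Matrix.trace_single_eq_of_ne _ _ _ (Ne.symm h), smul_eq_mul]
    match_scalars <;> field_simp <;> (try simp) <;> ring

lemma weilOp_spE (k l : Fin n) : weilOp (spE k l).1 =
    -(creS l * annS k) - if k = l then (1 / 2 : ℂ) • 1 else 0 := by
  have h1 := partialDeriv_mulCoord k l
  have h2 := partialDeriv_mulCoord l k
  have hpi := ofReal_pi_ne_zero
  rw [weilOp_eq]
  simp only [spE, Matrix.toBlocks_fromBlocks₁₁, Matrix.toBlocks_fromBlocks₁₂,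
    Matrix.toBlocks_fromBlocks₂₁, Matrix.transpose_smul, Matrix.transpose_sub,
    Matrix.transpose_single, quad_smul, quad_sub,
    Matrix.trace_smul, Matrix.trace_sub, symm, quad_add, quad_single, creS, annS, mul_sub, sub_mul,
    mul_add, smul_mul_assoc, mul_smul_comm, h2, mulCoord_comm l k, partialDeriv_comm l k]
  by_cases h : k = l
  · subst h
    simp only [if_true, Matrix.trace_single_eq_same, smul_eq_mul]
    match_scalars <;> field_simp <;> (try simp) <;> ring
  · simp only [if_neg h, if_neg (Ne.symm h), Matrix.trace_single_eq_of_ne _ _ _ h,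
      Matrix.trace_single_eq_of_ne _ _ _ (Ne.symm h), smul_eq_mul]
    match_scalars <;> field_simp <;> (try simp) <;> ring

/-! ### The Gaussian -/

lemma pow_mul_gaussian_le (m : ℕ) {r : ℝ} (hr : 0 ≤ r) :
    (1 + r) ^ m * Real.exp (-Real.pi * r ^ 2) ≤ m.factorial * Real.exp 2 := by
  have h1 : 1 + r ≤ 2 + Real.pi * r ^ 2 := by
    nlinarith [Real.pi_gt_three, sq_nonneg r, sq_nonneg (r - 1)]
  have h2 : (2 + Real.pi * r ^ 2) ^ m ≤ m.factorial * Real.exp (2 + Real.pi * r ^ 2) := by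
    have := Real.pow_div_factorial_le_exp (2 + Real.pi * r ^ 2) (by positivity) m
    rwa [div_le_iff₀' (by positivity)] at this
  have h3 : (1 + r) ^ m ≤ (2 + Real.pi * r ^ 2) ^ m := pow_le_pow_left₀ (by positivity) h1 m
  calc (1 + r) ^ m * Real.exp (-Real.pi * r ^ 2)
      ≤ (m.factorial * Real.exp (2 + Real.pi * r ^ 2)) * Real.exp (-Real.pi * r ^ 2) :=
        mul_le_mul_of_nonneg_right (h3.trans h2) (Real.exp_pos _).le
    _ = m.factorial * Real.exp 2 := by
        rw [mul_assoc, ← Real.exp_add]; congr 2; ring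

/-- The Gaussian `x ↦ exp (-π |x|²)`. -/
noncomputable def gaussian (n : ℕ) : Schwartz n where
  toFun x := ((Real.exp (-Real.pi * ‖x‖ ^ 2) : ℝ) : ℂ)
  smooth' := Complex.ofRealCLM.contDiff.comp
    (Real.contDiff_exp.comp (contDiff_const.mul (contDiff_norm_sq ℝ)))
  decay' k m := by
    obtain ⟨l, C, hC, hgrowth⟩ := (Function.hasTemperateGrowth_norm_sq
      (H := EuclideanSpace ℝ (Fin n))).norm_iteratedFDeriv_le_uniform m
    refine ⟨m.factorial * Real.pi ^ m * (1 + C) ^ m *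
      ((k + l * m).factorial * Real.exp 2), fun x => ?_⟩
    have hcomp := Complex.ofRealLI.norm_iteratedFDeriv_comp_left (n := ⊤)
      (f := fun x : EuclideanSpace ℝ (Fin n) => Real.exp (-Real.pi * ‖x‖ ^ 2)) (x := x)
      (Real.contDiff_exp.comp (contDiff_const.mul (contDiff_norm_sq ℝ))).contDiffAt
      (i := m) (by exact_mod_cast le_top)
    have hr : 0 ≤ ‖x‖ := norm_nonneg x
    have hbound := norm_iteratedFDeriv_comp_le (𝕜 := ℝ) (n := m) (N := ⊤)
      (g := fun t : ℝ => Real.exp (-Real.pi * t))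
      (f := fun x : EuclideanSpace ℝ (Fin n) => ‖x‖ ^ 2)
      (Real.contDiff_exp.comp (contDiff_const.mul contDiff_id)) (contDiff_norm_sq ℝ)
      (by exact_mod_cast le_top) x
      (C := Real.pi ^ m * Real.exp (-Real.pi * ‖x‖ ^ 2)) (D := (1 + C) * (1 + ‖x‖) ^ l)
      (fun i hi => by
        rw [norm_iteratedFDeriv_eq_norm_iteratedDeriv, iteratedDeriv_exp_const_mul, norm_mul,
          norm_pow, Real.norm_of_nonneg (Real.exp_pos _).le, norm_neg,
          Real.norm_of_nonneg Real.pi_pos.le]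
        gcongr
        linarith [Real.pi_gt_three])
      (fun i hi hi' => by
        refine (hgrowth i hi' x).trans ?_
        have h1 : C * (1 + ‖x‖) ^ l ≤ (1 + C) * (1 + ‖x‖) ^ l := by gcongr; linarith
        refine h1.trans (le_self_pow₀ ?_ (by omega))
        exact one_le_mul_of_one_le_of_one_le (by linarith) (one_le_pow₀ (by linarith)))
    have hnorm : ‖iteratedFDeriv ℝ m (fun x : EuclideanSpace ℝ (Fin n) =>
        ((Real.exp (-Real.pi * ‖x‖ ^ 2) : ℝ) : ℂ)) x‖ ≤ m.factorial *
        (Real.pi ^ m * Real.exp (-Real.pi * ‖x‖ ^ 2)) * ((1 + C) * (1 + ‖x‖) ^ l) ^ m :=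
      hcomp.trans_le hbound
    calc ‖x‖ ^ k * _ ≤ (1 + ‖x‖) ^ k * (m.factorial *
        (Real.pi ^ m * Real.exp (-Real.pi * ‖x‖ ^ 2)) * ((1 + C) * (1 + ‖x‖) ^ l) ^ m) := by
          gcongr
          linarith
      _ = m.factorial * Real.pi ^ m * (1 + C) ^ m *
          ((1 + ‖x‖) ^ (k + l * m) * Real.exp (-Real.pi * ‖x‖ ^ 2)) := by
          rw [mul_pow, pow_add, pow_mul]; ring
      _ ≤ _ := by
          exact mul_le_mul_of_nonneg_left (pow_mul_gaussian_le _ hr) (by positivity)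

lemma gaussian_apply (x : EuclideanSpace ℝ (Fin n)) :
    gaussian n x = ((Real.exp (-Real.pi * ‖x‖ ^ 2) : ℝ) : ℂ) := rfl

lemma gaussian_ne_zero : gaussian n ≠ 0 := by
  intro h
  have := DFunLike.congr_fun h 0
  simp [gaussian_apply] at this

lemma hasFDerivAt_exp_norm_sq (c : ℝ) (x : EuclideanSpace ℝ (Fin n)) :
    HasFDerivAt (fun x : EuclideanSpace ℝ (Fin n) => ((Real.exp (c * ‖x‖ ^ 2) : ℝ) : ℂ))
      (Complex.ofRealCLM ∘L (Real.exp (c * ‖x‖ ^ 2) • (c • (2 • innerSL ℝ x)))) x :=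
  Complex.ofRealCLM.hasFDerivAt.comp x
    (((hasStrictFDerivAt_norm_sq x).hasFDerivAt.const_mul c).exp)

lemma annS_gaussian (k : Fin n) : annS k (gaussian n) = 0 := by
  ext x
  have h : partialDeriv k (gaussian n) x = -(2 * Real.pi) * ((x k : ℂ) * gaussian n x) := by
    rw [partialDeriv_apply]
    change fderiv ℝ (fun x : EuclideanSpace ℝ (Fin n) =>
      ((Real.exp (-Real.pi * ‖x‖ ^ 2) : ℝ) : ℂ)) x _ = _
    rw [(hasFDerivAt_exp_norm_sq (-Real.pi) x).fderiv, gaussian_apply]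
    simp [EuclideanSpace.inner_single_right]
    ring
  simp only [annS, LinearMap.smul_apply, LinearMap.add_apply, _root_.smul_apply,
    _root_.add_apply, mulCoord_apply, h, smul_eq_mul, _root_.zero_apply]
  ring

/-- The product of `f` with `exp (π |x|²)` is constant. -/
lemma eq_smul_gaussian {f : Schwartz n} (hf : ∀ k, annS k f = 0) : f = f 0 • gaussian n := by
  have hpd : ∀ k x, fderiv ℝ f x (EuclideanSpace.single k 1) = -(2 * Real.pi) * (x k * f x) := by
    intro k x
    have h := DFunLike.congr_fun (hf k) x
    simp only [annS, LinearMap.smul_apply, LinearMap.add_apply, _root_.smul_apply,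
      _root_.add_apply, mulCoord_apply, partialDeriv_apply, smul_eq_mul,
      _root_.zero_apply] at h
    have h1 : (1 / (4 * Real.pi) : ℂ) ≠ 0 := one_div_ne_zero
      (mul_ne_zero (by norm_num) ofReal_pi_ne_zero)
    linear_combination (mul_eq_zero.1 h).resolve_left h1
  have hder : ∀ x : EuclideanSpace ℝ (Fin n), HasFDerivAt (fun x : EuclideanSpace ℝ (Fin n) =>
      ((Real.exp (Real.pi * ‖x‖ ^ 2) : ℝ) : ℂ) * f x)
      (0 : EuclideanSpace ℝ (Fin n) →L[ℝ] ℂ) x := by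
    intro x
    refine ((hasFDerivAt_exp_norm_sq Real.pi x).mul (f.hasFDerivAt (x := x))).congr_fderiv ?_
    refine ContinuousLinearMap.coe_injective ((EuclideanSpace.basisFun (Fin n) ℝ).toBasis.ext
      fun k => ?_)
    simp [hpd, EuclideanSpace.inner_single_right]
    ring
  have hconst := fun x => is_const_of_fderiv_eq_zero (𝕜 := ℝ)
    (fun x => (hder x).differentiableAt) (fun x => (hder x).fderiv) x 0
  ext x
  have h := hconst x
  simp only [norm_zero, ne_eq, OfNat.ofNat_ne_zero, not_false_eq_true, zero_pow, mul_zero,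
    Real.exp_zero, Complex.ofReal_one, one_mul] at h
  rw [_root_.smul_apply, gaussian_apply, ← h, smul_eq_mul, mul_right_comm,
    ← Complex.ofReal_mul, ← Real.exp_add]
  simp

/-! ### Injectivity of `zₖ dₖ + c` -/

/-- The pairing `(a, b) ↦ conj a * b`. -/
noncomputable def conjMul : ℂ →L[ℝ] ℂ →L[ℝ] ℂ :=
  (ContinuousLinearMap.mul ℝ ℂ).comp (Complex.conjCLE : ℂ →L[ℝ] ℂ)

lemma conjMul_apply (a b : ℂ) : conjMul a b = starRingEnd ℂ a * b := rfl

lemma integrable_conjMul (f g : Schwartz n) : MeasureTheory.Integrable fun x =>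
    conjMul (f x) (g x) :=
  (SchwartzMap.pairing conjMul f g).integrable

/-- The operator `creS k` is a multiple of the adjoint of `annS k`. -/
lemma integral_creS (k : Fin n) (f g : Schwartz n) : ∫ x, conjMul (f x) (creS k g x) =
    4 * Real.pi * ∫ x, conjMul (annS k f x) (g x) := by
  have hpi := ofReal_pi_ne_zero
  have h1 : ∫ x, conjMul (f x) (partialDeriv k g x) = -∫ x, conjMul (partialDeriv k f x) (g x) :=
    SchwartzMap.integral_bilinear_lineDerivOp_right_eq_neg_left f g conjMul _
  have h2 : ∀ x, conjMul (f x) (creS k g x) =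
      2 * Real.pi * conjMul (f x) (mulCoord k g x) - conjMul (f x) (partialDeriv k g x) := by
    intro x
    simp only [creS, LinearMap.sub_apply, LinearMap.smul_apply, _root_.sub_apply,
      _root_.smul_apply, conjMul_apply, smul_eq_mul]
    ring
  have h3 : ∀ x, 4 * Real.pi * conjMul (annS k f x) (g x) =
      conjMul (partialDeriv k f x) (g x) + 2 * Real.pi * conjMul (f x) (mulCoord k g x) := by
    intro x
    simp only [annS, LinearMap.add_apply, LinearMap.smul_apply, _root_.add_apply,
      _root_.smul_apply, conjMul_apply, smul_eq_mul, map_mul, map_add, map_div₀, map_one,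
      Complex.conj_ofReal, mulCoord_apply, map_ofNat]
    field_simp
  rw [← MeasureTheory.integral_const_mul]
  simp only [h2, h3]
  rw [MeasureTheory.integral_sub ((integrable_conjMul _ _).const_mul _) (integrable_conjMul _ _),
    MeasureTheory.integral_add (integrable_conjMul _ _) ((integrable_conjMul _ _).const_mul _), h1]
  ring

lemma integral_conjMul_self (f : Schwartz n) :
    ∫ x, conjMul (f x) (f x) = ((∫ x, ‖f x‖ ^ 2 : ℝ) : ℂ) := by
  rw [← integral_complex_ofReal]
  congr 1
  ext x
  rw [conjMul_apply, mul_comm, Complex.mul_conj, Complex.normSq_eq_norm_sq]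

/-- The operator `creS k * annS k` is nonnegative for the `L²` inner product. -/
lemma eq_zero_of_creS_annS {c : ℂ} (hc : 0 < c.re) {k : Fin n} {g : Schwartz n}
    (h : creS k (annS k g) + c • g = 0) : g = 0 := by
  have h1 : ∫ x, conjMul (g x) (creS k (annS k g) x) = -(c * ∫ x, conjMul (g x) (g x)) := by
    rw [← MeasureTheory.integral_const_mul, ← MeasureTheory.integral_neg]
    congr 1
    ext x
    have := DFunLike.congr_fun h x
    simp only [_root_.add_apply, _root_.smul_apply, _root_.zero_apply,
      smul_eq_mul] at this
    rw [eq_neg_of_add_eq_zero_left this, conjMul_apply, conjMul_apply]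
    ring
  rw [integral_creS, integral_conjMul_self, integral_conjMul_self] at h1
  have h2 := congrArg Complex.re h1
  simp only [Complex.neg_re, Complex.re_mul_ofReal] at h2
  have h3 : (4 : ℂ).re = 4 := rfl
  rw [h3] at h2
  have h4 : 0 ≤ ∫ x, ‖annS k g x‖ ^ 2 := MeasureTheory.integral_nonneg fun x => by positivity
  have h5 : 0 ≤ ∫ x, ‖g x‖ ^ 2 := MeasureTheory.integral_nonneg fun x => by positivity
  have h6 : ∫ x, ‖g x‖ ^ 2 = 0 := by
    have h7 : 0 ≤ 4 * Real.pi * ∫ x, ‖annS k g x‖ ^ 2 := by positivity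
    have h8 : 0 ≤ c.re * ∫ x, ‖g x‖ ^ 2 := by positivity
    exact (mul_eq_zero.1 (le_antisymm (by linarith) h8)).resolve_left hc.ne'
  have hint : MeasureTheory.Integrable fun x => ‖g x‖ ^ 2 := by
    have := (integrable_conjMul g g).norm
    refine this.congr (Filter.Eventually.of_forall fun x => ?_)
    simp [conjMul_apply, sq]
  rw [MeasureTheory.integral_eq_zero_iff_of_nonneg (fun x => by positivity) hint] at h6
  have h7 := (Continuous.ae_eq_iff_eq MeasureTheory.volume (by fun_prop) continuous_zero).1 h6
  ext x
  have := congrFun h7 x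
  simpa using this

/-! ### The Lie algebra is spanned by the Fock bilinears -/

lemma sum_smul_single_apply (m : Fin n → Fin n → ℂ) (i j : Fin n) :
    ∑ k, ∑ l, m k l * Matrix.single k l (1 : ℂ) i j = m i j := by
  rw [Finset.sum_eq_single i, Finset.sum_eq_single j] <;>
    simp +contextual [Matrix.single_apply]

lemma sum_smul_single_apply' (m : Fin n → Fin n → ℂ) (i j : Fin n) :
    ∑ k, ∑ l, m k l * Matrix.single l k (1 : ℂ) i j = m j i := by
  rw [Finset.sum_eq_single j, Finset.sum_eq_single i] <;>
    simp +contextual [Matrix.single_apply]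

/-- The elements `spE`, `spX`, `spY` span the Lie algebra, and `spE` spans the compact elements. -/
lemma exists_eq_sum (X : SpC n) : ∃ a b c : Fin n → Fin n → ℂ,
    X = ∑ k, ∑ l, (a k l • spE k l + b k l • spX k l + c k l • spY k l) ∧
      (IsCompactElement X → b = 0 ∧ c = 0) := by
  have hpi := ofReal_pi_ne_zero
  obtain ⟨h22, hB, hC⟩ := blocks X
  have hX : X.1 = Matrix.fromBlocks X.1.toBlocks₁₁ X.1.toBlocks₁₂ X.1.toBlocks₂₁
      (-X.1.toBlocks₁₁ᵀ) := by
    rw [← h22]; exact (Matrix.fromBlocks_toBlocks X.1).symm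
  generalize X.1.toBlocks₁₁ = A at *
  generalize X.1.toBlocks₁₂ = B at *
  generalize X.1.toBlocks₂₁ = C at *
  have hB' : ∀ i j, B j i = B i j := fun i j => congrFun (congrFun hB i) j
  have hC' : ∀ i j, C j i = C i j := fun i j => congrFun (congrFun hC i) j
  refine ⟨fun k l => (A k l - A l k) / 2 - Complex.I / 2 * (B k l - C k l),
    fun k l => 2 * Real.pi * (-(Complex.I / 2) * (B k l + C k l) - (A k l + A l k) / 2),
    fun k l => ((A k l + A l k) / 2 - Complex.I / 2 * (B k l + C k l)) / (8 * Real.pi), ?_, ?_⟩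
  · have hI := Complex.I_mul_I
    refine Subtype.ext ?_
    have hcoe : ∀ (a b c : ℂ) (k l : Fin n), (a • spE k l + b • spX k l + c • spY k l : SpC n).1 =
      a • (spE k l).1 + b • (spX k l).1 + c • (spY k l).1 := fun _ _ _ _ _ => rfl
    simp only [AddSubmonoidClass.coe_finsetSum, hcoe]
    rw [hX]
    ext (i | i) (j | j) <;>
      simp only [Matrix.sum_apply, Matrix.add_apply, Matrix.smul_apply, spE, spX, spY,
        Matrix.fromBlocks_apply₁₁, Matrix.fromBlocks_apply₁₂, Matrix.fromBlocks_apply₂₁,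
        Matrix.fromBlocks_apply₂₂, Matrix.neg_apply, Matrix.transpose_apply, symm,
        Matrix.sub_apply, smul_eq_mul, mul_add, mul_sub, mul_neg, neg_add, neg_sub, ← mul_assoc,
        Finset.sum_add_distrib, Finset.sum_sub_distrib, Finset.sum_neg_distrib,
        sum_smul_single_apply, sum_smul_single_apply'] <;>
      (try rw [hB' i j]) <;> (try rw [hC' i j]) <;> field_simp <;> ring_nf <;>
      simp only [Complex.I_sq] <;> ring
  · intro hcomp
    have hcomm : X.1 * Matrix.J (Fin n) ℂ = Matrix.J (Fin n) ℂ * X.1 := hcomp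
    rw [hX, Matrix.J, Matrix.fromBlocks_multiply, Matrix.fromBlocks_multiply,
      Matrix.fromBlocks_inj] at hcomm
    simp only [Matrix.mul_zero, Matrix.mul_one, Matrix.zero_mul, Matrix.one_mul, Matrix.mul_neg,
      Matrix.neg_mul, zero_add, add_zero, neg_neg] at hcomm
    obtain ⟨h1, h2, -, -⟩ := hcomm
    have hBC : ∀ i j, B i j = -C i j := fun i j => by simpa using congrFun (congrFun h1 i) j
    have hAA : ∀ i j, A i j = -A j i := fun i j => by
      have := congrFun (congrFun h2 i) j
      simp only [Matrix.neg_apply, Matrix.transpose_apply] at this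
      linear_combination -this
    constructor <;> funext k l <;> simp [hBC k l, hAA k l]

lemma isCompactElement_spE (k l : Fin n) : IsCompactElement (spE k l) := by
  change _ * _ = _ * _
  rw [spE, Matrix.J, Matrix.fromBlocks_multiply, Matrix.fromBlocks_multiply]
  simp only [Matrix.mul_zero, Matrix.mul_one, Matrix.zero_mul, Matrix.one_mul, Matrix.mul_neg,
      Matrix.neg_mul, zero_add, add_zero, neg_neg]
  congr 1 <;> ext i j <;>
    simp only [symm, Matrix.neg_apply, Matrix.add_apply, Matrix.sub_apply, Matrix.smul_apply,
      smul_eq_mul, Matrix.transpose_apply, Matrix.single_apply] <;>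
    simp only [and_comm] <;> (try rw [Matrix.zero_apply]) <;> ring

/-! ### `K`-finite Schwartz functions -/

lemma lie_schwartz (X : SpC n) (f : Schwartz n) : ⁅X, f⁆ = weilOp X.1 f := rfl

lemma lie_spX (k l : Fin n) (f : Schwartz n) : ⁅spX k l, f⁆ = annS k (annS l f) := by
  rw [lie_schwartz, weilOp_spX, Module.End.mul_apply]

lemma lie_spY (k l : Fin n) (f : Schwartz n) : ⁅spY k l, f⁆ = creS k (creS l f) := by
  rw [lie_schwartz, weilOp_spY, Module.End.mul_apply]

lemma lie_spE (k l : Fin n) (f : Schwartz n) : ⁅spE k l, f⁆ =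
    -creS l (annS k f) - (if k = l then (1 / 2 : ℂ) else 0) • f := by
  rw [lie_schwartz, weilOp_spE]
  split_ifs <;> simp

lemma lie_mem_of_spE {F : Submodule ℂ (Schwartz n)} (hF : ∀ k l : Fin n, ∀ f ∈ F, ⁅spE k l, f⁆ ∈ F)
    {X : SpC n} (hX : IsCompactElement X) {f : Schwartz n} (hf : f ∈ F) : ⁅X, f⁆ ∈ F := by
  obtain ⟨a, b, c, h, hbc⟩ := exists_eq_sum X
  obtain ⟨rfl, rfl⟩ := hbc hX
  rw [h]
  simp only [Pi.zero_apply, zero_smul, add_zero, sum_lie, smul_lie]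
  exact F.sum_mem fun k _ => F.sum_mem fun l _ => F.smul_mem _ (hF k l f hf)

/-- The span of the Fock operators. -/
noncomputable def fockSpan (n : ℕ) : Submodule ℂ (Module.End ℂ (Schwartz n)) :=
  Submodule.span ℂ (Set.range creS ∪ Set.range annS)

lemma creS_mem (k : Fin n) : creS k ∈ fockSpan n := Submodule.subset_span (Or.inl ⟨k, rfl⟩)

lemma annS_mem (k : Fin n) : annS k ∈ fockSpan n := Submodule.subset_span (Or.inr ⟨k, rfl⟩)

lemma spE_commutator (k l : Fin n) {w : Module.End ℂ (Schwartz n)} (hw : w ∈ fockSpan n) :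
    weilOp (spE k l).1 * w - w * weilOp (spE k l).1 ∈ fockSpan n := by
  have hle : fockSpan n ≤ (fockSpan n).comap
      (LinearMap.mulLeft ℂ (weilOp (spE k l).1) - LinearMap.mulRight ℂ (weilOp (spE k l).1)) := by
    rw [fockSpan, Submodule.span_le]
    rintro _ (⟨m, rfl⟩ | ⟨m, rfl⟩)
    · have h : weilOp (spE k l).1 * creS m - creS m * weilOp (spE k l).1 =
          -(if k = m then creS l else 0) := by
        rw [weilOp_spE, sub_mul, mul_sub, neg_mul, mul_neg, mul_assoc, annS_creS, mul_add,
          ← mul_assoc, creS_comm l m]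
        split_ifs <;> simp <;> noncomm_ring
      change _ - _ ∈ fockSpan n
      rw [LinearMap.mulLeft_apply, LinearMap.mulRight_apply, h]
      split_ifs
      · exact Submodule.neg_mem _ (creS_mem l)
      · simp
    · have h : weilOp (spE k l).1 * annS m - annS m * weilOp (spE k l).1 =
          if m = l then annS k else 0 := by
        rw [weilOp_spE, sub_mul, mul_sub, neg_mul, mul_neg, ← mul_assoc (annS m), annS_creS,
          add_mul, mul_assoc, annS_comm k m]
        split_ifs <;> simp <;> noncomm_ring
      change _ - _ ∈ fockSpan n
      rw [LinearMap.mulLeft_apply, LinearMap.mulRight_apply, h]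
      split_ifs
      · exact annS_mem k
      · simp
  exact hle hw

/-- The Fock operators preserve `K`-finiteness, because their span is stable under commutators with
the compact elements. -/
lemma IsKFinite.fock {f : Schwartz n} (hf : IsKFinite f) {w : Module.End ℂ (Schwartz n)}
    (hw : w ∈ fockSpan n) : IsKFinite (w f) := by
  obtain ⟨F, hF, hfF, hst⟩ := hf
  have hfin : (fockSpan n).FG := Submodule.fg_span ((Set.finite_range _).union (Set.finite_range _))
  refine ⟨Submodule.map₂ LinearMap.id (fockSpan n) F, hfin.map₂ _ hF,
    Submodule.apply_mem_map₂ LinearMap.id hw hfF, fun X hX g hg => lie_mem_of_spE ?_ hX hg⟩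
  intro k l g hg
  have hle : Submodule.map₂ LinearMap.id (fockSpan n) F ≤
      (Submodule.map₂ LinearMap.id (fockSpan n) F).comap (weilOp (spE k l).1) := by
    rw [Submodule.map₂_le]
    intro v hv h hh
    have e : weilOp (spE k l).1 (v h) =
        (weilOp (spE k l).1 * v - v * weilOp (spE k l).1) h + v ⁅spE k l, h⁆ := by
      rw [lie_schwartz]; simp
    change weilOp (spE k l).1 (v h) ∈ Submodule.map₂ LinearMap.id (fockSpan n) F
    rw [e]
    exact Submodule.add_mem _
      (Submodule.apply_mem_map₂ LinearMap.id (spE_commutator k l hv) hh)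
      (Submodule.apply_mem_map₂ LinearMap.id hv (hst _ (isCompactElement_spE k l) h hh))
  exact hle hg

lemma isKFinite_gaussian : IsKFinite (gaussian n) := by
  have h : ∀ k l : Fin n, ∀ g ∈ Submodule.span ℂ {gaussian n},
      ⁅spE k l, g⁆ ∈ Submodule.span ℂ {gaussian n} := by
    intro k l g hg
    obtain ⟨t, rfl⟩ := Submodule.mem_span_singleton.1 hg
    rw [lie_spE, map_smul, annS_gaussian, smul_zero, map_zero, neg_zero, zero_sub]
    exact Submodule.neg_mem _ (Submodule.smul_mem _ _ hg)
  exact ⟨_, Submodule.fg_span_singleton _, Submodule.mem_span_singleton_self _,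
    fun X hX g hg => lie_mem_of_spE h hX hg⟩

lemma pow_mul_number_sub {A : Type*} [Ring A] [Algebra ℂ A] {d z : A} (h : d * z = z * d + 1)
    (r : ℕ) (ν : ℂ) : d ^ r * (z * d - ν • 1) = (z * d + ((r : ℂ) - ν) • 1) * d ^ r := by
  induction r with
  | zero => simp [sub_eq_add_neg]
  | succ r ih =>
    have h1 : d * (z * d) = (z * d + 1) * d := by rw [← mul_assoc, h]
    rw [pow_succ', mul_assoc, ih, ← mul_assoc, mul_add, h1, mul_smul_comm, mul_one, ← mul_assoc]
    congr 1
    push_cast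
    simp only [add_mul, sub_mul, smul_mul_assoc, one_mul, sub_smul, add_smul, one_smul]
    abel

/-- On `K`-finite functions the annihilation operators are locally nilpotent: otherwise `zₖ dₖ`
would have eigenvalues with negative real part. -/
lemma IsKFinite.exists_annS_pow {f : Schwartz n} (hf : IsKFinite f) (k : Fin n) :
    ∃ r : ℕ, (annS k ^ r) f = 0 := by
  obtain ⟨F, hF, hfF, hst⟩ := hf
  set T : Module.End ℂ (Schwartz n) := creS k * annS k with hT
  have hTF : ∀ g ∈ F, T g ∈ F := by
    intro g hg
    have h := lie_spE k k g
    rw [if_pos rfl] at h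
    have e : T g = -(⁅spE k k, g⁆ + (1 / 2 : ℂ) • g) := by
      rw [h, hT, Module.End.mul_apply]; module
    rw [e]
    exact F.neg_mem (F.add_mem (hst _ (isCompactElement_spE k k) g hg) (F.smul_mem _ hg))
  -- vectors killed by a power of `annS k` form a subspace containing all generalized eigenspaces
  let W : Submodule ℂ (Schwartz n) :=
    { carrier := {g | ∃ r : ℕ, (annS k ^ r) g = 0}
      zero_mem' := ⟨0, by simp⟩
      add_mem' := by
        rintro g g' ⟨r, hr⟩ ⟨t, ht⟩
        refine ⟨r + t, ?_⟩
        rw [map_add, pow_add, Module.End.mul_apply, Module.End.mul_apply, ht, map_zero, add_zero,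
          ← Module.End.mul_apply, ← pow_add, add_comm, pow_add, Module.End.mul_apply, hr, map_zero]
      smul_mem' := by
        rintro c g ⟨r, hr⟩
        exact ⟨r, by rw [map_smul, hr, smul_zero]⟩ }
  have hcomm : ∀ (r : ℕ) (ν : ℂ), annS k ^ r * (T - ν • 1) =
      (T + ((r : ℂ) - ν) • 1) * annS k ^ r := fun r ν =>
    pow_mul_number_sub (by rw [annS_creS, if_pos rfl]) r ν
  have hinj : ∀ {c : ℂ}, 0 < c.re → ∀ (m : ℕ) (g : Schwartz n),
      ((T + c • 1) ^ m) g = 0 → g = 0 := by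
    intro c hc m
    induction m with
    | zero => intro g hg; simpa using hg
    | succ m ih =>
      intro g hg
      rw [pow_succ, Module.End.mul_apply] at hg
      exact eq_zero_of_creS_annS hc (by simpa [hT] using ih _ hg)
  have hgen : ∀ (ν : ℂ) (m : ℕ) (g : Schwartz n), ((T - ν • 1) ^ m) g = 0 → g ∈ W := by
    intro ν m g hg
    obtain ⟨r, hr⟩ := exists_nat_gt ν.re
    refine ⟨r, hinj (c := (r : ℂ) - ν) (by simpa using hr) m _ ?_⟩
    have h1 : annS k ^ r * (T - ν • 1) ^ m = (T + ((r : ℂ) - ν) • 1) ^ m * annS k ^ r := by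
      have : SemiconjBy (annS k ^ r) (T - ν • 1) (T + ((r : ℂ) - ν) • 1) := hcomm r ν
      exact this.pow_right m
    have h2 := LinearMap.congr_fun h1 g
    rw [Module.End.mul_apply, Module.End.mul_apply, hg, map_zero] at h2
    exact h2.symm
  have : FiniteDimensional ℂ F := Module.Finite.iff_fg.2 hF
  have htop := Module.End.iSup_maxGenEigenspace_eq_top (T.restrict hTF)
  have hle : (⊤ : Submodule ℂ F) ≤ W.comap F.subtype := by
    rw [← htop]
    refine iSup_le fun ν g hg => ?_
    obtain ⟨m, hm⟩ := (Module.End.mem_maxGenEigenspace _ _ _).1 hg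
    refine hgen ν m g.1 ?_
    have h1 : ∀ (m : ℕ) (g : F),
        ((((T.restrict hTF) - ν • 1) ^ m) g).1 = ((T - ν • 1) ^ m) g.1 := by
      intro m
      induction m with
      | zero => intro g; rfl
      | succ m ih => intro g; rw [pow_succ, pow_succ, Module.End.mul_apply, ih]; rfl
    rw [← h1, hm]
    rfl
  exact hle (Submodule.mem_top (x := (⟨f, hfF⟩ : F)))

/-! ### The fermionic Fock operators on exterior forms -/

/-- A basis of the covectors, consisting of weight vectors of weights `εₖ` and `-εₖ`, scaled such
that the root vectors `spX`, `spY`, `spE` act on forms without numerical factors. -/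
noncomputable def cov : Fin n ⊕ Fin n → Module.Dual ℂ (VC n)
  | Sum.inl k => (-1 / 2 : ℂ) • LinearMap.proj (Sum.inl k) +
      (Complex.I / 2) • LinearMap.proj (Sum.inr k)
  | Sum.inr k => (-2 * Real.pi : ℂ) • LinearMap.proj (Sum.inl k) +
      (-2 * Real.pi * Complex.I : ℂ) • LinearMap.proj (Sum.inr k)

/-- The basis of `VC n` dual to `cov`. -/
noncomputable def vec : Fin n ⊕ Fin n → VC n
  | Sum.inl k => Pi.single (Sum.inl k) (-1) + Pi.single (Sum.inr k) (-Complex.I)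
  | Sum.inr k => Pi.single (Sum.inl k) (-1 / (4 * Real.pi) : ℂ) +
      Pi.single (Sum.inr k) (Complex.I / (4 * Real.pi))

lemma cov_inl_apply (k : Fin n) (v : VC n) : cov (Sum.inl k) v =
    (-1 / 2 : ℂ) * v (Sum.inl k) + (Complex.I / 2) * v (Sum.inr k) := rfl

lemma cov_inr_apply (k : Fin n) (v : VC n) : cov (Sum.inr k) v =
    (-2 * Real.pi : ℂ) * v (Sum.inl k) + (-2 * Real.pi * Complex.I : ℂ) * v (Sum.inr k) := rfl

lemma sum_cov_smul_vec (v : VC n) : ∑ i, cov i v • vec i = v := by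
  have hpi := ofReal_pi_ne_zero
  funext j
  rw [Fintype.sum_sum_type, Pi.add_apply, Finset.sum_apply, Finset.sum_apply]
  rcases j with j | j <;>
    simp only [Pi.smul_apply, vec, Pi.add_apply, Pi.single_apply, Sum.inl.injEq, Sum.inr.injEq,
      reduceCtorEq, if_false, add_zero, zero_add, smul_eq_mul, mul_ite, mul_zero,
      Finset.sum_ite_eq, Finset.mem_univ, if_true, cov_inl_apply, cov_inr_apply] <;>
    field_simp <;> ring_nf <;> simp only [Complex.I_sq] <;> ring

lemma cov_vec (i j : Fin n ⊕ Fin n) : cov i (vec j) = if i = j then 1 else 0 := by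
  have hpi := ofReal_pi_ne_zero
  rcases i with k | k <;> rcases j with l | l <;> by_cases h : k = l <;>
    simp [cov_inl_apply, cov_inr_apply, vec, h] <;>
    (try field_simp) <;> ring_nf <;> (try simp only [Complex.I_sq]) <;> (try ring)

lemma sum_apply_vec_smul_cov (φ : Module.Dual ℂ (VC n)) : ∑ i, φ (vec i) • cov i = φ := by
  refine LinearMap.ext fun v => ?_
  have h := congrArg φ (sum_cov_smul_vec v)
  rw [← h]
  simp [mul_comm]

lemma lie_dual_apply (X : SpC n) (φ : Module.Dual ℂ (VC n)) (v : VC n) :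
    ⁅X, φ⁆ v = -φ (X.1 *ᵥ v) := by
  have h : ⁅X, φ⁆ v = -φ ⁅X, v⁆ := by simp
  exact h

lemma single_mulVec_apply (k l m : Fin n) (x : Fin n → ℂ) :
    (Matrix.single k l (1 : ℂ) *ᵥ x) m = if k = m then x l else 0 := by
  rw [Matrix.mulVec, dotProduct, Finset.sum_eq_single l] <;>
    simp +contextual [Matrix.single_apply, eq_comm]

lemma fromBlocks_mulVec_inl (A B C D : Matrix (Fin n) (Fin n) ℂ) (v : VC n) (m : Fin n) :
    (Matrix.fromBlocks A B C D *ᵥ v) (Sum.inl m) =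
      (A *ᵥ fun k => v (Sum.inl k)) m + (B *ᵥ fun k => v (Sum.inr k)) m := by
  rw [Matrix.fromBlocks_mulVec]; rfl

lemma fromBlocks_mulVec_inr (A B C D : Matrix (Fin n) (Fin n) ℂ) (v : VC n) (m : Fin n) :
    (Matrix.fromBlocks A B C D *ᵥ v) (Sum.inr m) =
      (C *ᵥ fun k => v (Sum.inl k)) m + (D *ᵥ fun k => v (Sum.inr k)) m := by
  rw [Matrix.fromBlocks_mulVec]; rfl

lemma symm_mulVec_apply (k l m : Fin n) (x : Fin n → ℂ) (c : ℂ) :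
    ((c • symm k l) *ᵥ x) m = c * ((if k = m then x l else 0) + if l = m then x k else 0) := by
  rw [Matrix.smul_mulVec, symm, Matrix.add_mulVec, Pi.smul_apply, Pi.add_apply,
    single_mulVec_apply, single_mulVec_apply, smul_eq_mul]

lemma neg_transpose_symm_mulVec_apply (k l m : Fin n) (x : Fin n → ℂ) (c : ℂ) :
    ((-(c • symm k l)ᵀ) *ᵥ x) m =
      -(c * ((if k = m then x l else 0) + if l = m then x k else 0)) := by
  rw [Matrix.transpose_smul, symm_transpose, Matrix.neg_mulVec, Pi.neg_apply, symm_mulVec_apply]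

lemma lie_spX_cov_inl (k l m : Fin n) : ⁅spX k l, cov (Sum.inl m)⁆ = 0 := by
  refine LinearMap.ext fun v => ?_
  rw [lie_dual_apply, cov_inl_apply, spX, fromBlocks_mulVec_inl, fromBlocks_mulVec_inr]
  simp only [symm_mulVec_apply, neg_transpose_symm_mulVec_apply, LinearMap.zero_apply]
  ring_nf
  simp only [Complex.I_sq]
  ring

lemma lie_spX_cov_inr (k l m : Fin n) : ⁅spX k l, cov (Sum.inr m)⁆ =
    (if l = m then cov (Sum.inl k) else 0) + if k = m then cov (Sum.inl l) else 0 := by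
  have hpi := ofReal_pi_ne_zero
  have hI := Complex.I_sq
  refine LinearMap.ext fun v => ?_
  rw [lie_dual_apply, cov_inr_apply, spX, fromBlocks_mulVec_inl, fromBlocks_mulVec_inr]
  simp only [symm_mulVec_apply, neg_transpose_symm_mulVec_apply]
  split_ifs <;> simp [cov_inl_apply] <;> field_simp <;> ring_nf <;> (try simp only [hI]) <;>
    (try ring)

lemma lie_spY_cov_inr (k l m : Fin n) : ⁅spY k l, cov (Sum.inr m)⁆ = 0 := by
  refine LinearMap.ext fun v => ?_
  rw [lie_dual_apply, cov_inr_apply, spY, fromBlocks_mulVec_inl, fromBlocks_mulVec_inr]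
  simp only [symm_mulVec_apply, neg_transpose_symm_mulVec_apply, LinearMap.zero_apply]
  ring_nf
  simp only [Complex.I_sq]
  ring

lemma lie_spY_cov_inl (k l m : Fin n) : ⁅spY k l, cov (Sum.inl m)⁆ =
    -((if l = m then cov (Sum.inr k) else 0) + if k = m then cov (Sum.inr l) else 0) := by
  have hI := Complex.I_sq
  refine LinearMap.ext fun v => ?_
  rw [lie_dual_apply, cov_inl_apply, spY, fromBlocks_mulVec_inl, fromBlocks_mulVec_inr]
  simp only [symm_mulVec_apply, neg_transpose_symm_mulVec_apply]
  split_ifs <;> simp [cov_inr_apply] <;> ring_nf <;> (try simp only [hI]) <;>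
    (try ring)

lemma antisymm_mulVec_apply (k l m : Fin n) (x : Fin n → ℂ) (c : ℂ) :
    ((c • (Matrix.single k l 1 - Matrix.single l k 1)) *ᵥ x) m =
      c * ((if k = m then x l else 0) - if l = m then x k else 0) := by
  rw [Matrix.smul_mulVec, Matrix.sub_mulVec, Pi.smul_apply, Pi.sub_apply,
    single_mulVec_apply, single_mulVec_apply, smul_eq_mul]

lemma neg_transpose_antisymm_mulVec_apply (k l m : Fin n) (x : Fin n → ℂ) (c : ℂ) :
    ((-(c • (Matrix.single k l 1 - Matrix.single l k 1))ᵀ) *ᵥ x) m =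
      c * ((if k = m then x l else 0) - if l = m then x k else 0) := by
  rw [← antisymm_mulVec_apply]
  congr 2
  rw [Matrix.transpose_smul, Matrix.transpose_sub, Matrix.transpose_single,
    Matrix.transpose_single, ← smul_neg, neg_sub]

lemma lie_spE_cov_inl (k l m : Fin n) : ⁅spE k l, cov (Sum.inl m)⁆ =
    if l = m then cov (Sum.inl k) else 0 := by
  have hI := Complex.I_sq
  refine LinearMap.ext fun v => ?_
  rw [lie_dual_apply, cov_inl_apply, spE, fromBlocks_mulVec_inl, fromBlocks_mulVec_inr]
  simp only [symm_mulVec_apply, antisymm_mulVec_apply, neg_transpose_antisymm_mulVec_apply]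
  split_ifs <;> simp [cov_inl_apply] <;> ring_nf <;> (try simp only [hI]) <;>
    (try ring)

lemma lie_spE_cov_inr (k l m : Fin n) : ⁅spE k l, cov (Sum.inr m)⁆ =
    -(if k = m then cov (Sum.inr l) else 0) := by
  have hI := Complex.I_sq
  refine LinearMap.ext fun v => ?_
  rw [lie_dual_apply, cov_inr_apply, spE, fromBlocks_mulVec_inl, fromBlocks_mulVec_inr]
  simp only [symm_mulVec_apply, antisymm_mulVec_apply, neg_transpose_antisymm_mulVec_apply]
  split_ifs <;> simp [cov_inr_apply] <;> ring_nf <;> (try simp only [hI]) <;>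
    (try ring)

/-- Exterior multiplication by a covector. -/
noncomputable def wedge (φ : Module.Dual ℂ (VC n)) : Module.End ℂ (Forms n) :=
  LinearMap.mulLeft ℂ (ExteriorAlgebra.ι ℂ φ)

/-- Contraction with a vector. -/
noncomputable def contr (v : VC n) : Module.End ℂ (Forms n) :=
  CliffordAlgebra.contractLeft (Q := (0 : QuadraticForm ℂ (Module.Dual ℂ (VC n))))
    (Module.Dual.eval ℂ (VC n) v)

lemma contr_ι_mul (v : VC n) (φ : Module.Dual ℂ (VC n)) (a : Forms n) :
    contr v (ExteriorAlgebra.ι ℂ φ * a) = φ v • a - ExteriorAlgebra.ι ℂ φ * contr v a :=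
  CliffordAlgebra.contractLeft_ι_mul _ _ _

lemma contr_algebraMap (v : VC n) (t : ℂ) : contr v (algebraMap ℂ (Forms n) t) = 0 :=
  CliffordAlgebra.contractLeft_algebraMap _ _ _

lemma wedge_anticomm (φ ψ : Module.Dual ℂ (VC n)) : wedge φ * wedge ψ = -(wedge ψ * wedge φ) := by
  refine LinearMap.ext fun a => ?_
  have := ExteriorAlgebra.ι_add_mul_swap (R := ℂ) φ ψ
  simp only [wedge, Module.End.mul_apply, LinearMap.mulLeft_apply, LinearMap.neg_apply,
    ← mul_assoc, eq_neg_of_add_eq_zero_left this, neg_mul]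

lemma contr_anticomm (v w : VC n) : contr v * contr w = -(contr w * contr v) :=
  LinearMap.ext fun a => CliffordAlgebra.contractLeft_comm _ _ a

lemma contr_wedge (v : VC n) (φ : Module.Dual ℂ (VC n)) :
    contr v * wedge φ = -(wedge φ * contr v) + φ v • 1 := by
  refine LinearMap.ext fun a => ?_
  simp only [wedge, Module.End.mul_apply, LinearMap.mulLeft_apply, LinearMap.neg_apply,
    LinearMap.add_apply, LinearMap.smul_apply, Module.End.one_apply, contr_ι_mul]
  abel

/-- A derivation of the exterior algebra in terms of exterior multiplications and contractions. -/
lemma exteriorDerivation_eq (f : Module.End ℂ (Module.Dual ℂ (VC n))) (a : Forms n) :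
    exteriorDerivation f a = (∑ i, wedge (f (cov i)) * contr (vec i)) a := by
  induction a using CliffordAlgebra.left_induction with
  | algebraMap r =>
    rw [LinearMap.sum_apply]
    refine (exteriorDerivation_algebraMap f r).trans (Finset.sum_eq_zero fun i _ => ?_).symm
    change wedge _ (contr (vec i) (algebraMap ℂ (Forms n) r)) = 0
    rw [contr_algebraMap, map_zero]
  | add x y hx hy => rw [map_add, map_add, hx, hy]
  | ι_mul a φ ha =>
    change exteriorDerivation f (ExteriorAlgebra.ι ℂ φ * a) =
      (∑ i, wedge (f (cov i)) * contr (vec i)) (ExteriorAlgebra.ι ℂ φ * a)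
    rw [exteriorDerivation_mul, ha, exteriorDerivation_ι]
    have h1 : f φ = ∑ i, φ (vec i) • f (cov i) := by
      conv_lhs => rw [← sum_apply_vec_smul_cov φ]
      simp
    rw [h1]
    simp only [LinearMap.sum_apply, Module.End.mul_apply, contr_ι_mul, wedge, map_sub, map_smul,
      LinearMap.mulLeft_apply, map_sum, Finset.mul_sum, Finset.sum_mul, ← Finset.sum_add_distrib,
      smul_mul_assoc]
    refine Finset.sum_congr rfl fun i _ => ?_
    rw [← mul_assoc, ← mul_assoc,
      eq_neg_of_add_eq_zero_left (ExteriorAlgebra.ι_add_mul_swap (R := ℂ) φ (f (cov i)))]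
    noncomm_ring

lemma lie_forms_apply (X : SpC n) (a : Forms n) :
    ⁅X, a⁆ = (∑ i, wedge ⁅X, cov i⁆ * contr (vec i)) a :=
  exteriorDerivation_eq (LieModule.toEnd ℂ (SpC n) (Module.Dual ℂ (VC n)) X) a

lemma wedge_zero : wedge (0 : Module.Dual ℂ (VC n)) = 0 := by
  refine LinearMap.ext fun a => ?_; simp [wedge]

lemma wedge_neg (φ : Module.Dual ℂ (VC n)) : wedge (-φ) = -wedge φ := by
  refine LinearMap.ext fun a => ?_; simp [wedge]

lemma wedge_add (φ ψ : Module.Dual ℂ (VC n)) : wedge (φ + ψ) = wedge φ + wedge ψ := by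
  refine LinearMap.ext fun a => ?_; simp [wedge, add_mul]

lemma lie_spX_forms (k l : Fin n) (a : Forms n) : ⁅spX k l, a⁆ =
    (wedge (cov (Sum.inl k)) * contr (vec (Sum.inr l)) +
      wedge (cov (Sum.inl l)) * contr (vec (Sum.inr k))) a := by
  rw [lie_forms_apply, Fintype.sum_sum_type]
  simp only [lie_spX_cov_inl, lie_spX_cov_inr, wedge_zero, wedge_add, add_mul,
    Finset.sum_add_distrib, apply_ite wedge, zero_mul, ite_mul, Finset.sum_ite_eq,
    Finset.mem_univ, if_true, Finset.sum_const_zero, zero_add]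

lemma lie_spY_forms (k l : Fin n) (a : Forms n) : ⁅spY k l, a⁆ =
    (-(wedge (cov (Sum.inr k)) * contr (vec (Sum.inl l)) +
      wedge (cov (Sum.inr l)) * contr (vec (Sum.inl k)))) a := by
  rw [lie_forms_apply, Fintype.sum_sum_type]
  simp only [lie_spY_cov_inl, lie_spY_cov_inr, wedge_zero, wedge_neg, wedge_add, add_mul, neg_mul,
    Finset.sum_add_distrib, Finset.sum_neg_distrib, apply_ite wedge, zero_mul, ite_mul,
    Finset.sum_ite_eq, Finset.mem_univ, if_true, Finset.sum_const_zero, add_zero]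

lemma lie_spE_forms (k l : Fin n) (a : Forms n) : ⁅spE k l, a⁆ =
    (wedge (cov (Sum.inl k)) * contr (vec (Sum.inl l)) -
      wedge (cov (Sum.inr l)) * contr (vec (Sum.inr k))) a := by
  rw [lie_forms_apply, Fintype.sum_sum_type]
  simp only [lie_spE_cov_inl, lie_spE_cov_inr, wedge_zero, wedge_neg, neg_mul,
    Finset.sum_neg_distrib, apply_ite wedge, zero_mul, ite_mul,
    Finset.sum_ite_eq, Finset.mem_univ, if_true, sub_eq_add_neg]

/-! ### The degree of exterior forms -/

lemma exteriorDerivation_id_of_mem {i : ℕ} {a : Forms n}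
    (ha : a ∈ ⋀[ℂ]^i (Module.Dual ℂ (VC n))) :
    exteriorDerivation LinearMap.id a = (i : ℂ) • a := by
  induction i generalizing a with
  | zero =>
    change a ∈ LinearMap.range (ExteriorAlgebra.ι ℂ) ^ 0 at ha
    rw [pow_zero, Submodule.mem_one] at ha
    obtain ⟨t, rfl⟩ := ha
    rw [exteriorDerivation_algebraMap]; simp
  | succ i ih =>
    change a ∈ LinearMap.range (ExteriorAlgebra.ι ℂ) ^ (i + 1) at ha
    rw [pow_succ] at ha
    induction ha using Submodule.mul_induction_on' with
    | mem_mul_mem x hx y hy =>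
      obtain ⟨φ, rfl⟩ := hy
      rw [exteriorDerivation_mul, ih hx, exteriorDerivation_ι]
      change x * ExteriorAlgebra.ι ℂ φ + (i : ℂ) • x * ExteriorAlgebra.ι ℂ φ =
        ((i + 1 : ℕ) : ℂ) • (x * ExteriorAlgebra.ι ℂ φ)
      rw [smul_mul_assoc, Nat.cast_add, Nat.cast_one, add_smul, one_smul, add_comm]
    | add x _ y _ hx hy => rw [map_add, hx, hy, smul_add]

lemma iSup_exteriorPower : ⨆ i : ℕ, ⋀[ℂ]^i (Module.Dual ℂ (VC n)) = ⊤ :=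
  (DirectSum.Decomposition.isInternal
    (fun i : ℕ => ⋀[ℂ]^i (Module.Dual ℂ (VC n)))).submodule_iSup_eq_top

/-- If subspaces spanning the whole space consist of eigenvectors, they are the eigenspaces. -/
lemma mem_of_eigen_of_iSup_eq_top {V : Type*} [AddCommGroup V] [Module ℂ V] {T : Module.End ℂ V}
    {W : ℕ → Submodule ℂ V} (hW : ⨆ i, W i = ⊤) (hT : ∀ i, ∀ u ∈ W i, T u = (i : ℂ) • u) {i : ℕ}
    {u : V} (hu : T u = (i : ℂ) • u) : u ∈ W i := by
  have htop : ⨆ ν, Module.End.eigenspace T ν = ⊤ := eq_top_iff.2 (hW ▸ iSup_le fun j =>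
    le_iSup_of_le (j : ℂ) fun w hw => Module.End.mem_eigenspace_iff.2 (hT j w hw))
  refine mem_of_mem_sup_coEigenspace (μ := (i : ℂ)) htop
    (fun w hw => by rw [hT i w hw]; exact (W i).smul_mem _ hw) hu ?_
  have hle : ⨆ j, W j ≤ W i ⊔ coEigenspace T (i : ℂ) := by
    refine iSup_le fun j => ?_
    by_cases hj : j = i
    · subst hj; exact le_sup_left
    · exact le_sup_of_le_right fun w hw => mem_coEigenspace (by exact_mod_cast hj) (hT j w hw)
  rw [hW] at hle
  exact hle Submodule.mem_top

lemma eq_algebraMap_of_contr_eq_zero {a : Forms n} (ha : ∀ i, contr (vec i) a = 0) :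
    ∃ t : ℂ, a = algebraMap ℂ (Forms n) t := by
  have h : exteriorDerivation LinearMap.id a = ((0 : ℕ) : ℂ) • a := by
    rw [exteriorDerivation_eq, LinearMap.sum_apply]
    simp [ha]
  have : a ∈ LinearMap.range (ExteriorAlgebra.ι ℂ) ^ 0 :=
    mem_of_eigen_of_iSup_eq_top (T := exteriorDerivation LinearMap.id)
      iSup_exteriorPower (fun i u hu => exteriorDerivation_id_of_mem hu) h
  rw [pow_zero, Submodule.mem_one] at this
  obtain ⟨t, ht⟩ := this
  exact ⟨t, ht.symm⟩

/-! ### The Fock space of all exterior forms with values in symplectic spinors -/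

lemma IsKFinite.add {f g : Schwartz n} (hf : IsKFinite f) (hg : IsKFinite g) :
    IsKFinite (f + g) := by
  obtain ⟨F, hF, hfF, hFst⟩ := hf
  obtain ⟨G, hG, hgG, hGst⟩ := hg
  refine ⟨F ⊔ G, hF.sup hG, Submodule.add_mem_sup hfF hgG, fun X hX h hh => ?_⟩
  obtain ⟨a, ha, b, hb, rfl⟩ := Submodule.mem_sup.1 hh
  rw [lie_add]
  exact Submodule.add_mem_sup (hFst X hX a ha) (hGst X hX b hb)

lemma IsKFinite.smul {f : Schwartz n} (hf : IsKFinite f) (c : ℂ) : IsKFinite (c • f) := by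
  obtain ⟨F, hF, hfF, hFst⟩ := hf
  exact ⟨F, hF, F.smul_mem c hfF, hFst⟩

/-- The module of all `K`-finite Schwartz functions. -/
noncomputable def kFinite (n : ℕ) : LieSubmodule ℂ (SpC n) (Schwartz n) where
  carrier := {f | IsKFinite f}
  zero_mem' := ⟨⊥, Submodule.fg_bot, Submodule.zero_mem _, by simp⟩
  add_mem' := IsKFinite.add
  smul_mem' c _ hf := IsKFinite.smul hf c
  lie_mem {X _} hf := IsKFinite.lie hf X

/-- The creation operators on `K`-finite functions. -/
noncomputable def creK (k : Fin n) : Module.End ℂ (kFinite n) where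
  toFun f := ⟨creS k f.1, IsKFinite.fock f.2 (creS_mem k)⟩
  map_add' f g := Subtype.ext (map_add (creS k) f.1 g.1)
  map_smul' c f := Subtype.ext (map_smul (creS k) c f.1)

/-- The annihilation operators on `K`-finite functions. -/
noncomputable def annK (k : Fin n) : Module.End ℂ (kFinite n) where
  toFun f := ⟨annS k f.1, IsKFinite.fock f.2 (annS_mem k)⟩
  map_add' f g := Subtype.ext (map_add (annS k) f.1 g.1)
  map_smul' c f := Subtype.ext (map_smul (annS k) c f.1)

lemma creK_comm (k l : Fin n) : creK k * creK l = creK l * creK k :=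
  LinearMap.ext fun f => Subtype.ext (LinearMap.congr_fun (creS_comm k l) f.1)

lemma annK_comm (k l : Fin n) : annK k * annK l = annK l * annK k :=
  LinearMap.ext fun f => Subtype.ext (LinearMap.congr_fun (annS_comm k l) f.1)

lemma annK_creK (k l : Fin n) : annK k * creK l = creK l * annK k + if k = l then 1 else 0 := by
  refine LinearMap.ext fun f => Subtype.ext ((LinearMap.congr_fun (annS_creS k l) f.1).trans ?_)
  split_ifs <;> rfl

lemma annK_pow_coe (k : Fin n) (r : ℕ) (f : kFinite n) : ((annK k ^ r) f).1 = (annS k ^ r) f.1 := by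
  induction r generalizing f with
  | zero => rfl
  | succ r ih => rw [pow_succ, pow_succ, Module.End.mul_apply, ih]; rfl

lemma exists_annK_pow (k : Fin n) (f : kFinite n) : ∃ r : ℕ, (annK k ^ r) f = 0 := by
  obtain ⟨r, hr⟩ := IsKFinite.exists_annS_pow f.2 k
  exact ⟨r, Subtype.ext ((annK_pow_coe k r f).trans hr)⟩

/-- Exterior forms with values in all `K`-finite Schwartz functions, even and odd. -/
abbrev TotalForms (n : ℕ) : Type := Forms n ⊗[ℂ] kFinite n

section

variable (S : Module.End ℂ (kFinite n)) (T : Module.End ℂ (Forms n))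

lemma lTensor_mul_rTensor : LinearMap.lTensor (Forms n) S * LinearMap.rTensor (kFinite n) T =
    LinearMap.rTensor (kFinite n) T * LinearMap.lTensor (Forms n) S := by
  refine TensorProduct.ext' fun a f => rfl

lemma lTensor_pow_apply (r : ℕ) (a : Forms n) (f : kFinite n) :
    (LinearMap.lTensor (Forms n) S ^ r) (a ⊗ₜ f) = a ⊗ₜ (S ^ r) f := by
  rw [LinearMap.lTensor_pow, LinearMap.lTensor_tmul]

end

/-- The Fock space structure of `TotalForms n`: the bosonic operators act on the Schwartz functions,
the fermionic ones on the exterior forms. -/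
noncomputable def totalFock (n : ℕ) : Fock n (TotalForms n) where
  z k := LinearMap.lTensor (Forms n) (creK k)
  d k := LinearMap.lTensor (Forms n) (annK k)
  c i := LinearMap.rTensor (kFinite n) (wedge (cov i))
  a i := LinearMap.rTensor (kFinite n) (contr (vec i))
  zz k l := by rw [← LinearMap.lTensor_mul, creK_comm, LinearMap.lTensor_mul]
  dd k l := by rw [← LinearMap.lTensor_mul, annK_comm, LinearMap.lTensor_mul]
  dz k l := by
    rw [← LinearMap.lTensor_mul, annK_creK, LinearMap.lTensor_add, LinearMap.lTensor_mul]
    split_ifs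
    · rw [Module.End.one_eq_id, LinearMap.lTensor_id, Module.End.one_eq_id]
    · rw [LinearMap.lTensor_zero]
  cc i j := by
    rw [← LinearMap.rTensor_mul, wedge_anticomm, LinearMap.rTensor_neg, LinearMap.rTensor_mul]
  aa i j := by
    rw [← LinearMap.rTensor_mul, contr_anticomm, LinearMap.rTensor_neg, LinearMap.rTensor_mul]
  ac i j := by
    rw [← LinearMap.rTensor_mul, contr_wedge, LinearMap.rTensor_add, LinearMap.rTensor_neg,
      LinearMap.rTensor_mul, cov_vec, LinearMap.rTensor_smul, Module.End.one_eq_id,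
      LinearMap.rTensor_id, Module.End.one_eq_id]
    by_cases h : i = j
    · simp [h]
    · simp [h, Ne.symm h]
  zc k i := lTensor_mul_rTensor _ _
  za k i := lTensor_mul_rTensor _ _
  dc k i := lTensor_mul_rTensor _ _
  da k i := lTensor_mul_rTensor _ _
  nilpotent k u := by
    induction u using TensorProduct.induction_on with
    | zero => exact ⟨0, map_zero _⟩
    | tmul a f =>
      obtain ⟨r, hr⟩ := exists_annK_pow k f
      exact ⟨r, by rw [lTensor_pow_apply, hr, TensorProduct.tmul_zero]⟩
    | add u v hu hv =>
      obtain ⟨r, hr⟩ := hu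
      obtain ⟨t, ht⟩ := hv
      refine ⟨r + t, ?_⟩
      rw [map_add, pow_add, Module.End.mul_apply, Module.End.mul_apply, ht, map_zero, add_zero,
        ← Module.End.mul_apply, ← pow_add, add_comm, pow_add, Module.End.mul_apply, hr, map_zero]

lemma lie_kFinite_spX (k l : Fin n) (f : kFinite n) : ⁅spX k l, f⁆ = annK k (annK l f) :=
  Subtype.ext (lie_spX k l f.1)

lemma lie_kFinite_spY (k l : Fin n) (f : kFinite n) : ⁅spY k l, f⁆ = creK k (creK l f) :=
  Subtype.ext (lie_spY k l f.1)

lemma lie_kFinite_spE (k l : Fin n) (f : kFinite n) : ⁅spE k l, f⁆ =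
    -creK l (annK k f) - (if k = l then (1 / 2 : ℂ) else 0) • f :=
  Subtype.ext (lie_spE k l f.1)

lemma lie_total_spX (k l : Fin n) (u : TotalForms n) : ⁅spX k l, u⁆ = (totalFock n).genX k l u := by
  induction u using TensorProduct.induction_on with
  | zero => rw [lie_zero, map_zero]
  | add u v hu hv => rw [lie_add, map_add, hu, hv]
  | tmul a f =>
    rw [TensorProduct.LieModule.lie_tmul_right, lie_spX_forms, lie_kFinite_spX]
    rw [LinearMap.add_apply, TensorProduct.add_tmul, add_comm]
    rfl

lemma lie_total_spY (k l : Fin n) (u : TotalForms n) : ⁅spY k l, u⁆ = (totalFock n).genY k l u := by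
  induction u using TensorProduct.induction_on with
  | zero => rw [lie_zero, map_zero]
  | add u v hu hv => rw [lie_add, map_add, hu, hv]
  | tmul a f =>
    rw [TensorProduct.LieModule.lie_tmul_right, lie_spY_forms, lie_kFinite_spY]
    rw [LinearMap.neg_apply, LinearMap.add_apply, TensorProduct.neg_tmul, TensorProduct.add_tmul,
      add_comm, ← sub_eq_add_neg]
    rfl

lemma lie_total_spE (k l : Fin n) (u : TotalForms n) : ⁅spE k l, u⁆ =
    (totalFock n).genE k l u - (if k = l then (1 / 2 : ℂ) else 0) • u := by
  induction u using TensorProduct.induction_on with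
  | zero => rw [lie_zero, map_zero, smul_zero, sub_zero]
  | add u v hu hv => rw [lie_add, map_add, hu, hv, smul_add]; abel
  | tmul a f =>
    have h : (totalFock n).genE k l (a ⊗ₜ f) =
        ((wedge (cov (Sum.inl k)) * contr (vec (Sum.inl l))) a) ⊗ₜ f -
        ((wedge (cov (Sum.inr l)) * contr (vec (Sum.inr k))) a) ⊗ₜ f -
        a ⊗ₜ (creK l (annK k f)) := rfl
    rw [TensorProduct.LieModule.lie_tmul_right, lie_spE_forms, lie_kFinite_spE, h]
    rw [LinearMap.sub_apply, TensorProduct.sub_tmul, TensorProduct.tmul_sub,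
      TensorProduct.tmul_neg, TensorProduct.tmul_smul]
    abel

/-- The Gaussian, as a `K`-finite function. -/
noncomputable def gaussianK (n : ℕ) : kFinite n := ⟨gaussian n, isKFinite_gaussian⟩

/-- The vacuum of `TotalForms n`: the constant form with value the Gaussian. -/
noncomputable def totalVacuum (n : ℕ) : TotalForms n := 1 ⊗ₜ gaussianK n

lemma one_tmul_eq_zero {f : kFinite n} (h : (1 : Forms n) ⊗ₜ[ℂ] f = 0) : f = 0 := by
  have := congrArg (fun u => TensorProduct.lid ℂ (kFinite n)
    (LinearMap.rTensor (kFinite n)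
      (ExteriorAlgebra.algebraMapInv (R := ℂ) (M := Module.Dual ℂ (VC n))).toLinearMap u)) h
  simpa using this

lemma exists_eq_one_tmul {u : TotalForms n}
    (hu : ∀ i, LinearMap.rTensor (kFinite n) (contr (vec i)) u = 0) :
    ∃ f : kFinite n, u = 1 ⊗ₜ f := by
  set b := Module.Basis.ofVectorSpace ℂ (kFinite n)
  obtain ⟨m, rfl⟩ := TensorProduct.eq_repr_basis_right b u
  have hm : ∀ j, ∃ t : ℂ, m j = algebraMap ℂ (Forms n) t := fun j => by
    refine eq_algebraMap_of_contr_eq_zero fun i => ?_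
    have h1 := hu i
    rw [Finsupp.sum, map_sum] at h1
    have h2 := TensorProduct.sum_tmul_basis_right_eq_zero b
      (m.mapRange (contr (vec i)) (map_zero _)) (by
        rw [Finsupp.sum_mapRange_index (by simp)]
        exact h1)
    exact DFunLike.congr_fun h2 j
  choose t ht using hm
  refine ⟨∑ j ∈ m.support, t j • b j, ?_⟩
  rw [Finsupp.sum, TensorProduct.tmul_sum]
  refine Finset.sum_congr rfl fun j _ => ?_
  rw [ht j, Algebra.algebraMap_eq_smul_one, TensorProduct.smul_tmul]

lemma isVacuum_total : (totalFock n).IsVacuum (totalVacuum n) where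
  ne_zero h := gaussian_ne_zero (congrArg Subtype.val (one_tmul_eq_zero h))
  ann_eq_zero := by
    rintro (k | i)
    · have h : annK k (gaussianK n) = 0 := Subtype.ext (annS_gaussian k)
      change (1 : Forms n) ⊗ₜ annK k (gaussianK n) = 0
      rw [h, TensorProduct.tmul_zero]
    · have h : contr (vec i) (1 : Forms n) = 0 := by
        have := contr_algebraMap (n := n) (vec i) 1
        rwa [map_one] at this
      change (contr (vec i) (1 : Forms n)) ⊗ₜ gaussianK n = 0
      rw [h, TensorProduct.zero_tmul]
  unique u hu := by
    obtain ⟨f, rfl⟩ := exists_eq_one_tmul fun i => hu (Sum.inr i)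
    have hf : ∀ k, annS k f.1 = 0 := fun k =>
      congrArg Subtype.val (one_tmul_eq_zero (f := annK k f) (hu (Sum.inl k)))
    refine ⟨f.1 0, ?_⟩
    have h : f = f.1 0 • gaussianK n := Subtype.ext (eq_smul_gaussian hf)
    conv_lhs => rw [h]
    rw [TensorProduct.tmul_smul]
    rfl

/-! ### Parity of Schwartz functions -/

/-- The reflection `f(x) ↦ f(-x)` of Schwartz functions. -/
noncomputable def reflectS (n : ℕ) : Module.End ℂ (Schwartz n) :=
  (SchwartzMap.compCLMOfContinuousLinearEquiv ℂ
    (ContinuousLinearEquiv.neg ℝ (M := EuclideanSpace ℝ (Fin n)))).toLinearMap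

lemma reflectS_apply (f : Schwartz n) (x : EuclideanSpace ℝ (Fin n)) :
    reflectS n f x = f (-x) := rfl

lemma reflectS_sq : reflectS n * reflectS n = 1 := by
  ext f x
  simp [reflectS_apply]

lemma reflectS_mulCoord (k : Fin n) :
    reflectS n * mulCoord k = -(mulCoord k * reflectS n) := by
  ext f x
  simp [reflectS_apply, mulCoord_apply]

lemma reflectS_partialDeriv (k : Fin n) :
    reflectS n * partialDeriv k = -(partialDeriv k * reflectS n) := by
  ext f x
  have h1 : HasFDerivAt (fun y => f (-y))
      ((fderiv ℝ f (-x)).comp (-ContinuousLinearMap.id ℝ (EuclideanSpace ℝ (Fin n)))) x :=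
    (f.hasFDerivAt (x := -x)).comp x (hasFDerivAt_id x).neg
  have h2 : fderiv ℝ (reflectS n f) x = _ := h1.fderiv
  simp [reflectS_apply, partialDeriv_apply, h2]

lemma reflectS_creS (k : Fin n) : reflectS n * creS k = -(creS k * reflectS n) := by
  rw [creS, mul_sub, sub_mul, mul_smul_comm, smul_mul_assoc, reflectS_mulCoord,
    reflectS_partialDeriv, smul_neg]
  abel

lemma reflectS_annS (k : Fin n) : reflectS n * annS k = -(annS k * reflectS n) := by
  rw [annS, mul_smul_comm, smul_mul_assoc, mul_add, add_mul, mul_smul_comm, smul_mul_assoc,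
    reflectS_mulCoord, reflectS_partialDeriv]
  module

lemma reflectS_weilOp_spE (k l : Fin n) :
    reflectS n * weilOp (spE k l).1 = weilOp (spE k l).1 * reflectS n := by
  have h : reflectS n * (creS l * annS k) = creS l * annS k * reflectS n := by
    rw [← mul_assoc, reflectS_creS, neg_mul, mul_assoc, reflectS_annS, mul_neg, neg_neg, mul_assoc]
  rw [weilOp_spE, mul_sub, sub_mul, mul_neg, h]
  split_ifs <;> simp

lemma IsKFinite.reflectS {f : Schwartz n} (hf : IsKFinite f) : IsKFinite (reflectS n f) := by
  obtain ⟨F, hF, hfF, hst⟩ := hf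
  refine ⟨F.map (SymplecticSpinor.reflectS n), hF.map _, ⟨f, hfF, rfl⟩, fun X hX g hg =>
    lie_mem_of_spE ?_ hX hg⟩
  rintro k l _ ⟨g, hg, rfl⟩
  exact ⟨⁅spE k l, g⁆, hst _ (isCompactElement_spE k l) g hg,
    LinearMap.congr_fun (reflectS_weilOp_spE k l) g⟩

/-- The reflection of `K`-finite functions. -/
noncomputable def reflectK (n : ℕ) : Module.End ℂ (kFinite n) where
  toFun f := ⟨reflectS n f.1, IsKFinite.reflectS f.2⟩
  map_add' f g := Subtype.ext (map_add (reflectS n) f.1 g.1)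
  map_smul' c f := Subtype.ext (map_smul (reflectS n) c f.1)

/-- The parity operator of `TotalForms n`. -/
noncomputable def totalParity (n : ℕ) : Module.End ℂ (TotalForms n) :=
  LinearMap.lTensor (Forms n) (reflectK n)

lemma isParity_total : (totalFock n).IsParity (totalVacuum n) (totalParity n) where
  z k := by
    have h : reflectK n * creK k = -(creK k * reflectK n) :=
      LinearMap.ext fun f => Subtype.ext (LinearMap.congr_fun (reflectS_creS k) f.1)
    change LinearMap.lTensor _ _ * LinearMap.lTensor _ _ =
      -(LinearMap.lTensor _ _ * LinearMap.lTensor _ _)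
    rw [← LinearMap.lTensor_mul, h, LinearMap.lTensor_neg, LinearMap.lTensor_mul]
  d k := by
    have h : reflectK n * annK k = -(annK k * reflectK n) :=
      LinearMap.ext fun f => Subtype.ext (LinearMap.congr_fun (reflectS_annS k) f.1)
    change LinearMap.lTensor _ _ * LinearMap.lTensor _ _ =
      -(LinearMap.lTensor _ _ * LinearMap.lTensor _ _)
    rw [← LinearMap.lTensor_mul, h, LinearMap.lTensor_neg, LinearMap.lTensor_mul]
  c i := lTensor_mul_rTensor _ _
  a i := lTensor_mul_rTensor _ _
  vacuum := by
    have h : reflectK n (gaussianK n) = gaussianK n := by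
      refine Subtype.ext ?_
      ext x
      change gaussian n (-x) = gaussian n x
      rw [gaussian_apply, gaussian_apply, norm_neg]
    change (1 : Forms n) ⊗ₜ reflectK n (gaussianK n) = _
    rw [h]
    rfl
  sq := by
    have h : reflectK n * reflectK n = 1 :=
      LinearMap.ext fun f => Subtype.ext (LinearMap.congr_fun reflectS_sq f.1)
    rw [totalParity, ← LinearMap.lTensor_mul, h, Module.End.one_eq_id, LinearMap.lTensor_id,
      Module.End.one_eq_id]

/-! ### The two parities -/

/-- The inclusion of the even respectively odd functions into all `K`-finite functions. -/
noncomputable def inclK (n : ℕ) (s : Fin 2) : Spinor n s →ₗ[ℂ] kFinite n where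
  toFun f := ⟨f.1, f.2.1⟩
  map_add' _ _ := rfl
  map_smul' _ _ := rfl

/-- The projection of all `K`-finite functions onto the even respectively odd ones. -/
noncomputable def projK (n : ℕ) (s : Fin 2) : kFinite n →ₗ[ℂ] Spinor n s where
  toFun f := ⟨((1 / 2 : ℂ) • (f + (-1 : ℂ) ^ (s : ℕ) • reflectK n f)).1,
    ((1 / 2 : ℂ) • (f + (-1 : ℂ) ^ (s : ℕ) • reflectK n f)).2, fun x => by
      have h : ∀ y, ((1 / 2 : ℂ) • (f + (-1 : ℂ) ^ (s : ℕ) • reflectK n f)).1 y =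
          (1 / 2 : ℂ) * (f.1 y + (-1 : ℂ) ^ (s : ℕ) * f.1 (-y)) := fun _ => rfl
      have h2 : (-1 : ℂ) ^ (s : ℕ) * (-1 : ℂ) ^ (s : ℕ) = 1 := by
        rw [← mul_pow]; norm_num
      rw [h, h, neg_neg]
      linear_combination (-(1 / 2) * f.1 (-x)) * h2⟩
  map_add' f g := Subtype.ext (congrArg (fun g : kFinite n => g.1)
    (show (1 / 2 : ℂ) • ((f + g) + (-1 : ℂ) ^ (s : ℕ) • reflectK n (f + g)) =
      (1 / 2 : ℂ) • (f + (-1 : ℂ) ^ (s : ℕ) • reflectK n f) +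
        (1 / 2 : ℂ) • (g + (-1 : ℂ) ^ (s : ℕ) • reflectK n g) by rw [map_add]; module))
  map_smul' c f := Subtype.ext (congrArg (fun g : kFinite n => g.1)
    (show (1 / 2 : ℂ) • ((c • f) + (-1 : ℂ) ^ (s : ℕ) • reflectK n (c • f)) =
      c • (1 / 2 : ℂ) • (f + (-1 : ℂ) ^ (s : ℕ) • reflectK n f) by rw [map_smul]; module))

lemma inclK_projK (s : Fin 2) : inclK n s ∘ₗ projK n s =
    (1 / 2 : ℂ) • (LinearMap.id + (-1 : ℂ) ^ (s : ℕ) • reflectK n) := rfl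

lemma projK_inclK (s : Fin 2) : projK n s ∘ₗ inclK n s = LinearMap.id := by
  refine LinearMap.ext fun f => Subtype.ext ?_
  ext x
  have h2 : (-1 : ℂ) ^ (s : ℕ) * (-1 : ℂ) ^ (s : ℕ) = 1 := by
    rw [← mul_pow]; norm_num
  have hf := f.2.2 x
  change (1 / 2 : ℂ) * (f.1 x + (-1 : ℂ) ^ (s : ℕ) * f.1 (-x)) = f.1 x
  rw [hf]
  linear_combination (1 / 2 * f.1 x) * h2

/-- The inclusion of `SpinorForms n s` into `TotalForms n`. -/
noncomputable def incl (n : ℕ) (s : Fin 2) : SpinorForms n s →ₗ[ℂ] TotalForms n :=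
  LinearMap.lTensor (Forms n) (inclK n s)

/-- The projection of `TotalForms n` onto `SpinorForms n s`. -/
noncomputable def proj (n : ℕ) (s : Fin 2) : TotalForms n →ₗ[ℂ] SpinorForms n s :=
  LinearMap.lTensor (Forms n) (projK n s)

lemma proj_incl (s : Fin 2) (w : SpinorForms n s) : proj n s (incl n s w) = w := by
  rw [proj, incl, ← LinearMap.comp_apply, ← LinearMap.lTensor_comp, projK_inclK,
    LinearMap.lTensor_id, LinearMap.id_apply]

lemma incl_proj (s : Fin 2) (u : TotalForms n) : incl n s (proj n s u) =
    (1 / 2 : ℂ) • (u + (-1 : ℂ) ^ (s : ℕ) • totalParity n u) := by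
  rw [proj, incl, ← LinearMap.comp_apply, ← LinearMap.lTensor_comp, inclK_projK,
    LinearMap.lTensor_smul, LinearMap.lTensor_add, LinearMap.lTensor_smul, LinearMap.lTensor_id]
  rfl

lemma incl_injective (s : Fin 2) : Function.Injective (incl n s) :=
  Function.LeftInverse.injective (proj_incl s)

lemma lie_incl (s : Fin 2) (X : SpC n) (w : SpinorForms n s) :
    ⁅X, incl n s w⁆ = incl n s ⁅X, w⁆ := by
  induction w using TensorProduct.induction_on with
  | zero => rw [map_zero, lie_zero, lie_zero, map_zero]
  | add u v hu hv => rw [map_add, lie_add, lie_add, map_add, hu, hv]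
  | tmul a f =>
    rw [incl, LinearMap.lTensor_tmul, TensorProduct.LieModule.lie_tmul_right,
      TensorProduct.LieModule.lie_tmul_right, map_add, LinearMap.lTensor_tmul,
      LinearMap.lTensor_tmul]
    rfl

/-! ### Degrees -/

lemma totalFock_deg : (totalFock n).deg =
    LinearMap.rTensor (kFinite n) (exteriorDerivation LinearMap.id) := by
  refine TensorProduct.ext' fun a f => ?_
  rw [LinearMap.rTensor_tmul, exteriorDerivation_eq, Fintype.sum_sum_type, LinearMap.add_apply,
    LinearMap.sum_apply, LinearMap.sum_apply, TensorProduct.add_tmul, TensorProduct.sum_tmul,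
    TensorProduct.sum_tmul, Fock.deg, LinearMap.add_apply, Fock.nx, Fock.ny, LinearMap.sum_apply,
    LinearMap.sum_apply]
  rfl

lemma deg_incl (s : Fin 2) (w : SpinorForms n s) : (totalFock n).deg (incl n s w) =
    incl n s (LinearMap.rTensor (Spinor n s) (exteriorDerivation LinearMap.id) w) := by
  rw [totalFock_deg]
  refine LinearMap.congr_fun (TensorProduct.ext' fun a f => ?_ :
    LinearMap.rTensor (kFinite n) (exteriorDerivation LinearMap.id) ∘ₗ incl n s =
      incl n s ∘ₗ LinearMap.rTensor (Spinor n s) (exteriorDerivation LinearMap.id)) w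
  rfl

lemma iSup_degreePart (s : Fin 2) : ⨆ i, degreePart n s i = ⊤ := by
  rw [eq_top_iff]
  rintro u -
  induction u using TensorProduct.induction_on with
  | zero => exact Submodule.zero_mem _
  | add u v hu hv => exact Submodule.add_mem _ hu hv
  | tmul a f =>
    have h : ⨆ i : ℕ, ⋀[ℂ]^i (Module.Dual ℂ (VC n)) ≤
        (⨆ i, degreePart n s i).comap ((TensorProduct.mk ℂ (Forms n) (Spinor n s)).flip f) :=
      iSup_le fun i b hb => Submodule.mem_iSup_of_mem i ⟨(⟨b, hb⟩ :
        ⋀[ℂ]^i (Module.Dual ℂ (VC n))) ⊗ₜ f, rfl⟩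
    rw [iSup_exteriorPower] at h
    exact h Submodule.mem_top

lemma mem_degreePart {s : Fin 2} {i : ℕ} {w : SpinorForms n s} :
    w ∈ degreePart n s i ↔ (totalFock n).deg (incl n s w) = (i : ℂ) • incl n s w := by
  have h1 : ∀ i, ∀ u ∈ degreePart n s i,
      LinearMap.rTensor (Spinor n s) (exteriorDerivation LinearMap.id) u = (i : ℂ) • u := by
    rintro i _ ⟨u, rfl⟩
    induction u using TensorProduct.induction_on with
    | zero => rw [map_zero, map_zero, smul_zero]
    | add u v hu hv => rw [map_add, map_add, hu, hv, smul_add]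
    | tmul a f =>
      rw [LinearMap.rTensor_tmul, LinearMap.rTensor_tmul, Submodule.subtype_apply,
        exteriorDerivation_id_of_mem a.2, TensorProduct.smul_tmul']
  rw [deg_incl, ← map_smul, (incl_injective s).eq_iff]
  exact ⟨h1 i w, mem_of_eigen_of_iSup_eq_top (iSup_degreePart s) h1⟩

/-! ### The irreducible summands -/

lemma lie_mem_of_isStable {N : Submodule ℂ (TotalForms n)} (hN : (totalFock n).IsStable N)
    (X : SpC n) {u : TotalForms n} (hu : u ∈ N) : ⁅X, u⁆ ∈ N := by
  obtain ⟨a, b, c, h, -⟩ := exists_eq_sum X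
  rw [h]
  simp only [sum_lie, add_lie, smul_lie]
  refine N.sum_mem fun k _ => N.sum_mem fun l _ => N.add_mem (N.add_mem (N.smul_mem _ ?_)
    (N.smul_mem _ ?_)) (N.smul_mem _ ?_)
  · rw [lie_total_spE]
    exact N.sub_mem (hN.genE k l u hu) (N.smul_mem _ hu)
  · rw [lie_total_spX]
    exact hN.genX k l u hu
  · rw [lie_total_spY]
    exact hN.genY k l u hu

lemma isStable_of_lie_mem {N : Submodule ℂ (TotalForms n)}
    (hN : ∀ X : SpC n, ∀ u ∈ N, ⁅X, u⁆ ∈ N) : (totalFock n).IsStable N where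
  genX k l u hu := lie_total_spX k l u ▸ hN _ u hu
  genY k l u hu := lie_total_spY k l u ▸ hN _ u hu
  genE k l u hu := by
    rw [← sub_add_cancel ((totalFock n).genE k l u) ((if k = l then (1 / 2 : ℂ) else 0) • u),
      ← lie_total_spE]
    exact N.add_mem (hN _ u hu) (N.smul_mem _ hu)

/-- The summand of degree `i` belonging to the representations of `𝔬𝔰𝔭(1|2)` generated in
degree `j`. -/
noncomputable def partModule (s : Fin 2) (i j : ℕ) :
    LieSubmodule ℂ (SpC n) (SpinorForms n s) where
  toSubmodule := ((totalFock n).part (totalParity n) i j s).comap (incl n s)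
  lie_mem {X w} hw := by
    change incl n s ⁅X, w⁆ ∈ (totalFock n).part (totalParity n) i j s
    rw [← lie_incl]
    exact lie_mem_of_isStable (Fock.part_stable isParity_total i j s) X hw

lemma mem_partModule {s : Fin 2} {i j : ℕ} {w : SpinorForms n s} :
    w ∈ partModule s i j ↔ incl n s w ∈ (totalFock n).part (totalParity n) i j s := Iff.rfl

lemma exists_incl_eq {s : Fin 2} {i j : ℕ} {u : TotalForms n}
    (hu : u ∈ (totalFock n).part (totalParity n) i j s) : ∃ w, incl n s w = u := by
  have h2 : (-1 : ℂ) ^ (s : ℕ) * (-1 : ℂ) ^ (s : ℕ) = 1 := by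
    rw [← mul_pow]; norm_num
  refine ⟨proj n s u, ?_⟩
  rw [incl_proj, (Fock.mem_part.1 hu).2.2, smul_smul, h2]
  module

lemma partModule_le_degreePart (s : Fin 2) (i j : ℕ) :
    ((partModule s i j : LieSubmodule ℂ (SpC n) (SpinorForms n s)) :
      Submodule ℂ (SpinorForms n s)) ≤ degreePart n s i := by
  intro w hw
  exact mem_degreePart.2 (Fock.mem_part.1 (mem_partModule.1 hw)).1

/-- Positive roots take positive integer values on the element defining `Fock.height`. -/
lemma exists_nat_of_mem_positiveRoots {α : Fin n → ℂ} (hα : α ∈ positiveRoots n) :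
    ∃ t : ℕ, 0 < t ∧ ∑ k : Fin n, ((n : ℂ) - k) * α k = t := by
  have hs : ∀ l : Fin n, ∑ k : Fin n, ((n : ℂ) - k) * (Pi.single l 1 : Fin n → ℂ) k = n - l := by
    intro l
    simp [Pi.single_apply]
  rcases hα with ⟨k, l, hkl, rfl⟩ | ⟨k, l, rfl⟩
  · refine ⟨l - k, Nat.sub_pos_of_lt hkl, ?_⟩
    simp only [Pi.sub_apply, mul_sub, Finset.sum_sub_distrib, hs]
    rw [Nat.cast_sub (le_of_lt hkl)]
    ring
  · refine ⟨(n - k) + (n - l), by have := k.2; omega, ?_⟩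
    simp only [Pi.add_apply, mul_add, Finset.sum_add_distrib, hs]
    rw [Nat.cast_add, Nat.cast_sub k.2.le, Nat.cast_sub l.2.le]

lemma height_lie {α : Fin n → ℂ} {X : SpC n} (hX : IsRootVector α X) {m : ℂ} {u : TotalForms n}
    (hu : (totalFock n).height u = m • u) : (totalFock n).height ⁅X, u⁆ =
      (m - ∑ k : Fin n, ((n : ℂ) - k) * α k) • ⁅X, u⁆ := by
  have h : ∀ k, Shifts ((totalFock n).genE k k)
      (LieModule.toEnd ℂ (SpC n) (TotalForms n) X) (α k) := by
    intro k
    have hE : ∀ u : TotalForms n, (totalFock n).genE k k u =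
        ⁅cartanH k, u⁆ + (1 / 2 : ℂ) • u := by
      intro u
      rw [cartanH_eq, lie_total_spE, if_pos rfl, sub_add_cancel]
    refine LinearMap.ext fun u => ?_
    change (totalFock n).genE k k ⁅X, u⁆ = ⁅X, (totalFock n).genE k k u⁆ + α k • ⁅X, u⁆
    rw [hE, hE, leibniz_lie, hX k, smul_lie, lie_add, lie_smul]
    abel
  have h2 := (Fock.height_shifts (totalFock n) h).apply u
  change (totalFock n).height ⁅X, u⁆ = ⁅X, (totalFock n).height u⁆ + _ • ⁅X, u⁆ at h2
  rw [h2, hu, lie_smul]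
  module

lemma isIrreducibleHighestWeightModule {s : Fin 2} {i j : ℕ} {wt : Fin n → ℂ}
    (h : (totalFock n).IsHighestWeightPart ((totalFock n).part (totalParity n) i j s) wt) :
    IsIrreducibleHighestWeightModule (partModule (n := n) s i j) fun k => wt k - 1 / 2 := by
  obtain ⟨u, hu, hu0, hwt, m, hm, hmin⟩ := h.exists_top
  obtain ⟨w, rfl⟩ := exists_incl_eq hu
  have hw : w ∈ partModule s i j := hu
  have hw0 : (⟨w, hw⟩ : partModule s i j) ≠ 0 := fun h0 => hu0 (by
    rw [show w = 0 from congrArg Subtype.val h0, map_zero])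
  constructor
  · have : Nontrivial (partModule (n := n) s i j) := ⟨_, _, hw0⟩
    refine LieModule.IsIrreducible.mk fun N hN => ?_
    have hmap : (N : Submodule ℂ (partModule (n := n) s i j)).map
        (incl n s ∘ₗ (partModule (n := n) s i j : Submodule ℂ (SpinorForms n s)).subtype) =
          (totalFock n).part (totalParity n) i j s := by
      refine h.irreducible _ ?_ ?_ (isStable_of_lie_mem ?_)
      · rintro _ ⟨v, -, rfl⟩
        exact v.2
      · intro h0
        refine hN ((LieSubmodule.eq_bot_iff _).2 fun v hv => ?_)
        have h1 : incl n s v.1 ∈ (⊥ : Submodule ℂ (TotalForms n)) := h0 ▸ ⟨v, hv, rfl⟩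
        exact Subtype.ext (incl_injective s (((Submodule.mem_bot ℂ).1 h1).trans (map_zero _).symm))
      · rintro X _ ⟨v, hv, rfl⟩
        exact ⟨_, N.lie_mem (x := X) hv, (lie_incl s X v.1).symm⟩
    refine eq_top_iff.2 fun v _ => ?_
    have hv : incl n s v.1 ∈ (totalFock n).part (totalParity n) i j s := v.2
    rw [← hmap] at hv
    obtain ⟨v', hv', e⟩ := hv
    exact (Subtype.ext (incl_injective s e) : v' = v) ▸ hv'
  · refine ⟨⟨w, hw⟩, hw0, fun k => Subtype.ext (incl_injective s ?_), fun α hα X hX =>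
      Subtype.ext (incl_injective s ?_)⟩
    · change incl n s ⁅cartanH k, w⁆ = incl n s ((wt k - 1 / 2) • w)
      rw [← lie_incl, cartanH_eq, lie_total_spE, if_pos rfl, hwt, map_smul, sub_smul]
    · change incl n s ⁅X, w⁆ = incl n s 0
      obtain ⟨t, ht, hsum⟩ := exists_nat_of_mem_positiveRoots hα
      rw [← lie_incl, map_zero]
      refine hmin t ht _ ?_ (by rw [height_lie hX hm, hsum])
      exact lie_mem_of_isStable (Fock.part_stable isParity_total i j s) X hu

/-! ### The decomposition -/

lemma mem_Xi {p : ℕ × ℕ} (hp : p ∈ Xi n) : p.2 ≤ n ∧ p.2 ≤ p.1 ∧ p.1 + p.2 ≤ 2 * n := by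
  rcases hp with ⟨h1, h2⟩ | ⟨h1, h2, h3⟩ <;> omega

lemma neg_one_pow_eq_ite (m : ℕ) : (-1 : ℂ) ^ m = if m % 2 = 0 then 1 else -1 := by
  split_ifs with h
  · exact (Nat.even_iff.2 h).neg_one_pow
  · exact (Nat.odd_iff.2 (by omega)).neg_one_pow

lemma lowerWeight_eq {s : Fin 2} {i j e : ℕ} (hi : i ≤ n) (hj : j ≤ i)
    (he : e = (s + (i + j)) % 2) (k : Fin n) :
    lowerWeight n s i j k = Fock.topWeight n j e k - 1 / 2 := by
  have hk := k.2
  have hs := s.2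
  rw [lowerWeight, Fock.topWeight, neg_one_pow_eq_ite]
  have hs1 : s = 1 ↔ (s : ℕ) = 1 := by rw [Fin.ext_iff]; rfl
  simp only [hs1]
  by_cases hjn : j = n
  · have hin : i = n := by omega
    subst hjn hin
    have hes : e = s := by omega
    subst hes
    rcases (by omega : (s : ℕ) = 0 ∨ (s : ℕ) = 1) with h | h <;>
      by_cases hk1 : (k : ℕ) + 1 = i <;> simp [h, hk1] <;> norm_num
  · have h1 : ¬(i = n ∧ j = n) := fun h => hjn h.2
    have h2 : ¬(j = n ∧ e = 1) := fun h => hjn h.1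
    rw [if_neg h1, if_neg h2]
    by_cases hk1 : (k : ℕ) + 1 = n
    · rw [if_pos hk1, if_pos hk1, if_neg (by omega : ¬(k : ℕ) < j)]
      rcases (by omega : e = 0 ∨ e = 1) with h | h
      · rw [if_pos (by omega), h]; norm_num
      · rw [if_neg (by omega), h]; norm_num
    · rw [if_neg hk1, if_neg hk1]
      split_ifs <;> norm_num

lemma spinorWeight_eq {s : Fin 2} {p : ℕ × ℕ} (hp : p ∈ Xi n) :
    spinorWeight n s p.1 p.2 =
      fun k => Fock.topWeight n p.2 ((s + (p.1 + p.2)) % 2) k - 1 / 2 := by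
  funext k
  rw [spinorWeight]
  split_ifs with h
  · exact lowerWeight_eq h (mem_Xi hp).2.1 rfl k
  · have h2 := mem_Xi hp
    exact lowerWeight_eq (by omega) (by omega) (by omega) k

lemma isIrreducibleHighestWeightModule_partModule (hn : 0 < n) (s : Fin 2) {p : ℕ × ℕ}
    (hp : p ∈ Xi n) : IsIrreducibleHighestWeightModule (partModule (n := n) s p.1 p.2)
      (spinorWeight n s p.1 p.2) := by
  obtain ⟨h1, h2, h3⟩ := mem_Xi hp
  rw [spinorWeight_eq hp]
  refine isIrreducibleHighestWeightModule ?_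
  have h := Fock.isHighestWeightPart isVacuum_total hn isParity_total
    (e := (s + (p.1 + p.2)) % 2) (Nat.mod_lt _ two_pos) h1 (t := p.1 - p.2) (by omega)
  have hpow : (-1 : ℂ) ^ ((s + (p.1 + p.2)) % 2 + (p.1 - p.2)) = (-1 : ℂ) ^ (s : ℕ) := by
    rw [neg_one_pow_eq_ite, neg_one_pow_eq_ite]
    congr 2
    omega
  rwa [Fock.part, hpow, Nat.add_sub_cancel' h2] at h

/-- The pair `(i, j)` is determined by the joint eigenvalue of `Fp * Fm` and the degree, encoded as
real and imaginary part of a single eigenvalue. -/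
lemma stringValue_add_I_injective :
    Function.Injective fun p : Xi n => stringValue n p.1.1 p.1.2 + p.1.1 * Complex.I := by
  rintro ⟨⟨i, j⟩, hp⟩ ⟨⟨i', j'⟩, hp'⟩ h
  have hre : ∀ a b : ℕ, (stringValue n a b).im = 0 := by
    intro a b
    have : stringValue n a b =
        (((if Even (a + b) then ((b : ℝ) - a) / 2
          else (2 * (n : ℝ) + 1 - a - b) / 2) : ℝ) : ℂ) := by
      rw [stringValue]
      split_ifs <;> push_cast <;> rfl
    rw [this, Complex.ofReal_im]
  have him := congrArg Complex.im h
  simp only [Complex.add_im, hre, Complex.mul_im, Complex.natCast_re, Complex.natCast_im,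
    Complex.I_im, Complex.I_re] at him
  have hi : i = i' := by
    have : (i : ℝ) = i' := by linarith
    exact_mod_cast this
  subst hi
  have hj := stringValue_injective (n := n) (i := i) (j := j) (j' := j') (mem_Xi hp').2.2
    (mem_Xi hp).2.1 (add_right_cancel h)
  subst hj
  rfl

lemma iSupIndep_partModule (s : Fin 2) : iSupIndep fun p : Xi n =>
    ((partModule s p.1.1 p.1.2 : LieSubmodule ℂ (SpC n) (SpinorForms n s)) :
      Submodule ℂ (SpinorForms n s)) := by
  set R : Module.End ℂ (TotalForms n) :=
    (totalFock n).Fp * (totalFock n).Fm + Complex.I • (totalFock n).deg with hR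
  have hind := (Module.End.eigenspaces_iSupIndep R).comp (stringValue_add_I_injective (n := n))
  have hle : ∀ p : Xi n, ((partModule s p.1.1 p.1.2 : LieSubmodule ℂ (SpC n) (SpinorForms n s)) :
      Submodule ℂ (SpinorForms n s)) ≤ (Module.End.eigenspace R
        (stringValue n p.1.1 p.1.2 + p.1.1 * Complex.I)).comap (incl n s) := by
    intro p w hw
    obtain ⟨h1, h2, -⟩ := Fock.mem_part.1 (mem_partModule.1 hw)
    rw [Submodule.mem_comap, Module.End.mem_eigenspace_iff, hR, LinearMap.add_apply,
      LinearMap.smul_apply, Module.End.mul_apply, h1, h2]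
    module
  intro p
  rw [Submodule.disjoint_def]
  intro w hw hw'
  refine incl_injective s ((Submodule.disjoint_def.1 (hind p) _ (hle p hw) ?_).trans
    (map_zero _).symm)
  have h : (⨆ q, ⨆ _ : q ≠ p,
      ((partModule s q.1.1 q.1.2 : LieSubmodule ℂ (SpC n) (SpinorForms n s)) :
        Submodule ℂ (SpinorForms n s))) ≤ (⨆ q : Xi n, ⨆ _ : q ≠ p, Module.End.eigenspace R
          (stringValue n q.1.1 q.1.2 + q.1.1 * Complex.I)).comap (incl n s) :=
    iSup₂_le fun q hq w hw => Submodule.mem_iSup_of_mem q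
      (Submodule.mem_iSup_of_mem hq (hle q hw))
  exact h hw'

lemma proj_mem_partModule (s : Fin 2) {i j : ℕ} {u : TotalForms n}
    (hu : u ∈ (totalFock n).sector i j) : proj n s u ∈ partModule s i j := by
  have hP := isParity_total (n := n)
  have h2 : (-1 : ℂ) ^ (s : ℕ) * (-1 : ℂ) ^ (s : ℕ) = 1 := by
    rw [← mul_pow]; norm_num
  have hc : ∀ {T : Module.End ℂ (TotalForms n)} {μ : ℂ},
      totalParity n * T = T * totalParity n → T u = μ • u →
        T (totalParity n u) = μ • totalParity n u := by
    intro T μ hT h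
    have := LinearMap.congr_fun hT u
    rw [Module.End.mul_apply, Module.End.mul_apply] at this
    rw [← this, h, map_smul]
  obtain ⟨h3, h4⟩ := Fock.mem_sector _ |>.1 hu
  have h5 := hc hP.deg h3
  have h6 := hc hP.Fp_Fm h4
  rw [Module.End.mul_apply] at h6
  have h7 : totalParity n (totalParity n u) = u := LinearMap.congr_fun hP.sq u
  rw [mem_partModule, incl_proj, Fock.mem_part]
  simp only [map_smul, map_add, h3, h4, h5, h6, h7]
  refine ⟨by module, by module, ?_⟩
  linear_combination (norm := module) (-(1 / 2) * h2) • totalParity n u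

lemma iSup_partModule (s : Fin 2) : ⨆ p : Xi n,
    ((partModule s p.1.1 p.1.2 : LieSubmodule ℂ (SpC n) (SpinorForms n s)) :
      Submodule ℂ (SpinorForms n s)) = ⊤ := by
  have hle : (⊤ : Submodule ℂ (TotalForms n)) ≤ (⨆ p : Xi n,
      ((partModule s p.1.1 p.1.2 : LieSubmodule ℂ (SpC n) (SpinorForms n s)) :
        Submodule ℂ (SpinorForms n s))).comap (proj n s) := by
    have hsec : ∀ i j, (i, j) ∈ Xi n → (totalFock n).sector i j ≤ (⨆ p : Xi n,
        ((partModule s p.1.1 p.1.2 : LieSubmodule ℂ (SpC n) (SpinorForms n s)) :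
          Submodule ℂ (SpinorForms n s))).comap (proj n s) := fun i j hp u hu =>
      Submodule.mem_iSup_of_mem (⟨(i, j), hp⟩ : Xi n) (proj_mem_partModule s hu)
    rw [← (totalFock n).iSup_eigenspace_deg]
    refine iSup_le fun i u hu => ?_
    replace hu := Module.End.mem_eigenspace_iff.1 hu
    rcases Nat.lt_or_ge n i with h | h
    · exact (iSup₂_le fun j hj =>
          hsec i j (Or.inr ⟨h, by dsimp only; omega, by dsimp only; omega⟩) :
        ⨆ j, ⨆ _ : i + j ≤ 2 * n, (totalFock n).sector i j ≤ _)
          (Fock.mem_iSup_sector_of_ge h.le hu)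
    · exact (iSup₂_le fun j hj => hsec i j (Or.inl ⟨h, hj⟩) :
        ⨆ j, ⨆ _ : j ≤ i, (totalFock n).sector i j ≤ _) (Fock.mem_iSup_sector_of_le h hu)
  rw [eq_top_iff]
  intro w _
  have := hle (Submodule.mem_top (x := incl n s w))
  rwa [Submodule.mem_comap, proj_incl] at this

lemma partModule_le_degreePart_iff (hn : 0 < n) (s : Fin 2) {p : ℕ × ℕ} (hp : p ∈ Xi n) (i : ℕ) :
    ((partModule s p.1 p.2 : LieSubmodule ℂ (SpC n) (SpinorForms n s)) :
      Submodule ℂ (SpinorForms n s)) ≤ degreePart n s i ↔ p.1 = i := by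
  refine ⟨fun h => ?_, fun h => h ▸ partModule_le_degreePart s _ _⟩
  obtain ⟨w, hw, -⟩ :=
    (isIrreducibleHighestWeightModule_partModule hn s hp).exists_highestWeightVector
  have h1 := mem_degreePart.1 (h w.2)
  rw [mem_degreePart.1 (partModule_le_degreePart s p.1 p.2 w.2)] at h1
  have h2 : incl n s w.1 ≠ 0 := fun h0 =>
    hw (Subtype.ext (incl_injective s (h0.trans (map_zero _).symm)))
  exact_mod_cast smul_left_injective ℂ h2 h1

lemma ncard_fst_eq {i : ℕ} (hi : i ≤ n) :
    {q : Fin 2 × Xi n | q.2.1.1 = i}.ncard = 2 * (i + 1) := by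
  have h : {q : Fin 2 × Xi n | q.2.1.1 = i} = Set.range fun r : Fin 2 × Fin (i + 1) =>
      (r.1, (⟨(i, r.2), Or.inl ⟨hi, Nat.lt_succ_iff.1 r.2.2⟩⟩ : Xi n)) := by
    ext ⟨s, ⟨⟨i', j⟩, hp⟩⟩
    constructor
    · intro (h : i' = i)
      subst h
      exact ⟨(s, ⟨j, Nat.lt_succ_iff.2 (mem_Xi hp).2.1⟩), rfl⟩
    · rintro ⟨r, hr⟩
      exact (congrArg (fun q : Fin 2 × Xi n => q.2.1.1) hr).symm
  rw [h, ← Set.image_univ, Set.ncard_image_of_injective, Set.ncard_univ, Nat.card_eq_fintype_card,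
    Fintype.card_prod, Fintype.card_fin, Fintype.card_fin]
  rintro ⟨s, j⟩ ⟨s', j'⟩ h
  have h1 := (Prod.ext_iff.1 h).1
  have h2 := congrArg (fun q : Fin 2 × Xi n => q.2.1.2) h
  exact Prod.ext h1 (Fin.ext h2)

end SymplecticSpinor

theorem theorem9 (n : ℕ) (hn : 1 ≤ n) :
    ∃ E : (s : Fin 2) → Xi n → LieSubmodule ℂ (SpC n) (SpinorForms n s),
      (∀ s (p : Xi n), ((E s p : LieSubmodule ℂ (SpC n) (SpinorForms n s)) :
          Submodule ℂ (SpinorForms n s)) ≤ degreePart n s p.1.1) ∧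
      (∀ s (p : Xi n),
        IsIrreducibleHighestWeightModule (E s p) (spinorWeight n s p.1.1 p.1.2)) ∧
      (∀ s, DirectSum.IsInternal fun p : Xi n =>
        ((E s p : LieSubmodule ℂ (SpC n) (SpinorForms n s)) :
          Submodule ℂ (SpinorForms n s))) ∧
      ∀ i ≤ n, {q : Fin 2 × Xi n | ((E q.1 q.2 : LieSubmodule ℂ (SpC n) (SpinorForms n q.1)) :
          Submodule ℂ (SpinorForms n q.1)) ≤ degreePart n q.1 i}.ncard = 2 * (i + 1) := by
  refine ⟨fun s p => partModule s p.1.1 p.1.2, fun s p => partModule_le_degreePart s _ _,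
    fun s p => isIrreducibleHighestWeightModule_partModule hn s p.2, fun s =>
      (DirectSum.isInternal_submodule_iff_iSupIndep_and_iSup_eq_top _).2
        ⟨iSupIndep_partModule s, iSup_partModule s⟩, fun i hi => ?_⟩
  simp only [fun q : Fin 2 × Xi n => partModule_le_degreePart_iff hn q.1 q.2.2 i]
  exact ncard_fst_eq hi
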